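/- **Theorem.** Let $D>4$, let $\eta=\mathrm{diag}(-1,1,\dots,1)$ be the Minkowski metric on $\mathbb R^D$, used to raise and lower indices, and let square brackets denote antisymmetrization with strength one. Consider the following variables, each together with all its (commuting) derivatives $\partial_{\mu_1}\cdots\partial_{\mu_r}$: * the field $T_{\alpha\beta\gamma}$, with $T_{\alpha\beta\gamma}=-T_{\beta\alpha\gamma}$ and $T_{\alpha\beta\gamma}+T_{\beta\gamma\alpha}+T_{\gamma\alpha\beta}=0$ (even, antifield number $0$); * the ghosts $S_{\alpha\beta}=S_{\beta\alpha}$ and $A_{\alpha\beta}=-A_{\beta\alpha}$ (odd, antifield number $0$) and the ghosts of ghosts $C_\alpha$ (even, antifield number $0$); * the antifields $T^{*\alpha\beta\gamma}$, with the same symmetries as $T$ (odd, antifield number $1$), $S^{*\alpha\beta}=S^{*\beta\alpha}$ and $A^{*\alpha\beta}=-A^{*\beta\alpha}$ (even, antifield number $2$), and $C^{*\alpha}$ (odd, antifield number $3$). Fix a real algebra $\mathcal K$ of smooth real functions on $\mathbb R^D$ that contains the constants and is stable under the partial derivatives (for example all smooth functions, all polynomials, or only the constants, i.e. no explicit $x$-dependence).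 Let $\Omega$ be the graded commutative algebra, with coefficients in $\mathcal K$, generated by these variables, their derivatives and the odd generators $dx^\mu$, and free apart from the stated symmetries; its elements are the local forms. Let $\Omega^p_q$ be the space of local forms of form degree $p$ and antifield number $q$. Let $d=dx^\mu\partial_\mu$ be the spacetime exterior derivative, where $\partial_\mu$ is the total derivative (acting also on $\mathcal K$). With $$F_{\alpha\beta\gamma\delta}=\partial_\alpha T_{\beta\gamma\delta}+\partial_\beta T_{\gamma\alpha\delta}+\partial_\gamma T_{\alpha\beta\delta},\qquad E_{\alpha\beta\delta\,\varepsilon\gamma}=\tfrac12(\partial_\varepsilon F_{\alpha\beta\delta\gamma}-\partial_\gamma F_{\alpha\beta\delta\varepsilon}),$$ $$E_{\alpha\beta\gamma}=\eta^{\varepsilon\delta}E_{\alpha\beta\delta\,\varepsilon\gamma},\qquad E_\alpha=\eta^{\beta\gamma}E_{\alpha\beta\gamma},$$ let the Koszul–Tate differential $\delta$ be the left antiderivation of $\Omega$ that commutes with the $\partial_\mu$, vanishes on $\mathcal K$, on the $dx^\mu$ and on $T,S,A,C$, and satisfies $$\delta T^{*\alpha\beta\gamma}=3\bigl(E^{\alpha\beta\gamma}+\eta^{\gamma[\alpha}E^{\beta]}\bigr),\qquad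 \delta S^{*\alpha\beta}=-\partial_\gamma\bigl(T^{*\gamma\alpha\beta}+T^{*\gamma\beta\alpha}\bigr),$$ $$\delta A^{*\alpha\beta}=-3\,\partial_\gamma\bigl(T^{*\gamma\alpha\beta}-T^{*\gamma\beta\alpha}\bigr),\qquad \delta C^{*\alpha}=6\,\partial_\mu S^{*\mu\alpha}+2\,\partial_\mu A^{*\mu\alpha}.$$ Let $H^p_q(\delta|d)$ be the space of all $a\in\Omega^p_q$ such that $\delta a+db=0$ for some $b\in\Omega^{p-1}_{q-1}$, modulo the trivial ones $a=\delta m+dn$ with $m\in\Omega^p_{q+1}$ and $n\in\Omega^{p-1}_q$. Then $$H^D_q(\delta|d)=0\qquad\text{for every } q>3 .$$ -/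

import Mathlib

open scoped TensorProduct ContDiff

noncomputable section

namespace HookGauge

/-! ### Generators -/

/-- The generators of the algebra of local forms of the free `(2,1)` tensor gauge theory in `D`
spacetime dimensions: the field `T`, the ghosts `S`, `A`, the ghosts of ghosts `C`, the antifields
`T*` (`Ts`), `S*` (`Ss`), `A*` (`As`), `C*` (`Cs`), all of them together with all their
derivatives, and the differentials `dx`.  The multiset `k = {μ₁, …, μᵣ}` records the
derivative `∂_{μ₁} ⋯ ∂_{μᵣ}`.  Field and ghost indices are lower ones, antifield
indices are upper ones. -/
inductive Gen (D : ℕ) : Type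
  | T (α β γ : Fin D) (k : Multiset (Fin D))
  | S (α β : Fin D) (k : Multiset (Fin D))
  | A (α β : Fin D) (k : Multiset (Fin D))
  | C (α : Fin D) (k : Multiset (Fin D))
  | Ts (α β γ : Fin D) (k : Multiset (Fin D))
  | Ss (α β : Fin D) (k : Multiset (Fin D))
  | As (α β : Fin D) (k : Multiset (Fin D))
  | Cs (α : Fin D) (k : Multiset (Fin D))
  | dx (μ : Fin D)

namespace Gen

variable {D : ℕ}

/-- Grassmann parity (`0` even, `1` odd). -/
def parity : Gen D → ℕ
  | T _ _ _ _ => 0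
  | S _ _ _ => 1
  | A _ _ _ => 1
  | C _ _ => 0
  | Ts _ _ _ _ => 1
  | Ss _ _ _ => 0
  | As _ _ _ => 0
  | Cs _ _ => 1
  | dx _ => 1

/-- Antifield (antighost) number. -/
def antigh : Gen D → ℤ
  | T _ _ _ _ => 0
  | S _ _ _ => 0
  | A _ _ _ => 0
  | C _ _ => 0
  | Ts _ _ _ _ => 1
  | Ss _ _ _ => 2
  | As _ _ _ => 2
  | Cs _ _ => 3
  | dx _ => 0

/-- Form degree. -/
def formDeg : Gen D → ℤ
  | dx _ => 1
  | _ => 0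

end Gen

open Gen Finsupp

/-- The linear relations (algebraic symmetries) satisfied by the generators: each listed linear
combination of generators is zero. -/
inductive LinRel (D : ℕ) : (Gen D →₀ ℝ) → Prop
  | T_antisymm (α β γ : Fin D) (k : Multiset (Fin D)) :
      LinRel D (single (T α β γ k) 1 + single (T β α γ k) 1)
  | T_cyclic (α β γ : Fin D) (k : Multiset (Fin D)) :
      LinRel D (single (T α β γ k) 1 + single (T β γ α k) 1 + single (T γ α β k) 1)
  | S_symm (α β : Fin D) (k : Multiset (Fin D)) :
      LinRel D (single (S α β k) 1 - single (S β α k) 1)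
  | A_antisymm (α β : Fin D) (k : Multiset (Fin D)) :
      LinRel D (single (A α β k) 1 + single (A β α k) 1)
  | Ts_antisymm (α β γ : Fin D) (k : Multiset (Fin D)) :
      LinRel D (single (Ts α β γ k) 1 + single (Ts β α γ k) 1)
  | Ts_cyclic (α β γ : Fin D) (k : Multiset (Fin D)) :
      LinRel D (single (Ts α β γ k) 1 + single (Ts β γ α k) 1 + single (Ts γ α β k) 1)
  | Ss_symm (α β : Fin D) (k : Multiset (Fin D)) :
      LinRel D (single (Ss α β k) 1 - single (Ss β α k) 1)
  | As_antisymm (α β : Fin D) (k : Multiset (Fin D)) :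
      LinRel D (single (As α β k) 1 + single (As β α k) 1)

/-! ### The graded commutative algebra -/

/-- Relations of the graded commutative algebra: graded commutativity of the generators and the
linear symmetries. -/
inductive Rel (D : ℕ) : FreeAlgebra ℝ (Gen D) → FreeAlgebra ℝ (Gen D) → Prop
  | comm (g h : Gen D) :
      Rel D (FreeAlgebra.ι ℝ g * FreeAlgebra.ι ℝ h)
        ((-1 : ℝ) ^ (g.parity * h.parity) • (FreeAlgebra.ι ℝ h * FreeAlgebra.ι ℝ g))
  | lin (v : Gen D →₀ ℝ) (hv : LinRel D v) :
      Rel D (linearCombination ℝ (FreeAlgebra.ι ℝ) v) 0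

/-- The free graded commutative real algebra on the generators `Gen D` subject to their linear
symmetries, i.e. forms `P_{μ₁⋯μₚ} dx^{μ₁} ⋯ dx^{μₚ}` whose coefficients are polynomials
without explicit `x`-dependence in the fields, ghosts, antifields and their derivatives. -/
def Alg (D : ℕ) : Type := RingQuot (Rel D)

instance (D : ℕ) : Ring (Alg D) := inferInstanceAs (Ring (RingQuot (Rel D)))

instance (D : ℕ) : Algebra ℝ (Alg D) := inferInstanceAs (Algebra ℝ (RingQuot (Rel D)))

/-- The quotient map from the free algebra. -/
def mkAlg (D : ℕ) : FreeAlgebra ℝ (Gen D) →ₐ[ℝ] Alg D := RingQuot.mkAlgHom ℝ (Rel D)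

variable {D : ℕ}

theorem mkAlg_surjective : Function.Surjective (mkAlg D) :=
  RingQuot.mkAlgHom_surjective ℝ (Rel D)

theorem mkAlg_rel {a b : FreeAlgebra ℝ (Gen D)} (h : Rel D a b) : mkAlg D a = mkAlg D b :=
  RingQuot.mkAlgHom_rel ℝ h

/-- The generator `g` as an element of the algebra. -/
def gen (g : Gen D) : Alg D := mkAlg D (FreeAlgebra.ι ℝ g)

theorem gen_comm (g h : Gen D) :
    gen g * gen h = (-1 : ℝ) ^ (g.parity * h.parity) • (gen h * gen g) := by
  have := mkAlg_rel (Rel.comm g h)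
  simpa [gen] using this

theorem gen_lin {v : Gen D →₀ ℝ} (hv : LinRel D v) : linearCombination ℝ gen v = 0 := by
  have := mkAlg_rel (Rel.lin v hv)
  rw [map_zero] at this
  rw [← this]
  exact (Finsupp.apply_linearCombination ℝ (mkAlg D).toLinearMap (FreeAlgebra.ι ℝ) v).symm

/-- `a` has the commutation rule of an element of parity `n` with all generators. -/
def SuperComm (n : ℕ) (a : Alg D) : Prop :=
  ∀ g : Gen D, a * gen g = (-1 : ℝ) ^ (n * g.parity) • (gen g * a)

theorem SuperComm.add {n : ℕ} {a b : Alg D} (ha : SuperComm n a) (hb : SuperComm n b) :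
    SuperComm n (a + b) := fun g => by rw [add_mul, mul_add, smul_add, ha g, hb g]

theorem SuperComm.smul {n : ℕ} {a : Alg D} (c : ℝ) (ha : SuperComm n a) :
    SuperComm n (c • a) := fun g => by
  rw [smul_mul_assoc, mul_smul_comm, ha g, smul_comm]

theorem SuperComm.neg {n : ℕ} {a : Alg D} (ha : SuperComm n a) : SuperComm n (-a) := by
  simpa using ha.smul (-1)

theorem SuperComm.sub {n : ℕ} {a b : Alg D} (ha : SuperComm n a) (hb : SuperComm n b) :
    SuperComm n (a - b) := by simpa [sub_eq_add_neg] using ha.add hb.neg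

theorem SuperComm.zero (n : ℕ) : SuperComm n (0 : Alg D) := fun g => by simp

theorem SuperComm.sum {n : ℕ} {ι : Type} {s : Finset ι} {f : ι → Alg D}
    (h : ∀ i, SuperComm n (f i)) : SuperComm n (∑ i ∈ s, f i) := by
  classical
  induction s using Finset.induction_on with
  | empty => simpa using SuperComm.zero n
  | insert i s hi ih => rw [Finset.sum_insert hi]; exact (h i).add ih

theorem superComm_gen (g : Gen D) : SuperComm g.parity (gen g) := fun h => gen_comm g h

theorem SuperComm.congr {n m : ℕ} {a : Alg D} (h : SuperComm n a) (hnm : n % 2 = m % 2) :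
    SuperComm m a := fun g => by
  rw [h g, pow_mul, pow_mul, neg_one_pow_eq_pow_mod_two (n := n), hnm,
    ← neg_one_pow_eq_pow_mod_two]

/-! ### Graded derivations -/

/-- Prescribed values of a graded derivation of parity `ε` on the generators. -/
structure DerData (D : ℕ) (ε : ℕ) where
  /-- value on a generator -/
  val : Gen D → Alg D
  superComm : ∀ g, SuperComm (g.parity + ε) (val g)
  lin : ∀ v, LinRel D v → linearCombination ℝ val v = 0

/-- The matrix that encodes a generator and the value of the derivation on it. -/
def DerData.mat {ε : ℕ} (X : DerData D ε) (g : Gen D) : Matrix (Fin 2) (Fin 2) (Alg D) :=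
  !![(-1 : ℝ) ^ (ε * g.parity) • gen g, X.val g; 0, gen g]

theorem sign_lin (ε : ℕ) {v : Gen D →₀ ℝ} (hv : LinRel D v) :
    linearCombination ℝ (fun g : Gen D => (-1 : ℝ) ^ (ε * g.parity) • gen g) v = 0 := by
  have h0 := gen_lin hv
  cases hv <;>
    simp only [map_add, map_sub, linearCombination_single, one_smul, Gen.parity,
      ← smul_add] at h0 ⊢ <;>
    first
      | rw [h0, smul_zero]
      | rw [← smul_sub, h0, smul_zero]

theorem mat_linearCombination {ε : ℕ} (X : DerData D ε) (v : Gen D →₀ ℝ) :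
    linearCombination ℝ X.mat v =
      !![linearCombination ℝ (fun g : Gen D => (-1 : ℝ) ^ (ε * g.parity) • gen g) v,
        linearCombination ℝ X.val v; 0, linearCombination ℝ gen v] := by
  induction v using Finsupp.induction_linear with
  | zero => ext i j; fin_cases i <;> fin_cases j <;> simp
  | add f g hf hg => rw [map_add, hf, hg]; ext i j; fin_cases i <;> fin_cases j <;> simp
  | single g c =>
    ext i j; fin_cases i <;> fin_cases j <;> simp [DerData.mat]

/-- The algebra homomorphism `a ↦ !![±a, X a; 0, a]` extending `DerData.mat`. -/
def DerData.hom {ε : ℕ} (X : DerData D ε) : Alg D →ₐ[ℝ] Matrix (Fin 2) (Fin 2) (Alg D) :=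
  RingQuot.liftAlgHom ℝ ⟨FreeAlgebra.lift ℝ X.mat, by
    rintro _ _ (⟨g, h⟩ | ⟨v, hv⟩)
    · have h1 : X.val h * gen g =
          (-1 : ℝ) ^ ((h.parity + ε) * g.parity) • (gen g * X.val h) := X.superComm h g
      have h2 : X.val g * gen h =
          (-1 : ℝ) ^ ((g.parity + ε) * h.parity) • (gen h * X.val g) := X.superComm g h
      have sq : ∀ n : ℕ, ((-1 : ℝ) ^ n) * (-1) ^ n = 1 := fun n => by
        rw [← mul_pow]; simp
      simp only [map_mul, map_smul, FreeAlgebra.lift_ι_apply]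
      ext i j
      fin_cases i <;> fin_cases j
      · simp only [DerData.mat, Matrix.mul_apply, Fin.sum_univ_two]
        simp [gen_comm g h, smul_smul]
        congr 1
        ring
      · simp only [DerData.mat, Matrix.mul_apply, Fin.sum_univ_two]
        simp [h1, h2, smul_smul]
        rw [add_comm]
        congr 2
        · rw [add_mul, pow_add, mul_comm g.parity h.parity]
        · rw [add_mul, pow_add, mul_comm h.parity g.parity, ← mul_assoc, sq, one_mul]
      · simp [DerData.mat, Matrix.mul_apply, Fin.sum_univ_two]
      · simp [DerData.mat, Matrix.mul_apply, Fin.sum_univ_two, gen_comm g h]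
    · have h1 := Finsupp.apply_linearCombination ℝ (FreeAlgebra.lift ℝ X.mat).toLinearMap
        (FreeAlgebra.ι ℝ) v
      have h2 : ((FreeAlgebra.lift ℝ X.mat).toLinearMap ∘ FreeAlgebra.ι ℝ) = X.mat := by
        ext1 g; simp
      rw [h2, AlgHom.toLinearMap_apply] at h1
      rw [h1, map_zero, mat_linearCombination, sign_lin ε hv, X.lin v hv, gen_lin hv]
      ext i j; fin_cases i <;> fin_cases j <;> simp⟩

/-- The left graded derivation of parity `ε` of the algebra with prescribed values on the
generators. -/
def DerData.der {ε : ℕ} (X : DerData D ε) : Alg D →ₗ[ℝ] Alg D :=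
  Matrix.entryLinearMap ℝ (Alg D) (0 : Fin 2) (1 : Fin 2) ∘ₗ X.hom.toLinearMap

theorem DerData.hom_gen {ε : ℕ} (X : DerData D ε) (g : Gen D) : X.hom (gen g) = X.mat g := by
  have h : X.hom (mkAlg D (FreeAlgebra.ι ℝ g)) =
      FreeAlgebra.lift ℝ X.mat (FreeAlgebra.ι ℝ g) := RingQuot.liftAlgHom_mkAlgHom_apply ..
  rw [gen, h, FreeAlgebra.lift_ι_apply]

@[simp]
theorem DerData.der_gen {ε : ℕ} (X : DerData D ε) (g : Gen D) : X.der (gen g) = X.val g := by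
  simp [DerData.der, X.hom_gen, DerData.mat]

/-- Graded Leibniz rule, for left multiplication by a generator. -/
theorem DerData.der_gen_mul {ε : ℕ} (X : DerData D ε) (g : Gen D) (a : Alg D) :
    X.der (gen g * a) = X.val g * a + (-1 : ℝ) ^ (ε * g.parity) • (gen g * X.der a) := by
  have key : X.hom a 1 1 = a := by
    have : ∀ a : Alg D, X.hom a 1 1 = a ∧ X.hom a 1 0 = 0 := by
      intro a
      obtain ⟨a, rfl⟩ := mkAlg_surjective a
      induction a using FreeAlgebra.induction with
      | grade0 r => simp [Matrix.algebraMap_matrix_apply]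
      | grade1 g =>
        change X.hom (gen g) 1 1 = gen g ∧ X.hom (gen g) 1 0 = 0
        simp [X.hom_gen, DerData.mat]
      | mul a b ha hb =>
        simp [Matrix.mul_apply, Fin.sum_univ_two, ha.1, ha.2, hb.1, hb.2]
      | add a b ha hb => simp [ha.1, ha.2, hb.1, hb.2]
    exact (this a).1
  have h : X.der (gen g * a) = (X.hom (gen g) * X.hom a) 0 1 := by
    rw [← map_mul]; rfl
  have h' : X.der a = X.hom a 0 1 := rfl
  rw [h, h', Matrix.mul_apply, Fin.sum_univ_two, key, X.hom_gen, add_comm]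
  simp [DerData.mat]

/-! ### The derivatives `∂_μ` on the generators -/

/-- Value of the derivative `∂_μ` on the generators. -/
def partialVal (μ : Fin D) : Gen D → Alg D
  | T α β γ k => gen (T α β γ (μ ::ₘ k))
  | S α β k => gen (S α β (μ ::ₘ k))
  | A α β k => gen (A α β (μ ::ₘ k))
  | C α k => gen (C α (μ ::ₘ k))
  | Ts α β γ k => gen (Ts α β γ (μ ::ₘ k))
  | Ss α β k => gen (Ss α β (μ ::ₘ k))
  | As α β k => gen (As α β (μ ::ₘ k))
  | Cs α k => gen (Cs α (μ ::ₘ k))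
  | dx _ => 0

def partialData (μ : Fin D) : DerData D 0 where
  val := partialVal μ
  superComm g := by
    cases g
    case dx => exact SuperComm.zero _
    all_goals exact superComm_gen _
  lin v hv := by
    cases hv
    case T_antisymm α β γ k => simpa [partialVal] using gen_lin (LinRel.T_antisymm α β γ (μ ::ₘ k))
    case T_cyclic α β γ k => simpa [partialVal] using gen_lin (LinRel.T_cyclic α β γ (μ ::ₘ k))
    case S_symm α β k => simpa [partialVal] using gen_lin (LinRel.S_symm α β (μ ::ₘ k))
    case A_antisymm α β k => simpa [partialVal] using gen_lin (LinRel.A_antisymm α β (μ ::ₘ k))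
    case Ts_antisymm α β γ k =>
      simpa [partialVal] using gen_lin (LinRel.Ts_antisymm α β γ (μ ::ₘ k))
    case Ts_cyclic α β γ k => simpa [partialVal] using gen_lin (LinRel.Ts_cyclic α β γ (μ ::ₘ k))
    case Ss_symm α β k => simpa [partialVal] using gen_lin (LinRel.Ss_symm α β (μ ::ₘ k))
    case As_antisymm α β k => simpa [partialVal] using gen_lin (LinRel.As_antisymm α β (μ ::ₘ k))

/-! ### The equations of motion -/

/-- Diagonal entries of the Minkowski metric `diag(-1, 1, …, 1)` (equal to those of its inverse). -/
def η (μ : Fin D) : ℝ := if (μ : ℕ) = 0 then -1 else 1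

/-- The components `η^{μν}`. -/
def metric (μ ν : Fin D) : ℝ := if μ = ν then η μ else 0

/-- `∂_k F_{[αβγ]δ}`, with
`F_{[αβγ]δ} = ∂_α T_{[βγ]δ} + ∂_β T_{[γα]δ} + ∂_γ T_{[αβ]δ}`. -/
def Fstr (α β γ δ : Fin D) (k : Multiset (Fin D)) : Alg D :=
  gen (T β γ δ (α ::ₘ k)) + gen (T γ α δ (β ::ₘ k)) + gen (T α β δ (γ ::ₘ k))

/-- `∂_k E_{[αβδ][εγ]}`, with
`E_{[αβδ][εγ]} = ½ (∂_ε F_{[αβδ]γ} - ∂_γ F_{[αβδ]ε})`. -/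
def curv (α β δ ε γ : Fin D) (k : Multiset (Fin D)) : Alg D :=
  (1 / 2 : ℝ) • (Fstr α β δ γ (ε ::ₘ k) - Fstr α β δ ε (γ ::ₘ k))

/-- `∂_k E_{[αβ]γ}`, with `E_{[αβ]γ} = η^{εδ} E_{[αβδ][εγ]}` (the metric is diagonal). -/
def ricci (α β γ : Fin D) (k : Multiset (Fin D)) : Alg D :=
  ∑ δ, η δ • curv α β δ δ γ k

/-- `∂_k E_α`, with `E_α = η^{βγ} E_{[αβ]γ}`. -/
def ricciTr (α : Fin D) (k : Multiset (Fin D)) : Alg D :=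
  ∑ β, η β • ricci α β β k

/-- `∂_k` of the Euler–Lagrange derivative `3 (E^{[αβ]γ} + η^{γ[α} E^{β]})`, where
the bracket antisymmetrizes with strength one and indices are raised with the diagonal metric. -/
def eom (α β γ : Fin D) (k : Multiset (Fin D)) : Alg D :=
  (3 : ℝ) • ((η α * η β * η γ) • ricci α β γ k +
    (1 / 2 : ℝ) • ((metric γ α * η β) • ricciTr β k - (metric γ β * η α) • ricciTr α k))

/-! ### The Koszul–Tate differential -/

/-- Value of the Koszul–Tate differential `δ` on the generators. -/
def koszulVal : Gen D → Alg D
  | Ts α β γ k => eom α β γ k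
  | Ss α β k => -∑ γ, (gen (Ts γ α β (γ ::ₘ k)) + gen (Ts γ β α (γ ::ₘ k)))
  | As α β k => -(3 : ℝ) • ∑ γ, (gen (Ts γ α β (γ ::ₘ k)) - gen (Ts γ β α (γ ::ₘ k)))
  | Cs α k => (6 : ℝ) • ∑ μ, gen (Ss μ α (μ ::ₘ k)) + (2 : ℝ) • ∑ μ, gen (As μ α (μ ::ₘ k))
  | _ => 0

theorem T_anti (α β γ : Fin D) (k : Multiset (Fin D)) :
    gen (T α β γ k) = -gen (T β α γ k) := by
  have := gen_lin (LinRel.T_antisymm α β γ k)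
  simp only [map_add, linearCombination_single, one_smul] at this
  exact eq_neg_of_add_eq_zero_left this

theorem T_cyc (α β γ : Fin D) (k : Multiset (Fin D)) :
    gen (T α β γ k) + gen (T β γ α k) + gen (T γ α β k) = 0 := by
  simpa using gen_lin (LinRel.T_cyclic α β γ k)

theorem Fstr_superComm (α β γ δ : Fin D) (k : Multiset (Fin D)) :
    SuperComm 0 (Fstr α β γ δ k) :=
  ((superComm_gen (T β γ δ _)).add (superComm_gen (T γ α δ _))).add (superComm_gen (T α β δ _))

theorem ricci_superComm (α β γ : Fin D) (k : Multiset (Fin D)) : SuperComm 0 (ricci α β γ k) :=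
  SuperComm.sum fun _ => (((Fstr_superComm _ _ _ _ _).sub (Fstr_superComm _ _ _ _ _)).smul _).smul _

theorem ricciTr_superComm (α : Fin D) (k : Multiset (Fin D)) : SuperComm 0 (ricciTr α k) :=
  SuperComm.sum fun _ => (ricci_superComm _ _ _ _).smul _

theorem eom_superComm (α β γ : Fin D) (k : Multiset (Fin D)) : SuperComm 0 (eom α β γ k) :=
  (((ricci_superComm _ _ _ _).smul _).add ((((ricciTr_superComm _ _).smul _).sub
    ((ricciTr_superComm _ _).smul _)).smul _)).smul _

theorem Fstr_anti (α β γ δ : Fin D) (k : Multiset (Fin D)) :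
    Fstr α β γ δ k = -Fstr β α γ δ k := by
  simp only [Fstr]
  rw [T_anti β γ, T_anti γ α, T_anti α β]
  abel

theorem ricci_anti (α β γ : Fin D) (k : Multiset (Fin D)) : ricci α β γ k = -ricci β α γ k := by
  simp only [ricci, curv, ← Finset.sum_neg_distrib]
  refine Finset.sum_congr rfl fun δ _ => ?_
  rw [Fstr_anti α β, Fstr_anti α β]
  module

theorem ricci_cyc (α β γ : Fin D) (k : Multiset (Fin D)) :
    ricci α β γ k + ricci β γ α k + ricci γ α β k = 0 := by
  simp only [ricci, ← Finset.sum_add_distrib]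
  refine Finset.sum_eq_zero fun δ _ => ?_
  rw [← smul_add, ← smul_add]
  refine smul_eq_zero_of_right _ ?_
  simp only [curv, Fstr, Multiset.cons_swap δ α, Multiset.cons_swap δ β, Multiset.cons_swap δ γ,
    Multiset.cons_swap β α, Multiset.cons_swap γ α, Multiset.cons_swap γ β]
  have a1 := T_cyc β δ γ (α ::ₘ δ ::ₘ k)
  have a2 := T_cyc γ δ α (β ::ₘ δ ::ₘ k)
  have a3 := T_cyc α δ β (γ ::ₘ δ ::ₘ k)
  have b := T_cyc α β γ (δ ::ₘ δ ::ₘ k)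
  rw [T_anti γ β δ] at a1
  rw [T_anti α γ δ] at a2
  rw [T_anti β α δ] at a3
  rw [T_anti β δ δ, T_anti γ δ δ, T_anti α δ δ]
  linear_combination (norm := module) (1 / 2 : ℝ) • (a1 + a2 + a3 + b)

theorem metric_comm (μ ν : Fin D) : metric μ ν = metric ν μ := by
  unfold metric
  by_cases h : μ = ν
  · subst h; rfl
  · rw [if_neg h, if_neg (Ne.symm h)]

theorem eom_anti (α β γ : Fin D) (k : Multiset (Fin D)) : eom α β γ k = -eom β α γ k := by
  simp only [eom]
  rw [ricci_anti α β]
  module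

theorem eom_cyc (α β γ : Fin D) (k : Multiset (Fin D)) :
    eom α β γ k + eom β γ α k + eom γ α β k = 0 := by
  have h := ricci_cyc α β γ k
  simp only [eom]
  rw [metric_comm α β, metric_comm β γ, metric_comm γ α]
  linear_combination (norm := module) (3 * (η α * η β * η γ)) • h

def koszulData : DerData D 1 where
  val := koszulVal
  superComm g := by
    cases g
    case Ts α β γ k => exact (eom_superComm α β γ k).congr (by simp [Gen.parity])
    case Ss α β k =>
      exact (SuperComm.sum fun γ =>
        (superComm_gen (Ts γ α β _)).add (superComm_gen (Ts γ β α _))).neg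
    case As α β k =>
      exact (SuperComm.sum fun γ =>
        (superComm_gen (Ts γ α β _)).sub (superComm_gen (Ts γ β α _))).smul _
    case Cs α k =>
      exact SuperComm.congr (n := 0) (((SuperComm.sum fun μ => superComm_gen (Ss μ α _)).smul _).add
        ((SuperComm.sum fun μ => superComm_gen (As μ α _)).smul _)) (by simp [Gen.parity])
    all_goals exact SuperComm.zero _
  lin v hv := by
    cases hv
    case Ts_antisymm α β γ k => simp [koszulVal, eom_anti α β γ k]
    case Ts_cyclic α β γ k => simpa [koszulVal] using eom_cyc α β γ k
    case Ss_symm α β k => simp [koszulVal, Finset.sum_add_distrib, add_comm]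
    case As_antisymm α β k =>
      simp only [koszulVal, map_add, linearCombination_single, one_smul, ← smul_add,
        ← Finset.sum_add_distrib]
      simp
    all_goals simp [koszulVal]

/-! ### Explicit dependence on the coordinates -/

/-- An admissible class of coefficient functions of the spacetime coordinates `x`: a real algebra
of smooth functions on `ℝ^D` that is stable under the partial derivatives.  The two extreme cases
are all smooth functions and the constants (no explicit `x`-dependence). -/
structure CoeffClass (D : ℕ) where
  /-- the algebra of coefficient functions -/
  alg : Subalgebra ℝ ((Fin D → ℝ) → ℝ)
  smooth : ∀ f ∈ alg, ContDiff ℝ ∞ f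
  stable : ∀ f ∈ alg, ∀ μ : Fin D, (fun x => fderiv ℝ f x (Pi.single μ 1)) ∈ alg

/-- All smooth functions of the coordinates. -/
def CoeffClass.allSmooth (D : ℕ) : CoeffClass D where
  alg :=
    { carrier := {f | ContDiff ℝ ∞ f}
      mul_mem' := fun {f g} (hf : ContDiff ℝ ∞ f) (hg : ContDiff ℝ ∞ g) => hf.mul hg
      add_mem' := fun {f g} (hf : ContDiff ℝ ∞ f) (hg : ContDiff ℝ ∞ g) => hf.add hg
      algebraMap_mem' := fun c => show ContDiff ℝ ∞ (fun _ => c) from contDiff_const }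
  smooth _ hf := hf
  stable f hf μ := by
    have hf : ContDiff ℝ ∞ f := hf
    exact (hf.fderiv_right (m := ∞) (by simp)).clm_apply contDiff_const

/-- The constants: no explicit dependence on the coordinates. -/
def CoeffClass.constants (D : ℕ) : CoeffClass D where
  alg := ⊥
  smooth f hf := by
    obtain ⟨c, rfl⟩ := Algebra.mem_bot.1 hf
    exact contDiff_const
  stable f hf μ := by
    obtain ⟨c, rfl⟩ := Algebra.mem_bot.1 hf
    have : (fun x : Fin D → ℝ =>
        fderiv ℝ (algebraMap ℝ ((Fin D → ℝ) → ℝ) c) x (Pi.single μ 1)) = 0 := by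
      funext x
      have h : fderiv ℝ (algebraMap ℝ ((Fin D → ℝ) → ℝ) c) x = 0 :=
        (hasFDerivAt_const c x).fderiv
      rw [h]; rfl
    rw [this]
    exact zero_mem _

/-- The type of coefficient functions of the class `K`. -/
def CoeffClass.Fn (K : CoeffClass D) : Type := K.alg

instance (K : CoeffClass D) : CommRing K.Fn := inferInstanceAs (CommRing K.alg)

instance (K : CoeffClass D) : Algebra ℝ K.Fn := inferInstanceAs (Algebra ℝ K.alg)

/-- The partial derivative `∂/∂x^μ` on coefficient functions. -/
def CoeffClass.pd (K : CoeffClass D) (μ : Fin D) : K.Fn →ₗ[ℝ] K.Fn where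
  toFun f := ⟨fun x => fderiv ℝ f.1 x (Pi.single μ 1), K.stable f.1 f.2 μ⟩
  map_add' f g := by
    refine Subtype.ext (funext fun x => ?_)
    have hf := (K.smooth f.1 f.2).differentiable (by simp) x
    have hg := (K.smooth g.1 g.2).differentiable (by simp) x
    change fderiv ℝ (f.1 + g.1) x _ = fderiv ℝ f.1 x _ + fderiv ℝ g.1 x _
    rw [fderiv_add hf hg]; rfl
  map_smul' c f := by
    refine Subtype.ext (funext fun x => ?_)
    have hf := (K.smooth f.1 f.2).differentiable (by simp) x
    change fderiv ℝ (c • f.1) x _ = c • fderiv ℝ f.1 x _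
    rw [fderiv_const_smul hf]; rfl

/-! ### Local forms, `δ`, `d` and the cohomology of `δ` modulo `d` -/

/-- Local forms: forms whose coefficients are polynomials in the fields, ghosts, antifields and
finitely many of their derivatives, with coefficient functions of `x` in the class `K`. -/
abbrev LocalForm (K : CoeffClass D) : Type := K.Fn ⊗[ℝ] Alg D

variable (K : CoeffClass D)

/-- The Koszul–Tate differential `δ`; it does not act on the coordinates. -/
def δ : LocalForm K →ₗ[ℝ] LocalForm K :=
  LinearMap.lTensor K.Fn koszulData.der

/-- The total derivative `∂_μ`. -/
def totalDeriv (μ : Fin D) : LocalForm K →ₗ[ℝ] LocalForm K :=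
  LinearMap.rTensor (Alg D) (K.pd μ) + LinearMap.lTensor K.Fn (partialData μ).der

/-- The spacetime exterior derivative `d = dx^μ ∂_μ`. -/
def d : LocalForm K →ₗ[ℝ] LocalForm K :=
  ∑ μ, LinearMap.lTensor K.Fn (LinearMap.mulLeft ℝ (gen (dx μ))) ∘ₗ totalDeriv K μ

/-- Local forms of form degree `p` and antifield number `q` (the zero space if `p < 0` or
`q < 0`). -/
def forms (p q : ℤ) : Submodule ℝ (LocalForm K) :=
  Submodule.span ℝ {a | ∃ (f : K.Fn) (l : List (Gen D)),
    (l.map Gen.formDeg).sum = p ∧ (l.map Gen.antigh).sum = q ∧ a = f ⊗ₜ[ℝ] (l.map gen).prod}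

/-- Cocycles of `δ` modulo `d`: forms `a` of form degree `p` and antifield number `q` such that
`δ a + d b = 0` for some `b` of form degree `p - 1` and antifield number `q - 1`. -/
def cocycles (p q : ℤ) : Submodule ℝ (LocalForm K) where
  carrier := {a | a ∈ forms K p q ∧ ∃ b ∈ forms K (p - 1) (q - 1), δ K a + d K b = 0}
  zero_mem' := ⟨zero_mem _, 0, zero_mem _, by simp⟩
  add_mem' := by
    rintro a a' ⟨ha, b, hb, h⟩ ⟨ha', b', hb', h'⟩
    refine ⟨add_mem ha ha', b + b', add_mem hb hb', ?_⟩
    rw [map_add, map_add, add_add_add_comm, h, h', add_zero]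
  smul_mem' := by
    rintro c a ⟨ha, b, hb, h⟩
    refine ⟨Submodule.smul_mem _ c ha, c • b, Submodule.smul_mem _ c hb, ?_⟩
    rw [map_smul, map_smul, ← smul_add, h, smul_zero]

/-- Trivial cocycles: `δ m + d n`, with `m` of form degree `p` and antifield number `q + 1`, and `n`
of form degree `p - 1` and antifield number `q`. -/
def coboundaries (p q : ℤ) : Submodule ℝ (LocalForm K) :=
  (forms K p (q + 1)).map (δ K) ⊔ (forms K (p - 1) q).map (d K)

/-- The cohomology group `H^p_q(δ|d)`. -/
abbrev H (p q : ℤ) : Type :=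
  cocycles K p q ⧸ (coboundaries K p q).submoduleOf (cocycles K p q)

end HookGauge

end

open scoped TensorProduct ContDiff

noncomputable section

namespace HookGauge

variable {D : ℕ}

/-! ### Graded derivations with values in an algebra over the local forms -/

/-! Let N be the derivation counting the variables other than the dx. On forms of nonzero antifield
number N is invertible by a polynomial in N, and N commutes with δ and the ∂_μ, so a cocycle is a =
N a' with a' again a cocycle modulo d. Euler's formula and integration by parts give a = Σ z_l X_l
up to a divergence, where X_l is the Euler–Lagrange derivative of a' with respect to the variable
z_l (`number_sub_mem_divergences`). In top form degree divergences are d-exact (`divergences_le`).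

Euler–Lagrange derivatives kill divergences, so the cocycle condition becomes the system ±δ X_l +
Σ_m K_lm(-∂) X_m = 0, with K the matrix of δ on the variables (`eulerLagrange_δ`, `dualKoszul`). The
antifield number of X_l is q minus that of z_l, hence at least q - 3 > 0, where δ is acyclic. Since
K couples z_l only to variables one level higher, the system can be solved level by level from the
top: X_l = ±δ y_l + Σ_m K_lm(-∂) y_m (`exists_dualKoszul_eq`). Inserting this in Euler's formula and
moving K back onto the z_l gives a = δ(Σ z_l y_l) + divergence (`mem_coboundaries`).

There remains the acyclicity of δ in nonzero antifield number (`exists_δ_eq`). On the linear part, δ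
is a matrix over the polynomial ring in the derivatives, regarded as momenta p_a. Exactness there
(`koszulLin_exact`) is polynomial tensor calculus: solutions of the field equations have zero trace
(the trace equation carries the factor 3 - D), then zero Ricci tensor, then zero curvature because
p² is not a zero divisor, and exactness of the Koszul complex in form degrees one to three makes
them pure gauge (`exists_eq_gauge`); gauge parameters acting trivially come from the ghosts of
ghosts (`exists_of_gauge_eq_zero`). The self-adjointness of the field equations
(`sum_mul_fieldEq_comm`) relates these equations to δ acting on linear combinations of antifields. A
homotopy on the linear part extends to an odd derivation s of the algebra; δs + sδ is then an even
derivation that is diagonalizable with positive integer eigenvalues in nonzero antifield number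
(`exists_homotopy`). -/

theorem Gen.parity_eq_zero_or_one (g : Gen D) : g.parity = 0 ∨ g.parity = 1 := by
  cases g <;> simp [Gen.parity]

/-- Induction on elements of `Alg D`: it suffices to treat `1`, sums, multiples, and products with
a generator on the left. -/
theorem alg_induction {p : Alg D → Prop} (a : Alg D) (one : p 1)
    (add : ∀ a b, p a → p b → p (a + b)) (smul : ∀ (c : ℝ) a, p a → p (c • a))
    (gen_mul : ∀ g a, p a → p (gen g * a)) : p a := by
  -- Carrying an arbitrary right factor b lets the product case compose, so that only left
  -- multiplication by single generators is ever needed.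
  have key : ∀ (x : FreeAlgebra ℝ (Gen D)) (b : Alg D), p b → p (mkAlg D x * b) := by
    intro x
    induction x using FreeAlgebra.induction with
    | grade0 r =>
      intro b hb
      rw [AlgHom.commutes, ← Algebra.smul_def]
      exact smul r b hb
    | grade1 g => intro b hb; exact gen_mul g b hb
    | mul x y hx hy => intro b hb; rw [map_mul, mul_assoc]; exact hx _ (hy _ hb)
    | add x y hx hy => intro b hb; rw [map_add, add_mul]; exact add _ _ (hx _ hb) (hy _ hb)
  obtain ⟨x, rfl⟩ := mkAlg_surjective a
  simpa using key x 1 one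

/-- Two linear maps agree if they agree on `1` and the agreement is preserved by multiplication
with generators. -/
theorem linearMap_ext_gen_mul {M : Type*} [AddCommGroup M] [Module ℝ M] {f h : Alg D →ₗ[ℝ] M}
    (one : f 1 = h 1) (gen_mul : ∀ g a, f a = h a → f (gen g * a) = h (gen g * a)) : f = h := by
  ext a
  induction a using alg_induction with
  | one => exact one
  | add a b ha hb => rw [map_add, map_add, ha, hb]
  | smul c a ha => rw [map_smul, map_smul, ha]
  | gen_mul g a ha => exact gen_mul g a ha

/-- An algebra homomorphism out of `Alg D` from its values on the generators. -/
def liftAlg {𝒜 : Type*} [Ring 𝒜] [Algebra ℝ 𝒜] (f : Gen D → 𝒜)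
    (comm : ∀ g h, f g * f h = (-1 : ℝ) ^ (g.parity * h.parity) • (f h * f g))
    (lin : ∀ v, LinRel D v → Finsupp.linearCombination ℝ f v = 0) : Alg D →ₐ[ℝ] 𝒜 :=
  RingQuot.liftAlgHom ℝ ⟨FreeAlgebra.lift ℝ f, by
    rintro _ _ (⟨g, h⟩ | ⟨v, hv⟩)
    · simpa using comm g h
    · have h1 := Finsupp.apply_linearCombination ℝ (FreeAlgebra.lift ℝ f).toLinearMap
        (FreeAlgebra.ι ℝ) v
      have h2 : ((FreeAlgebra.lift ℝ f).toLinearMap ∘ FreeAlgebra.ι ℝ) = f := by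
        ext1 g; simp
      rw [h2, AlgHom.toLinearMap_apply] at h1
      rw [h1, map_zero, lin v hv]⟩

theorem liftAlg_gen {𝒜 : Type*} [Ring 𝒜] [Algebra ℝ 𝒜] (f : Gen D → 𝒜) (comm) (lin) (g : Gen D) :
    liftAlg f comm lin (gen g) = f g := by
  have h : liftAlg f comm lin (mkAlg D (FreeAlgebra.ι ℝ g)) =
      FreeAlgebra.lift ℝ f (FreeAlgebra.ι ℝ g) := RingQuot.liftAlgHom_mkAlgHom_apply ..
  rw [gen, h, FreeAlgebra.lift_ι_apply]

/-- The `ε`-th power of the parity automorphism. -/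
def sgn (D ε : ℕ) : Alg D →ₐ[ℝ] Alg D :=
  liftAlg (fun g => (-1 : ℝ) ^ (ε * g.parity) • gen g)
    (fun g h => by
      simp only [smul_mul_smul_comm, gen_comm g h, smul_smul]
      congr 1
      ring)
    (fun _ hv => sign_lin ε hv)

@[simp]
theorem sgn_gen (ε : ℕ) (g : Gen D) : sgn D ε (gen g) = (-1 : ℝ) ^ (ε * g.parity) • gen g :=
  liftAlg_gen ..

/-- The augmentation `Alg D → ℝ`, which sends every generator to zero. -/
def aug (D : ℕ) : Alg D →ₐ[ℝ] ℝ :=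
  liftAlg (fun _ => 0) (fun _ _ => by simp) (fun v _ => by simp [Finsupp.linearCombination_apply])

@[simp]
theorem aug_gen (g : Gen D) : aug D (gen g) = 0 := liftAlg_gen ..

section IsTDer

variable {𝒜 : Type*} [Ring 𝒜] [Algebra ℝ 𝒜]

/-- `X` is a left graded derivation of parity `ε` with values in the algebra `𝒜`, to which
`Alg D` maps by `ι`. -/
structure IsTDer (ι : Alg D →ₐ[ℝ] 𝒜) (ε : ℕ) (X : Alg D →ₗ[ℝ] 𝒜) : Prop where
  one : X 1 = 0
  gen_mul : ∀ g a, X (gen g * a) =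
    X (gen g) * ι a + (-1 : ℝ) ^ (ε * g.parity) • (ι (gen g) * X a)

variable {ι : Alg D →ₐ[ℝ] 𝒜} {ε : ℕ} {X Y : Alg D →ₗ[ℝ] 𝒜}

theorem IsTDer.ext (hX : IsTDer ι ε X) (hY : IsTDer ι ε Y) (h : ∀ g, X (gen g) = Y (gen g)) :
    X = Y :=
  linearMap_ext_gen_mul (by rw [hX.one, hY.one]) fun g a ha => by
    rw [hX.gen_mul, hY.gen_mul, ha, h]

/-- The graded Leibniz rule. -/
theorem IsTDer.mul (hX : IsTDer ι ε X) (u a : Alg D) :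
    X (u * a) = X u * ι a + ι (sgn D ε u) * X a := by
  induction u using alg_induction with
  | one => simp [hX.one]
  | add u v hu hv => rw [add_mul, map_add, hu, hv, map_add, map_add, map_add]; noncomm_ring
  | smul c u hu => simp [hu]
  | gen_mul g u hu =>
    rw [mul_assoc, hX.gen_mul, hX.gen_mul, hu, map_mul, map_mul, map_mul, sgn_gen, map_smul]
    simp only [smul_mul_assoc, mul_add, add_mul, smul_add, mul_assoc, add_assoc]

/-- A graded derivation of parity `ε` from the values on the generators. -/
theorem exists_isTDer (ι : Alg D →ₐ[ℝ] 𝒜) (ε : ℕ) (val : Gen D → 𝒜)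
    (superComm : ∀ g h, val g * ι (gen h) =
      (-1 : ℝ) ^ ((g.parity + ε) * h.parity) • (ι (gen h) * val g))
    (lin : ∀ v, LinRel D v → Finsupp.linearCombination ℝ val v = 0) :
    ∃ X : Alg D →ₗ[ℝ] 𝒜, IsTDer ι ε X ∧ ∀ g, X (gen g) = val g := by
  have sq : ∀ n : ℕ, ((-1 : ℝ) ^ n) * (-1) ^ n = 1 := fun n => by
    rw [← mul_pow]; simp
  -- An algebra homomorphism into upper triangular matrices with diagonal (±ι, ι) has a graded
  -- derivation in its corner, so the universal property of the algebra yields the derivation.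
  let mat : Gen D → Matrix (Fin 2) (Fin 2) 𝒜 := fun g =>
    !![(-1 : ℝ) ^ (ε * g.parity) • ι (gen g), val g; 0, ι (gen g)]
  have mlin : ∀ v : Gen D →₀ ℝ, Finsupp.linearCombination ℝ mat v =
      !![ι (Finsupp.linearCombination ℝ (fun g : Gen D => (-1 : ℝ) ^ (ε * g.parity) • gen g) v),
        Finsupp.linearCombination ℝ val v; 0, ι (Finsupp.linearCombination ℝ gen v)] := by
    intro v
    induction v using Finsupp.induction_linear with
    | zero => ext i j; fin_cases i <;> fin_cases j <;> simp
    | add f g hf hg => rw [map_add, hf, hg]; ext i j; fin_cases i <;> fin_cases j <;> simp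
    | single g c => ext i j; fin_cases i <;> fin_cases j <;> simp [mat]
  let hom : Alg D →ₐ[ℝ] Matrix (Fin 2) (Fin 2) 𝒜 := liftAlg mat (by
    intro g h
    have h1 := superComm h g
    have h2 := superComm g h
    have h3 : ι (gen g) * ι (gen h) =
        (-1 : ℝ) ^ (g.parity * h.parity) • (ι (gen h) * ι (gen g)) := by
      rw [← map_mul, gen_comm g h, map_smul, map_mul]
    ext i j
    fin_cases i <;> fin_cases j
    · simp only [mat, Matrix.mul_apply, Fin.sum_univ_two]
      simp [h3, smul_smul]
      congr 1
      ring
    · simp only [mat, Matrix.mul_apply, Fin.sum_univ_two]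
      simp [h1, h2, smul_smul]
      rw [add_comm]
      congr 2
      · rw [add_mul, pow_add, mul_comm g.parity h.parity]
      · rw [add_mul, pow_add, mul_comm h.parity g.parity, ← mul_assoc, sq, one_mul]
    · simp [mat, Matrix.mul_apply, Fin.sum_univ_two]
    · simp [mat, Matrix.mul_apply, Fin.sum_univ_two, h3]) (by
    intro v hv
    rw [mlin, sign_lin ε hv, lin v hv, gen_lin hv]
    ext i j; fin_cases i <;> fin_cases j <;> simp)
  have hom_gen : ∀ g, hom (gen g) = mat g := fun g => liftAlg_gen ..
  have key : ∀ a, hom a 1 1 = ι a ∧ hom a 1 0 = 0 := by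
    intro a
    induction a using alg_induction with
    | one => simp
    | add a b ha hb => simp [ha.1, ha.2, hb.1, hb.2]
    | smul c a ha => simp [ha.1, ha.2]
    | gen_mul g a ha => simp [Matrix.mul_apply, Fin.sum_univ_two, ha.1, ha.2, hom_gen, mat]
  refine ⟨Matrix.entryLinearMap ℝ 𝒜 (0 : Fin 2) (1 : Fin 2) ∘ₗ hom.toLinearMap, ⟨?_, ?_⟩, ?_⟩
  · simp
  · intro g a
    change hom (gen g * a) 0 1 = hom (gen g) 0 1 * ι a + _ • (ι (gen g) * hom a 0 1)
    rw [map_mul, Matrix.mul_apply, Fin.sum_univ_two, (key a).1, hom_gen, add_comm]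
    simp [mat]
  · intro g
    simp [hom_gen, mat]

end IsTDer

/-- Graded derivations of `Alg D`. -/
abbrev IsDer (ε : ℕ) (X : Alg D →ₗ[ℝ] Alg D) : Prop := IsTDer (AlgHom.id ℝ (Alg D)) ε X

theorem IsTDer.apply_gen_mul {ε : ℕ} {X : Alg D →ₗ[ℝ] Alg D} (hX : IsDer ε X) (g : Gen D)
    (a : Alg D) :
    X (gen g * a) = X (gen g) * a + (-1 : ℝ) ^ (ε * g.parity) • (gen g * X a) := hX.gen_mul g a

theorem DerData.isDer {ε : ℕ} (X : DerData D ε) : IsDer ε X.der where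
  one := by simp [DerData.der]
  gen_mul g a := by simp [X.der_gen_mul]

/-- `a` is homogeneous of parity `n`. -/
def HasParity (n : ℕ) (a : Alg D) : Prop := ∀ ε, sgn D ε a = (-1 : ℝ) ^ (ε * n) • a

theorem hasParity_gen (g : Gen D) : HasParity g.parity (gen g) := fun ε => sgn_gen ε g

theorem HasParity.add {n : ℕ} {a b : Alg D} (ha : HasParity n a) (hb : HasParity n b) :
    HasParity n (a + b) := fun ε => by rw [map_add, ha, hb, smul_add]

theorem HasParity.smul {n : ℕ} {a : Alg D} (c : ℝ) (ha : HasParity n a) :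
    HasParity n (c • a) := fun ε => by rw [map_smul, ha, smul_comm]

theorem HasParity.zero (n : ℕ) : HasParity n (0 : Alg D) := fun ε => by simp

theorem neg_one_pow_mul_congr {n m : ℕ} (h : n % 2 = m % 2) (ε : ℕ) :
    (-1 : ℝ) ^ (ε * n) = (-1) ^ (ε * m) := by
  rw [mul_comm ε, mul_comm ε, pow_mul, pow_mul, neg_one_pow_eq_pow_mod_two (n := n), h,
    ← neg_one_pow_eq_pow_mod_two]

theorem HasParity.congr {n m : ℕ} {a : Alg D} (ha : HasParity n a) (h : n % 2 = m % 2) :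
    HasParity m a := fun ε => by rw [ha, neg_one_pow_mul_congr h]

/-- The graded commutator of two graded derivations is a graded derivation. -/
theorem IsTDer.bracket {ε ε' : ℕ} {X Y : Alg D →ₗ[ℝ] Alg D} (hX : IsDer ε X) (hY : IsDer ε' Y)
    (pX : ∀ g, HasParity (g.parity + ε) (X (gen g)))
    (pY : ∀ g, HasParity (g.parity + ε') (Y (gen g))) :
    IsDer (ε + ε') (X ∘ₗ Y - (-1 : ℝ) ^ (ε * ε') • Y ∘ₗ X) where
  one := by simp [hX.one, hY.one]
  gen_mul g a := by
    have sq : (-1 : ℝ) ^ (ε * ε') * (-1 : ℝ) ^ (ε * ε') = 1 := by rw [← mul_pow]; simp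
    have h1 := hX.gen_mul g a
    have h2 := hY.gen_mul g a
    have h3 := hX.mul (Y (gen g)) a
    have h4 := hY.mul (X (gen g)) a
    have h5 := hX.gen_mul g (Y a)
    have h6 := hY.gen_mul g (X a)
    rw [pY g ε] at h3
    rw [pX g ε'] at h4
    simp only [AlgHom.id_apply] at h1 h2 h3 h4 h5 h6 ⊢
    simp only [LinearMap.sub_apply, LinearMap.smul_apply, LinearMap.comp_apply, h1, h2, map_add,
      map_smul, h3, h4, h5, h6, smul_add, smul_mul_assoc, mul_sub, sub_mul, smul_sub, mul_smul_comm,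
      smul_smul, mul_add, add_mul, pow_add, mul_comm ε' ε]
    generalize (-1 : ℝ) ^ (ε * ε') = s at *
    generalize (-1 : ℝ) ^ (ε * g.parity) = s1
    generalize (-1 : ℝ) ^ (ε' * g.parity) = s2
    have : s * (s2 * s) = s2 := by linear_combination s2 * sq
    rw [this]
    module

/-! ### Degrees -/

/-- Forms without explicit dependence on the coordinates, of form degree `p` and antifield
number `q`. -/
def formsA (D : ℕ) (p q : ℤ) : Submodule ℝ (Alg D) :=
  Submodule.span ℝ {a | ∃ l : List (Gen D),
    (l.map Gen.formDeg).sum = p ∧ (l.map Gen.antigh).sum = q ∧ a = (l.map gen).prod}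

theorem one_mem_formsA : (1 : Alg D) ∈ formsA D 0 0 :=
  Submodule.subset_span ⟨[], by simp⟩

theorem gen_mem_formsA (g : Gen D) : gen g ∈ formsA D g.formDeg g.antigh :=
  Submodule.subset_span ⟨[g], by simp⟩

theorem mul_mem_formsA {p q p' q' : ℤ} {a b : Alg D} (ha : a ∈ formsA D p q)
    (hb : b ∈ formsA D p' q') : a * b ∈ formsA D (p + p') (q + q') := by
  induction ha using Submodule.span_induction with
  | mem a ha =>
    obtain ⟨l, hl, hl', rfl⟩ := ha
    induction hb using Submodule.span_induction with
    | mem b hb =>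
      obtain ⟨l', h1, h2, rfl⟩ := hb
      exact Submodule.subset_span ⟨l ++ l', by simp [hl, h1], by simp [hl', h2], by simp⟩
    | zero => simp
    | add b c _ _ hb hc => rw [mul_add]; exact add_mem hb hc
    | smul r b _ hb => rw [mul_smul_comm]; exact Submodule.smul_mem _ _ hb
  | zero => simp
  | add a c _ _ ha hc => rw [add_mul]; exact add_mem ha hc
  | smul r a _ ha => rw [smul_mul_assoc]; exact Submodule.smul_mem _ _ ha

/-- A derivation shifts the degrees if it does so on the generators. -/
theorem IsTDer.mem_formsA {ε : ℕ} {X : Alg D →ₗ[ℝ] Alg D} (hX : IsDer ε X) {dp dq : ℤ}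
    (h : ∀ g : Gen D, X (gen g) ∈ formsA D (g.formDeg + dp) (g.antigh + dq)) {p q : ℤ}
    {a : Alg D} (ha : a ∈ formsA D p q) : X a ∈ formsA D (p + dp) (q + dq) := by
  induction ha using Submodule.span_induction with
  | mem a ha =>
    obtain ⟨l, rfl, rfl, rfl⟩ := ha
    induction l with
    | nil => simp [hX.one]
    | cons g l ih =>
      simp only [List.map_cons, List.prod_cons, List.sum_cons]
      rw [hX.apply_gen_mul]
      refine add_mem ?_ (Submodule.smul_mem _ _ ?_)
      · have := mul_mem_formsA (h g) (b := (l.map gen).prod) (Submodule.subset_span ⟨l, rfl, rfl, rfl⟩)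
        convert this using 1
        congr 1 <;> ring
      · have := mul_mem_formsA (gen_mem_formsA g) ih
        convert this using 1
        congr 1 <;> ring
  | zero => simp
  | add a c _ _ ha hc => rw [map_add]; exact add_mem ha hc
  | smul r a _ ha => rw [map_smul]; exact Submodule.smul_mem _ _ ha

/-! ### Labels of the undifferentiated fields and the Young projector -/

/-- Labels of the undifferentiated fields, ghosts and antifields. -/
inductive Lab (D : ℕ) : Type
  | T (α β γ : Fin D)
  | S (α β : Fin D)
  | A (α β : Fin D)
  | C (α : Fin D)
  | Ts (α β γ : Fin D)
  | Ss (α β : Fin D)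
  | As (α β : Fin D)
  | Cs (α : Fin D)

/-- The labels as a sum type. -/
def labEquiv (D : ℕ) : ((Fin D × Fin D × Fin D) ⊕ (Fin D × Fin D) ⊕ (Fin D × Fin D) ⊕ Fin D) ⊕
    ((Fin D × Fin D × Fin D) ⊕ (Fin D × Fin D) ⊕ (Fin D × Fin D) ⊕ Fin D) ≃ Lab D where
  toFun
    | .inl (.inl (a, b, c)) => .T a b c
    | .inl (.inr (.inl (a, b))) => .S a b
    | .inl (.inr (.inr (.inl (a, b)))) => .A a b
    | .inl (.inr (.inr (.inr a))) => .C a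
    | .inr (.inl (a, b, c)) => .Ts a b c
    | .inr (.inr (.inl (a, b))) => .Ss a b
    | .inr (.inr (.inr (.inl (a, b)))) => .As a b
    | .inr (.inr (.inr (.inr a))) => .Cs a
  invFun
    | .T a b c => .inl (.inl (a, b, c))
    | .S a b => .inl (.inr (.inl (a, b)))
    | .A a b => .inl (.inr (.inr (.inl (a, b))))
    | .C a => .inl (.inr (.inr (.inr a)))
    | .Ts a b c => .inr (.inl (a, b, c))
    | .Ss a b => .inr (.inr (.inl (a, b)))
    | .As a b => .inr (.inr (.inr (.inl (a, b))))
    | .Cs a => .inr (.inr (.inr (.inr a)))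
  left_inv x := by rcases x with (x | x | x | x) | (x | x | x | x) <;> rfl
  right_inv x := by cases x <;> rfl

instance : Fintype (Lab D) := Fintype.ofEquiv _ (labEquiv D)

instance : DecidableEq (Lab D) := Classical.decEq _

theorem sum_lab {M : Type*} [AddCommMonoid M] (f : Lab D → M) :
    ∑ l, f l = ((∑ a, ∑ b, ∑ c, f (.T a b c)) + ((∑ a, ∑ b, f (.S a b)) +
      ((∑ a, ∑ b, f (.A a b)) + ∑ a, f (.C a)))) +
      ((∑ a, ∑ b, ∑ c, f (.Ts a b c)) + ((∑ a, ∑ b, f (.Ss a b)) +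
      ((∑ a, ∑ b, f (.As a b)) + ∑ a, f (.Cs a)))) := by
  rw [← (labEquiv D).sum_comp]
  simp only [Fintype.sum_sum_type, Fintype.sum_prod_type]
  rfl

/-- The derivative `∂_k` of the variable with label `l`. -/
def Lab.at : Lab D → Multiset (Fin D) → Gen D
  | .T a b c, k => .T a b c k
  | .S a b, k => .S a b k
  | .A a b, k => .A a b k
  | .C a, k => .C a k
  | .Ts a b c, k => .Ts a b c k
  | .Ss a b, k => .Ss a b k
  | .As a b, k => .As a b k
  | .Cs a, k => .Cs a k

/-- The kind of a variable. -/
def Lab.kind : Lab D → ℕ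
  | .T _ _ _ => 0
  | .S _ _ => 1
  | .A _ _ => 2
  | .C _ => 3
  | .Ts _ _ _ => 4
  | .Ss _ _ => 5
  | .As _ _ => 6
  | .Cs _ => 7

/-- Grassmann parity. -/
def Lab.parity (l : Lab D) : ℕ := (l.at 0).parity

/-- Antifield number. -/
def Lab.antigh (l : Lab D) : ℤ := (l.at 0).antigh

/-- The level of a variable: its antifield number, except that the ghosts, on which the
Koszul–Tate differential acts trivially, are set apart at level `5`. -/
def Lab.lev : Lab D → ℕ
  | .T _ _ _ => 0
  | .S _ _ => 5
  | .A _ _ => 5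
  | .C _ => 5
  | .Ts _ _ _ => 1
  | .Ss _ _ => 2
  | .As _ _ => 2
  | .Cs _ => 3

@[simp]
theorem parity_at (l : Lab D) (k : Multiset (Fin D)) : (l.at k).parity = l.parity := by
  cases l <;> rfl

@[simp]
theorem antigh_at (l : Lab D) (k : Multiset (Fin D)) : (l.at k).antigh = l.antigh := by
  cases l <;> rfl

@[simp]
theorem formDeg_at (l : Lab D) (k : Multiset (Fin D)) : (l.at k).formDeg = 0 := by
  cases l <;> rfl

theorem Lab.parity_eq_of_kind {l m : Lab D} (h : l.kind = m.kind) : l.parity = m.parity := by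
  cases l <;> cases m <;> first | rfl | simp [Lab.kind] at h

theorem Lab.antigh_eq_of_kind {l m : Lab D} (h : l.kind = m.kind) : l.antigh = m.antigh := by
  cases l <;> cases m <;> first | rfl | simp [Lab.kind] at h

theorem Lab.lev_eq_of_kind {l m : Lab D} (h : l.kind = m.kind) : l.lev = m.lev := by
  cases l <;> cases m <;> first | rfl | simp [Lab.kind] at h

/-- This is why the ghosts sit at level 5: levels 4 and 6 are empty, so a ghost is never adjacent to
another variable, and neighbouring levels always differ by one unit of antifield number and by
parity. -/
theorem Lab.parity_add_one_of_lev {l m : Lab D} (h : m.lev = l.lev + 1) :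
    m.parity % 2 = (l.parity + 1) % 2 := by
  cases l <;> cases m <;> simp_all [Lab.lev, Lab.parity, Lab.at, Gen.parity]

theorem Lab.antigh_add_one_of_lev {l m : Lab D} (h : m.lev = l.lev + 1) :
    m.antigh = l.antigh + 1 := by
  cases l <;> cases m <;> simp_all [Lab.lev, Lab.antigh, Lab.at, Gen.antigh]

theorem Gen.eq_dx_or_at (g : Gen D) : (∃ μ, g = .dx μ) ∨ ∃ l : Lab D, ∃ k, g = l.at k := by
  cases g with
  | T a b c k => exact .inr ⟨.T a b c, k, rfl⟩
  | S a b k => exact .inr ⟨.S a b, k, rfl⟩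
  | A a b k => exact .inr ⟨.A a b, k, rfl⟩
  | C a k => exact .inr ⟨.C a, k, rfl⟩
  | Ts a b c k => exact .inr ⟨.Ts a b c, k, rfl⟩
  | Ss a b k => exact .inr ⟨.Ss a b, k, rfl⟩
  | As a b k => exact .inr ⟨.As a b, k, rfl⟩
  | Cs a k => exact .inr ⟨.Cs a, k, rfl⟩
  | dx μ => exact .inl ⟨μ, rfl⟩

section Young

variable {M N : Type*} [AddCommGroup M] [Module ℝ M] [AddCommGroup N] [Module ℝ N]

/-- The projector onto tensors that are antisymmetric in the first two indices and have vanishing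
cyclic sum. -/
def hook (x : Fin D → Fin D → Fin D → M) (a b c : Fin D) : M :=
  (1 / 3 : ℝ) • (x a b c - x b a c) - (1 / 6 : ℝ) • (x b c a - x c b a + x c a b - x a c b)

/-- The projector onto families of tensors with the symmetries of the generators. -/
def young : (Lab D → M) →ₗ[ℝ] (Lab D → M) where
  toFun v
    | .T a b c => hook (fun a b c => v (.T a b c)) a b c
    | .S a b => (1 / 2 : ℝ) • (v (.S a b) + v (.S b a))
    | .A a b => (1 / 2 : ℝ) • (v (.A a b) - v (.A b a))
    | .C a => v (.C a)
    | .Ts a b c => hook (fun a b c => v (.Ts a b c)) a b c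
    | .Ss a b => (1 / 2 : ℝ) • (v (.Ss a b) + v (.Ss b a))
    | .As a b => (1 / 2 : ℝ) • (v (.As a b) - v (.As b a))
    | .Cs a => v (.Cs a)
  map_add' v w := by
    funext l; cases l <;> simp only [hook, Pi.add_apply] <;> module
  map_smul' r v := by
    funext l; cases l <;> simp only [hook, Pi.smul_apply, RingHom.id_apply] <;> module

/-- The symmetries of the generators, for families of tensors with values in a module. -/
structure IsSym (v : Lab D → M) : Prop where
  T_anti : ∀ a b c, v (.T a b c) = -v (.T b a c)
  T_cyc : ∀ a b c, v (.T a b c) + v (.T b c a) + v (.T c a b) = 0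
  S_symm : ∀ a b, v (.S a b) = v (.S b a)
  A_anti : ∀ a b, v (.A a b) = -v (.A b a)
  Ts_anti : ∀ a b c, v (.Ts a b c) = -v (.Ts b a c)
  Ts_cyc : ∀ a b c, v (.Ts a b c) + v (.Ts b c a) + v (.Ts c a b) = 0
  Ss_symm : ∀ a b, v (.Ss a b) = v (.Ss b a)
  As_anti : ∀ a b, v (.As a b) = -v (.As b a)

theorem hook_of_symm {x : Fin D → Fin D → Fin D → M} (h1 : ∀ a b c, x a b c = -x b a c)
    (h2 : ∀ a b c, x a b c + x b c a + x c a b = 0) (a b c : Fin D) : hook x a b c = x a b c := by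
  have e := h2 a b c
  rw [hook, h1 b a c, h1 c b a, h1 a c b]
  linear_combination (norm := module) (-1 / 3 : ℝ) • e

theorem IsSym.young_eq {v : Lab D → M} (h : IsSym v) : young v = v := by
  funext l
  cases l with
  | T a b c => exact hook_of_symm h.T_anti h.T_cyc a b c
  | S a b => simp only [young, LinearMap.coe_mk, AddHom.coe_mk, h.S_symm b a]; module
  | A a b => simp only [young, LinearMap.coe_mk, AddHom.coe_mk, h.A_anti b a]; module
  | C a => rfl
  | Ts a b c => exact hook_of_symm h.Ts_anti h.Ts_cyc a b c
  | Ss a b => simp only [young, LinearMap.coe_mk, AddHom.coe_mk, h.Ss_symm b a]; module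
  | As a b => simp only [young, LinearMap.coe_mk, AddHom.coe_mk, h.As_anti b a]; module
  | Cs a => rfl

theorem isSym_young (v : Lab D → M) : IsSym (young v) := by
  constructor <;> intros <;> simp only [young, LinearMap.coe_mk, AddHom.coe_mk, hook] <;> module

theorem isSym_iff {v : Lab D → M} : IsSym v ↔ young v = v :=
  ⟨fun h => h.young_eq, fun h => h ▸ isSym_young v⟩

theorem young_young (v : Lab D → M) : young (young v) = young v := (isSym_young v).young_eq

theorem young_map (f : M →ₗ[ℝ] N) (v : Lab D → M) :
    young (fun l => f (v l)) = fun l => f (young v l) := by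
  funext l
  cases l <;> simp [young, hook]

/-- `young` does not mix different kinds of variables. -/
theorem young_eq_zero_of_kind {v : Lab D → M} {l : Lab D}
    (h : ∀ m : Lab D, m.kind = l.kind → v m = 0) : young v l = 0 := by
  cases l <;> simp only [Lab.kind] at h <;>
    simp only [young, LinearMap.coe_mk, AddHom.coe_mk, hook] <;> simp [h]

/-- `hook` is a weighted sum of index permutations in which mutually inverse permutations have equal
weight (both 3-cycles carry -1/6), so relabelling the summation indices moves it to the other
factor. -/
theorem sum_hook_adjoint (ψ : Fin D → Fin D → Fin D → (N →ₗ[ℝ] M)) (x : Fin D → Fin D → Fin D → N) :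
    ∑ a, ∑ b, ∑ c, ψ a b c (hook x a b c) = ∑ a, ∑ b, ∑ c, hook ψ a b c (x a b c) := by
  have s12 : ∀ f : Fin D → Fin D → Fin D → M,
      ∑ a, ∑ b, ∑ c, f b a c = ∑ a, ∑ b, ∑ c, f a b c := fun f => Finset.sum_comm
  have s23 : ∀ f : Fin D → Fin D → Fin D → M,
      ∑ a, ∑ b, ∑ c, f a c b = ∑ a, ∑ b, ∑ c, f a b c := fun f =>
    Finset.sum_congr rfl fun a _ => Finset.sum_comm
  have c1 : ∀ f : Fin D → Fin D → Fin D → M,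
      ∑ a, ∑ b, ∑ c, f b c a = ∑ a, ∑ b, ∑ c, f a b c := fun f => by
    rw [s12 fun a b c => f a c b, s23]
  have c2 : ∀ f : Fin D → Fin D → Fin D → M,
      ∑ a, ∑ b, ∑ c, f c a b = ∑ a, ∑ b, ∑ c, f a b c := fun f => by
    rw [s23 fun a b c => f b a c, s12]
  have s13 : ∀ f : Fin D → Fin D → Fin D → M,
      ∑ a, ∑ b, ∑ c, f c b a = ∑ a, ∑ b, ∑ c, f a b c := fun f => by
    rw [c1 fun a b c => f b a c, s12]
  simp only [hook, map_sub, map_add, map_smul, LinearMap.sub_apply, LinearMap.add_apply,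
    LinearMap.smul_apply, Finset.sum_sub_distrib, Finset.sum_add_distrib, ← Finset.smul_sum]
  rw [← s12 fun a b c => ψ a b c (x b a c), ← s13 fun a b c => ψ a b c (x c b a),
    ← s23 fun a b c => ψ a b c (x a c b), ← c1 fun a b c => ψ a b c (x c a b),
    ← c2 fun a b c => ψ a b c (x b c a)]
  module

/-- `young` is self-adjoint. -/
theorem sum_young_adjoint (ψ : Lab D → (N →ₗ[ℝ] M)) (v : Lab D → N) :
    ∑ l, ψ l (young v l) = ∑ l, young ψ l (v l) := by
  have s : ∀ f : Fin D → Fin D → M, ∑ a, ∑ b, f b a = ∑ a, ∑ b, f a b :=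
    fun f => Finset.sum_comm
  rw [sum_lab, sum_lab]
  simp only [young, LinearMap.coe_mk, AddHom.coe_mk]
  rw [sum_hook_adjoint (fun a b c => ψ (.T a b c)), sum_hook_adjoint (fun a b c => ψ (.Ts a b c))]
  simp only [map_sub, map_add, map_smul, LinearMap.sub_apply, LinearMap.add_apply,
    LinearMap.smul_apply, Finset.sum_sub_distrib, Finset.sum_add_distrib, ← Finset.smul_sum]
  rw [← s fun a b => ψ (.S a b) (v (.S b a)), ← s fun a b => ψ (.A a b) (v (.A b a)),
    ← s fun a b => ψ (.Ss a b) (v (.Ss b a)), ← s fun a b => ψ (.As a b) (v (.As b a))]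

theorem sum_apply_single (ψ : Lab D → (N →ₗ[ℝ] M)) (l : Lab D) (x : N) :
    ∑ m, ψ m (Pi.single (M := fun _ => N) l x m) = ψ l x := by
  rw [Finset.sum_eq_single l]
  · simp
  · intro m _ hm; simp [hm]
  · simp

/-- An element in the kernel of all families of linear maps with the symmetries is in the kernel of
the projector. -/
theorem young_eq_zero {v : Lab D → M}
    (h : ∀ ψ : Lab D → (M →ₗ[ℝ] M), IsSym ψ → ∑ l, ψ l (v l) = 0) : young v = 0 := by
  funext l
  -- The test family is the Young projection of the l-th coordinate; by self-adjointness it reads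
  -- off the component l of `young v`.
  have := h _ (isSym_young (Pi.single l LinearMap.id))
  rw [← sum_young_adjoint, Finset.sum_eq_single l] at this
  · simpa using this
  · intro m _ hm; simp [hm]
  · simp

end Young

/-! ### The linear part of the algebra as a module over the differential operators -/

/-- Constant coefficient differential operators: polynomials in the derivatives. -/
abbrev Op (D : ℕ) : Type := MvPolynomial (Fin D) ℝ

/-- The operator `∂_k`. -/
def mono (k : Multiset (Fin D)) : Op D := MvPolynomial.monomial (Multiset.toFinsupp k) 1

theorem mono_zero : mono (0 : Multiset (Fin D)) = 1 := by simp [mono]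

theorem mono_cons (μ : Fin D) (k : Multiset (Fin D)) :
    mono (μ ::ₘ k) = MvPolynomial.X μ * mono k := by
  rw [mono, ← Multiset.singleton_add, map_add, Multiset.toFinsupp_singleton, MvPolynomial.X, mono,
    MvPolynomial.monomial_mul, one_mul]

theorem op_induction {p : Op D → Prop} (r : Op D) (mono : ∀ k, p (mono k))
    (add : ∀ r s, p r → p s → p (r + s)) (smul : ∀ (c : ℝ) r, p r → p (c • r)) : p r := by
  induction r using MvPolynomial.induction_on' with
  | monomial u a =>
    have : MvPolynomial.monomial u a = a • HookGauge.mono (Finsupp.toMultiset u) := by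
      rw [HookGauge.mono, Finsupp.toMultiset_toFinsupp, MvPolynomial.smul_monomial, smul_eq_mul,
        mul_one]
    rw [this]
    exact smul _ _ (mono _)
  | add r s hr hs => exact add _ _ hr hs

theorem op_linearMap_ext {M : Type*} [AddCommGroup M] [Module ℝ M] {f h : Op D →ₗ[ℝ] M}
    (H : ∀ k, f (mono k) = h (mono k)) : f = h := by
  refine LinearMap.ext fun r => ?_
  induction r using op_induction with
  | mono k => exact H k
  | add r s hr hs => rw [map_add, map_add, hr, hs]
  | smul c r hr => rw [map_smul, map_smul, hr]

/-- The derivatives `r ↦ r(∂) z` of the variable `z` with label `l`. -/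
def genOp (l : Lab D) : Op D →ₗ[ℝ] Alg D :=
  (MvPolynomial.basisMonomials (Fin D) ℝ).constr ℝ fun s => gen (l.at (Finsupp.toMultiset s))

@[simp]
theorem genOp_mono (l : Lab D) (k : Multiset (Fin D)) : genOp l (mono k) = gen (l.at k) := by
  have := (MvPolynomial.basisMonomials (Fin D) ℝ).constr_basis ℝ
    (fun s => gen (l.at (Finsupp.toMultiset s))) (Multiset.toFinsupp k)
  simpa [genOp, mono] using this

theorem linRel_eq_zero {M : Type*} [AddCommGroup M] [Module ℝ M] {f : Gen D → M}
    (h : ∀ k, IsSym fun l : Lab D => f (l.at k)) {v : Gen D →₀ ℝ} (hv : LinRel D v) :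
    Finsupp.linearCombination ℝ f v = 0 := by
  cases hv with
  | T_antisymm a b c k => simp [show f (.T a b c k) = _ from (h k).T_anti a b c, Lab.at]
  | T_cyclic a b c k => simpa [Lab.at] using (h k).T_cyc a b c
  | S_symm a b k => simp [show f (.S a b k) = _ from (h k).S_symm a b, Lab.at]
  | A_antisymm a b k => simp [show f (.A a b k) = _ from (h k).A_anti a b, Lab.at]
  | Ts_antisymm a b c k => simp [show f (.Ts a b c k) = _ from (h k).Ts_anti a b c, Lab.at]
  | Ts_cyclic a b c k => simpa [Lab.at] using (h k).Ts_cyc a b c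
  | Ss_symm a b k => simp [show f (.Ss a b k) = _ from (h k).Ss_symm a b, Lab.at]
  | As_antisymm a b k => simp [show f (.As a b k) = _ from (h k).As_anti a b, Lab.at]

theorem isSym_of_linRel {M : Type*} [AddCommGroup M] [Module ℝ M] {f : Gen D → M}
    (h : ∀ v, LinRel D v → Finsupp.linearCombination ℝ f v = 0) (k : Multiset (Fin D)) :
    IsSym fun l : Lab D => f (l.at k) where
  T_anti a b c := by
    have := h _ (.T_antisymm a b c k)
    exact eq_neg_of_add_eq_zero_left (by simpa [Lab.at] using this)
  T_cyc a b c := by simpa [Lab.at] using h _ (.T_cyclic a b c k)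
  S_symm a b := by simpa [sub_eq_zero, Lab.at] using h _ (.S_symm a b k)
  A_anti a b := by
    have := h _ (.A_antisymm a b k)
    exact eq_neg_of_add_eq_zero_left (by simpa [Lab.at] using this)
  Ts_anti a b c := by
    have := h _ (.Ts_antisymm a b c k)
    exact eq_neg_of_add_eq_zero_left (by simpa [Lab.at] using this)
  Ts_cyc a b c := by simpa [Lab.at] using h _ (.Ts_cyclic a b c k)
  Ss_symm a b := by simpa [sub_eq_zero, Lab.at] using h _ (.Ss_symm a b k)
  As_anti a b := by
    have := h _ (.As_antisymm a b k)
    exact eq_neg_of_add_eq_zero_left (by simpa [Lab.at] using this)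

theorem isSym_gen (k : Multiset (Fin D)) : IsSym fun l : Lab D => gen (l.at k) :=
  isSym_of_linRel (fun _ hv => gen_lin hv) k

theorem isSym_genOp : IsSym (genOp : Lab D → (Op D →ₗ[ℝ] Alg D)) := by
  constructor
  all_goals
    intros
    apply op_linearMap_ext
    intro k
    simp only [LinearMap.neg_apply, LinearMap.add_apply, LinearMap.zero_apply, genOp_mono]
  · exact (isSym_gen k).T_anti _ _ _
  · exact (isSym_gen k).T_cyc _ _ _
  · exact (isSym_gen k).S_symm _ _
  · exact (isSym_gen k).A_anti _ _
  · exact (isSym_gen k).Ts_anti _ _ _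
  · exact (isSym_gen k).Ts_cyc _ _ _
  · exact (isSym_gen k).Ss_symm _ _
  · exact (isSym_gen k).As_anti _ _

/-- Linear combinations of the variables with differential operators as coefficients. -/
abbrev Lin (D : ℕ) : Type := Lab D → Op D

/-- The element of the algebra defined by a linear combination. -/
def toAlg : Lin D →ₗ[ℝ] Alg D := ∑ l, genOp l ∘ₗ LinearMap.proj l

theorem toAlg_apply (v : Lin D) : toAlg v = ∑ l, genOp l (v l) := by
  simp [toAlg]

-- By self-adjointness the projector can be moved onto the generators, which already have the
-- symmetries.
@[simp]
theorem toAlg_young (v : Lin D) : toAlg (young v) = toAlg v := by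
  rw [toAlg_apply, toAlg_apply, sum_young_adjoint, isSym_genOp.young_eq]

theorem toAlg_single (l : Lab D) (r : Op D) : toAlg (Pi.single l r) = genOp l r := by
  rw [toAlg_apply]
  exact sum_apply_single genOp l r

theorem lin_induction {p : Lin D → Prop} (v : Lin D) (zero : p 0) (single : ∀ l k, p (Pi.single l (mono k)))
    (add : ∀ v w, p v → p w → p (v + w)) (smul : ∀ (c : ℝ) v, p v → p (c • v)) : p v := by
  have h1 : ∀ l r, p (Pi.single l r) := by
    intro l r
    induction r using op_induction with
    | mono k => exact single l k
    | add r s hr hs => rw [Pi.single_add]; exact add _ _ hr hs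
    | smul c r hr => rw [Pi.single_smul]; exact smul _ _ hr
  rw [← Finset.univ_sum_single v]
  exact Finset.sum_induction _ p add zero fun l _ => h1 l _

/-- The representative of a generator in `Lin D` with the symmetries. -/
def cls : Gen D → Lin D
  | .T a b c k => young (Pi.single (.T a b c) (mono k))
  | .S a b k => young (Pi.single (.S a b) (mono k))
  | .A a b k => young (Pi.single (.A a b) (mono k))
  | .C a k => young (Pi.single (.C a) (mono k))
  | .Ts a b c k => young (Pi.single (.Ts a b c) (mono k))
  | .Ss a b k => young (Pi.single (.Ss a b) (mono k))
  | .As a b k => young (Pi.single (.As a b) (mono k))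
  | .Cs a k => young (Pi.single (.Cs a) (mono k))
  | .dx _ => 0

theorem cls_at (l : Lab D) (k : Multiset (Fin D)) :
    cls (l.at k) = young (Pi.single l (mono k)) := by
  cases l <;> rfl

theorem young_cls (g : Gen D) : young (cls g) = cls g := by
  rcases g.eq_dx_or_at with ⟨μ, rfl⟩ | ⟨l, k, rfl⟩
  · simp [cls]
  · rw [cls_at, young_young]

/-- This makes `cls` compatible with the linear relations, so derivations of the algebra may be
prescribed through it. Each relation is checked by duality: every family of maps with the symmetries
annihilates it. -/
theorem isSym_cls (k : Multiset (Fin D)) : IsSym fun l : Lab D => cls (l.at k) := by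
  simp only [cls_at]
  have key : ∀ v : Lin D, (∀ ψ : Lab D → (Op D →ₗ[ℝ] Op D), IsSym ψ → ∑ l, ψ l (v l) = 0) →
      young v = 0 := fun v => young_eq_zero
  constructor <;> intros
  · rw [← add_eq_zero_iff_eq_neg, ← map_add]
    refine key _ fun ψ hψ => ?_
    simp only [Pi.add_apply, map_add, Finset.sum_add_distrib, sum_apply_single]
    rw [hψ.T_anti]; simp
  · rw [← map_add, ← map_add]
    refine key _ fun ψ hψ => ?_
    simp only [Pi.add_apply, map_add, Finset.sum_add_distrib, sum_apply_single]
    rw [← LinearMap.add_apply, ← LinearMap.add_apply, hψ.T_cyc]; simp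
  · rw [← sub_eq_zero, ← map_sub]
    refine key _ fun ψ hψ => ?_
    simp only [Pi.sub_apply, map_sub, Finset.sum_sub_distrib, sum_apply_single]
    rw [hψ.S_symm]; simp
  · rw [← add_eq_zero_iff_eq_neg, ← map_add]
    refine key _ fun ψ hψ => ?_
    simp only [Pi.add_apply, map_add, Finset.sum_add_distrib, sum_apply_single]
    rw [hψ.A_anti]; simp
  · rw [← add_eq_zero_iff_eq_neg, ← map_add]
    refine key _ fun ψ hψ => ?_
    simp only [Pi.add_apply, map_add, Finset.sum_add_distrib, sum_apply_single]
    rw [hψ.Ts_anti]; simp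
  · rw [← map_add, ← map_add]
    refine key _ fun ψ hψ => ?_
    simp only [Pi.add_apply, map_add, Finset.sum_add_distrib, sum_apply_single]
    rw [← LinearMap.add_apply, ← LinearMap.add_apply, hψ.Ts_cyc]; simp
  · rw [← sub_eq_zero, ← map_sub]
    refine key _ fun ψ hψ => ?_
    simp only [Pi.sub_apply, map_sub, Finset.sum_sub_distrib, sum_apply_single]
    rw [hψ.Ss_symm]; simp
  · rw [← add_eq_zero_iff_eq_neg, ← map_add]
    refine key _ fun ψ hψ => ?_
    simp only [Pi.add_apply, map_add, Finset.sum_add_distrib, sum_apply_single]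
    rw [hψ.As_anti]; simp

@[simp]
theorem toAlg_cls_at (l : Lab D) (k : Multiset (Fin D)) : toAlg (cls (l.at k)) = gen (l.at k) := by
  rw [cls_at, toAlg_young, toAlg_single, genOp_mono]

theorem cls_at_of_kind {l m : Lab D} (h : m.kind ≠ l.kind) (k : Multiset (Fin D)) :
    cls (l.at k) m = 0 := by
  rw [cls_at]
  refine young_eq_zero_of_kind fun n hn => ?_
  rw [Pi.single_eq_of_ne]
  rintro rfl
  exact h hn.symm

theorem parity_of_cls_ne_zero {g : Gen D} {m : Lab D} (h : cls g m ≠ 0) :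
    g.parity = m.parity := by
  rcases g.eq_dx_or_at with ⟨μ, rfl⟩ | ⟨l, k, rfl⟩
  · simp [cls] at h
  · rw [parity_at]
    by_contra h'
    exact h (cls_at_of_kind (fun e => h' (Lab.parity_eq_of_kind e).symm) k)

theorem young_smul (r : Op D) (v : Lin D) : young (r • v) = r • young v :=
  young_map (LinearMap.mulLeft ℝ r) v

theorem cls_cons (l : Lab D) (μ : Fin D) (k : Multiset (Fin D)) :
    cls (l.at (μ ::ₘ k)) = (MvPolynomial.X μ : Op D) • cls (l.at k) := by
  rw [cls_at, cls_at, mono_cons, ← young_smul]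
  congr 1
  rw [← smul_eq_mul, Pi.single_smul]

theorem partial_gen_at (l : Lab D) (μ : Fin D) (k : Multiset (Fin D)) :
    (partialData μ).der (gen (l.at k)) = gen (l.at (μ ::ₘ k)) := by
  rw [DerData.der_gen]
  cases l <;> rfl

theorem partial_gen_dx (μ ν : Fin D) : (partialData μ).der (gen (.dx ν)) = 0 := by
  rw [DerData.der_gen]
  rfl

theorem partial_toAlg (μ : Fin D) (v : Lin D) :
    (partialData μ).der (toAlg v) = toAlg ((MvPolynomial.X μ : Op D) • v) := by
  induction v using lin_induction with
  | zero => simp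
  | single l k =>
    rw [← Pi.single_smul, toAlg_single, toAlg_single, genOp_mono, partial_gen_at, smul_eq_mul,
      ← mono_cons, genOp_mono]
  | add v w hv hw => rw [map_add, map_add, hv, hw, smul_add, map_add]
  | smul c v hv => rw [map_smul, map_smul, hv, smul_comm, LinearMap.map_smul]

/-! ### Fréchet derivatives -/

theorem linearCombination_cls {v : Gen D →₀ ℝ} (hv : LinRel D v) :
    Finsupp.linearCombination ℝ cls v = 0 := linRel_eq_zero isSym_cls hv

/-- The first tensor factor records which derivative of z is differentiated away. The sign rule
holds because the value on g is zero unless g has the parity of z, and the linear relations hold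
because `cls` respects them. Using the symmetrized representative makes the sum over all labels,
dependent ones included, count each variable once. -/
theorem exists_frechet (l : Lab D) : ∃ X : Alg D →ₗ[ℝ] Op D ⊗[ℝ] Alg D,
    IsTDer Algebra.TensorProduct.includeRight l.parity X ∧
      ∀ g, X (gen g) = cls g l ⊗ₜ[ℝ] 1 := by
  refine exists_isTDer _ _ _ (fun g h => ?_) (fun v hv => ?_)
  · by_cases h0 : cls g l = 0
    · simp [h0]
    · rw [parity_of_cls_ne_zero h0, ← two_mul, mul_assoc, pow_mul]
      simp
  · have h1 := Finsupp.apply_linearCombination ℝ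
      ((TensorProduct.mk ℝ (Op D) (Alg D)).flip 1 ∘ₗ LinearMap.proj l) cls v
    rw [linearCombination_cls hv, map_zero] at h1
    exact h1.symm

/-- The derivative of an element of the algebra with respect to the variable with label `l` and all
its derivatives, `a ↦ ∑_k ∂_k ⊗ ∂a/∂(∂_k z)`. -/
def frechet (l : Lab D) : Alg D →ₗ[ℝ] Op D ⊗[ℝ] Alg D := (exists_frechet l).choose

theorem isTDer_frechet (l : Lab D) :
    IsTDer Algebra.TensorProduct.includeRight l.parity (frechet l) := (exists_frechet l).choose_spec.1

@[simp]
theorem frechet_gen (l : Lab D) (g : Gen D) : frechet l (gen g) = cls g l ⊗ₜ[ℝ] 1 :=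
  (exists_frechet l).choose_spec.2 g

theorem lTensor_mul_left {ε : ℕ} {X : Alg D →ₗ[ℝ] Alg D} (hX : IsDer ε X) (u : Alg D)
    (x : Op D ⊗[ℝ] Alg D) : X.lTensor (Op D) (((1 : Op D) ⊗ₜ[ℝ] u) * x) =
      ((1 : Op D) ⊗ₜ[ℝ] X u) * x + ((1 : Op D) ⊗ₜ[ℝ] sgn D ε u) * X.lTensor (Op D) x := by
  induction x using TensorProduct.induction_on with
  | zero => simp
  | tmul r a => simp [hX.mul, TensorProduct.tmul_add]
  | add x y hx hy => rw [mul_add, map_add, hx, hy, map_add, mul_add, mul_add]; abel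

theorem lTensor_coeff_mul (X : Alg D →ₗ[ℝ] Alg D) (r : Op D)
    (x : Op D ⊗[ℝ] Alg D) : X.lTensor (Op D) ((r ⊗ₜ[ℝ] (1 : Alg D)) * x) =
      (r ⊗ₜ[ℝ] (1 : Alg D)) * X.lTensor (Op D) x := by
  induction x using TensorProduct.induction_on with
  | zero => simp
  | tmul s a => simp
  | add x y hx hy => rw [mul_add, map_add, hx, hy, map_add, mul_add]

theorem partial_hasParity (μ : Fin D) (g : Gen D) :
    HasParity g.parity ((partialData μ).der (gen g)) := by
  rcases g.eq_dx_or_at with ⟨ν, rfl⟩ | ⟨l, k, rfl⟩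
  · rw [partial_gen_dx]; exact HasParity.zero _
  · rw [partial_gen_at, parity_at, ← parity_at l (μ ::ₘ k)]; exact hasParity_gen _

theorem frechet_partial_gen (l : Lab D) (μ : Fin D) (g : Gen D) :
    frechet l ((partialData μ).der (gen g)) =
      ((MvPolynomial.X μ : Op D) ⊗ₜ[ℝ] (1 : Alg D)) * frechet l (gen g) := by
  rcases g.eq_dx_or_at with ⟨ν, rfl⟩ | ⟨m, k, rfl⟩
  · rw [partial_gen_dx]; simp [cls]
  · rw [partial_gen_at, frechet_gen, frechet_gen, cls_cons]; simp

/-- On a generator ∂_μ only adds μ to the recorded derivative, which is multiplication by X_μ in the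
first factor; both sides obey the same Leibniz rule. -/
theorem frechet_partial (l : Lab D) (μ : Fin D) (a : Alg D) :
    frechet l ((partialData μ).der a) = (partialData μ).der.lTensor (Op D) (frechet l a) +
      ((MvPolynomial.X μ : Op D) ⊗ₜ[ℝ] (1 : Alg D)) * frechet l a := by
  have hP := isTDer_frechet l
  have hd := (partialData (D := D) μ).isDer
  suffices frechet l ∘ₗ (partialData μ).der = (partialData μ).der.lTensor (Op D) ∘ₗ frechet l +
      LinearMap.mulLeft ℝ ((MvPolynomial.X μ : Op D) ⊗ₜ[ℝ] (1 : Alg D)) ∘ₗ frechet l from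
    LinearMap.congr_fun this a
  refine linearMap_ext_gen_mul (by simp [hP.one, hd.one]) fun g a ha => ?_
  simp only [LinearMap.comp_apply, LinearMap.add_apply, LinearMap.mulLeft_apply] at ha ⊢
  have hs : sgn D 0 (gen g) = gen g := by simp
  rw [hd.apply_gen_mul, hP.gen_mul, map_add, hP.mul, map_smul, hP.gen_mul, ha, frechet_partial_gen,
    partial_hasParity, frechet_gen]
  simp only [zero_mul, pow_zero, one_smul, map_add, map_smul,
    Algebra.TensorProduct.includeRight_apply, lTensor_coeff_mul, lTensor_mul_left hd, hs,
    LinearMap.lTensor_tmul]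
  simp only [mul_add, smul_add, smul_mul_assoc, mul_smul_comm, ← mul_assoc,
    Algebra.TensorProduct.tmul_mul_tmul, mul_one, one_mul]
  abel

/-! ### The linear part and the Koszul–Tate operator on it -/

theorem aug_partial (μ : Fin D) (a : Alg D) : aug D ((partialData μ).der a) = 0 := by
  have hd := (partialData (D := D) μ).isDer
  induction a using alg_induction with
  | one => rw [hd.one, map_zero]
  | add a b ha hb => rw [map_add, map_add, ha, hb, add_zero]
  | smul c a ha => rw [map_smul, map_smul, ha, smul_zero]
  | gen_mul g a ha =>
    rw [hd.apply_gen_mul]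
    rcases g.eq_dx_or_at with ⟨ν, rfl⟩ | ⟨m, k, rfl⟩
    · rw [partial_gen_dx]; simp
    · rw [partial_gen_at]; simp

/-- The part of an element of the algebra that is linear in the variables. -/
def linPart : Alg D →ₗ[ℝ] Lin D :=
  LinearMap.pi fun l => (TensorProduct.rid ℝ (Op D)).toLinearMap ∘ₗ
    (aug D).toLinearMap.lTensor (Op D) ∘ₗ frechet l

theorem linPart_apply (a : Alg D) (l : Lab D) : linPart a l =
    TensorProduct.rid ℝ (Op D) ((aug D).toLinearMap.lTensor (Op D) (frechet l a)) := rfl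

@[simp]
theorem linPart_gen (g : Gen D) : linPart (gen g) = cls g := by
  funext l
  simp [linPart_apply]

theorem linPart_partial (μ : Fin D) (a : Alg D) :
    linPart ((partialData μ).der a) = (MvPolynomial.X μ : Op D) • linPart a := by
  funext l
  rw [linPart_apply, frechet_partial, map_add, map_add, ← LinearMap.comp_apply,
    ← LinearMap.lTensor_comp]
  have h : (aug D).toLinearMap ∘ₗ (partialData μ).der = 0 := by ext a; simp [aug_partial]
  rw [h, LinearMap.lTensor_zero, LinearMap.zero_apply, map_zero, zero_add, Pi.smul_apply,
    linPart_apply]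
  generalize frechet l a = x
  induction x using TensorProduct.induction_on with
  | zero => simp
  | tmul r a => simp
  | add x y hx hy => rw [mul_add, map_add, map_add, hx, hy, map_add, map_add, smul_add]

/-- Together with `toAlg_young` this identifies linear forms in the variables with symmetrized
tensors of polynomials: the stated symmetries are the only linear relations. -/
theorem linPart_toAlg (v : Lin D) : linPart (toAlg v) = young v := by
  induction v using lin_induction with
  | zero => simp
  | single l k => rw [toAlg_single, genOp_mono, linPart_gen, cls_at]
  | add v w hv hw => rw [map_add, map_add, hv, hw, map_add]
  | smul c v hv => rw [map_smul, map_smul, hv, map_smul]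

/-! ### The Koszul–Tate differential on the linear part -/

/-- The span of the variables one level below `n`. -/
def below (D n : ℕ) : Submodule ℝ (Alg D) :=
  Submodule.span ℝ {a | ∃ (m : Lab D) (k : Multiset (Fin D)), n = m.lev + 1 ∧ a = gen (m.at k)}

theorem gen_mem_below (m : Lab D) (k : Multiset (Fin D)) : gen (m.at k) ∈ below D (m.lev + 1) :=
  Submodule.subset_span ⟨m, k, rfl, rfl⟩

theorem Fstr_mem_below (α β γ δ : Fin D) (k : Multiset (Fin D)) : Fstr α β γ δ k ∈ below D 1 :=
  add_mem (add_mem (gen_mem_below (.T β γ δ) _) (gen_mem_below (.T γ α δ) _))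
    (gen_mem_below (.T α β δ) _)

theorem ricci_mem_below (α β γ : Fin D) (k : Multiset (Fin D)) : ricci α β γ k ∈ below D 1 :=
  sum_mem fun _ _ => Submodule.smul_mem _ _ (Submodule.smul_mem _ _
    (sub_mem (Fstr_mem_below _ _ _ _ _) (Fstr_mem_below _ _ _ _ _)))

theorem ricciTr_mem_below (α : Fin D) (k : Multiset (Fin D)) : ricciTr α k ∈ below D 1 :=
  sum_mem fun _ _ => Submodule.smul_mem _ _ (ricci_mem_below _ _ _ _)

theorem koszul_gen_mem_below (l : Lab D) (k : Multiset (Fin D)) :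
    koszulData.der (gen (l.at k)) ∈ below D l.lev := by
  rw [DerData.der_gen]
  cases l with
  | Ts a b c =>
    exact Submodule.smul_mem _ _ (add_mem (Submodule.smul_mem _ _ (ricci_mem_below _ _ _ _))
      (Submodule.smul_mem _ _ (sub_mem (Submodule.smul_mem _ _ (ricciTr_mem_below _ _))
      (Submodule.smul_mem _ _ (ricciTr_mem_below _ _)))))
  | Ss a b =>
    exact neg_mem (sum_mem fun c _ => add_mem (gen_mem_below (.Ts c a b) _)
      (gen_mem_below (.Ts c b a) _))
  | As a b =>
    exact Submodule.smul_mem _ _ (sum_mem fun c _ => sub_mem (gen_mem_below (.Ts c a b) _)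
      (gen_mem_below (.Ts c b a) _))
  | Cs a =>
    exact add_mem (Submodule.smul_mem _ _ (sum_mem fun c _ => gen_mem_below (.Ss c a) _))
      (Submodule.smul_mem _ _ (sum_mem fun c _ => gen_mem_below (.As c a) _))
  | _ => exact zero_mem _

theorem koszul_gen_dx (μ : Fin D) : koszulData.der (gen (.dx μ)) = 0 := by
  rw [DerData.der_gen]
  rfl

theorem below_le_range (n : ℕ) : below D n ≤ LinearMap.range (toAlg (D := D)) :=
  Submodule.span_le.2 <| by
    rintro _ ⟨m, k, -, rfl⟩
    exact ⟨cls (m.at k), toAlg_cls_at m k⟩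

theorem toAlg_linPart {n : ℕ} {a : Alg D} (ha : a ∈ below D n) : toAlg (linPart a) = a := by
  obtain ⟨v, rfl⟩ := below_le_range n ha
  rw [linPart_toAlg, toAlg_young]

theorem young_linPart {n : ℕ} {a : Alg D} (ha : a ∈ below D n) :
    young (linPart a) = linPart a := by
  obtain ⟨v, rfl⟩ := below_le_range n ha
  rw [linPart_toAlg, young_young]

theorem linPart_eq_zero_of_lev {n : ℕ} {a : Alg D} (ha : a ∈ below D n) {m : Lab D}
    (hm : n ≠ m.lev + 1) : linPart a m = 0 := by
  induction ha using Submodule.span_induction with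
  | mem a ha =>
    obtain ⟨l, k, hl, rfl⟩ := ha
    rw [linPart_gen]
    refine cls_at_of_kind (fun h => hm ?_) k
    rw [hl, Lab.lev_eq_of_kind h]
  | zero => simp
  | add a b _ _ ha hb => rw [map_add, Pi.add_apply, ha, hb, add_zero]
  | smul c a _ ha => rw [map_smul, Pi.smul_apply, ha, smul_zero]

theorem hasParity_of_mem_below {l : Lab D} {a : Alg D} (ha : a ∈ below D l.lev) :
    HasParity (l.parity + 1) a := by
  induction ha using Submodule.span_induction with
  | mem a ha =>
    obtain ⟨m, k, hl, rfl⟩ := ha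
    refine (hasParity_gen _).congr ?_
    have := Lab.parity_add_one_of_lev hl
    rw [parity_at]
    omega
  | zero => exact HasParity.zero _
  | add a b _ _ ha hb => exact ha.add hb
  | smul c a _ ha => exact ha.smul c

theorem mem_formsA_of_mem_below {l : Lab D} {a : Alg D} (ha : a ∈ below D l.lev) :
    a ∈ formsA D 0 (l.antigh - 1) := by
  refine Submodule.span_le.2 ?_ ha
  rintro _ ⟨m, k, hl, rfl⟩
  have h := gen_mem_formsA (m.at k)
  rw [formDeg_at, antigh_at] at h
  rwa [Lab.antigh_add_one_of_lev hl, add_sub_cancel_right]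

theorem koszul_hasParity (g : Gen D) : HasParity (g.parity + 1) (koszulData.der (gen g)) := by
  rcases g.eq_dx_or_at with ⟨μ, rfl⟩ | ⟨l, k, rfl⟩
  · rw [koszul_gen_dx]; exact HasParity.zero _
  · rw [parity_at]; exact hasParity_of_mem_below (koszul_gen_mem_below l k)

theorem koszul_mem_formsA {p q : ℤ} {a : Alg D} (ha : a ∈ formsA D p q) :
    koszulData.der a ∈ formsA D p (q - 1) := by
  have := koszulData.isDer.mem_formsA (dp := 0) (dq := -1) (fun g => ?_) ha
  · simpa [sub_eq_add_neg] using this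
  rcases g.eq_dx_or_at with ⟨μ, rfl⟩ | ⟨l, k, rfl⟩
  · rw [koszul_gen_dx]; exact zero_mem _
  · rw [antigh_at, formDeg_at]
    simpa [sub_eq_add_neg] using mem_formsA_of_mem_below (koszul_gen_mem_below l k)

theorem partial_mem_formsA (μ : Fin D) {p q : ℤ} {a : Alg D} (ha : a ∈ formsA D p q) :
    (partialData μ).der a ∈ formsA D p q := by
  have := (partialData μ).isDer.mem_formsA (dp := 0) (dq := 0) (fun g => ?_) ha
  · simpa using this
  rcases g.eq_dx_or_at with ⟨ν, rfl⟩ | ⟨l, k, rfl⟩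
  · rw [partial_gen_dx]; exact zero_mem _
  · rw [partial_gen_at]
    simpa using gen_mem_formsA (l.at (μ ::ₘ k))

theorem partial_Fstr (μ α β γ δ : Fin D) (k : Multiset (Fin D)) :
    (partialData μ).der (Fstr α β γ δ k) = Fstr α β γ δ (μ ::ₘ k) := by
  simp only [Fstr, map_add, DerData.der_gen, partialData, partialVal, Multiset.cons_swap μ]

theorem partial_ricci (μ α β γ : Fin D) (k : Multiset (Fin D)) :
    (partialData μ).der (ricci α β γ k) = ricci α β γ (μ ::ₘ k) := by
  simp only [ricci, curv, map_sum, map_smul, map_sub, partial_Fstr, Multiset.cons_swap μ]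

theorem partial_ricciTr (μ α : Fin D) (k : Multiset (Fin D)) :
    (partialData μ).der (ricciTr α k) = ricciTr α (μ ::ₘ k) := by
  simp only [ricciTr, map_sum, map_smul, partial_ricci]

theorem koszul_gen_cons (l : Lab D) (μ : Fin D) (k : Multiset (Fin D)) :
    koszulData.der (gen (l.at (μ ::ₘ k))) =
      (partialData μ).der (koszulData.der (gen (l.at k))) := by
  rw [DerData.der_gen, DerData.der_gen]
  cases l with
  | Ts a b c =>
    simp only [koszulData, koszulVal, Lab.at, eom, map_smul, map_add, map_sub, partial_ricci,
      partial_ricciTr]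
  | Ss a b =>
    simp only [koszulData, koszulVal, Lab.at, map_neg, map_sum, map_add, DerData.der_gen,
      partialData, partialVal, Multiset.cons_swap μ]
  | As a b =>
    simp only [koszulData, koszulVal, Lab.at, map_smul, map_sum, map_sub, DerData.der_gen,
      partialData, partialVal, Multiset.cons_swap μ]
  | Cs a =>
    simp only [koszulData, koszulVal, Lab.at, map_smul, map_sum, map_add, DerData.der_gen,
      partialData, partialVal, Multiset.cons_swap μ]
  | _ => exact (map_zero _).symm

theorem isDer_zero (ε : ℕ) : IsDer ε (0 : Alg D →ₗ[ℝ] Alg D) where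
  one := rfl
  gen_mul g a := by simp

/-- The graded commutator of two derivations is a derivation, so it vanishes as soon as it does on
the generators. -/
theorem koszul_partial (μ : Fin D) (a : Alg D) :
    koszulData.der ((partialData μ).der a) = (partialData μ).der (koszulData.der a) := by
  have h := (partialData (D := D) μ).isDer.bracket koszulData.isDer (partial_hasParity μ)
    koszul_hasParity
  have h0 := h.ext (isDer_zero _) fun g => by
    rcases g.eq_dx_or_at with ⟨ν, rfl⟩ | ⟨l, k, rfl⟩
    · simp [partial_gen_dx, koszul_gen_dx, -DerData.der_gen]
    · simp [partial_gen_at, koszul_gen_cons, -DerData.der_gen]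
  have := LinearMap.congr_fun h0 a
  simp only [zero_mul, pow_zero, one_smul, LinearMap.sub_apply, LinearMap.comp_apply,
    LinearMap.zero_apply, sub_eq_zero] at this
  exact this.symm

theorem partial_comm (μ ν : Fin D) (a : Alg D) :
    (partialData μ).der ((partialData ν).der a) = (partialData ν).der ((partialData μ).der a) := by
  have h := (partialData (D := D) μ).isDer.bracket (partialData (D := D) ν).isDer
    (partial_hasParity μ) (partial_hasParity ν)
  have h0 := h.ext (isDer_zero _) fun g => by
    rcases g.eq_dx_or_at with ⟨ν, rfl⟩ | ⟨l, k, rfl⟩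
    · simp [partial_gen_dx, -DerData.der_gen]
    · simp [partial_gen_at, Multiset.cons_swap μ, -DerData.der_gen]
  have := LinearMap.congr_fun h0 a
  simpa [sub_eq_zero] using this

/-- The Koszul–Tate differential on `Lin D`. -/
def koszulLin : Lin D →ₗ[Op D] Lin D where
  toFun v := ∑ l, v l • linPart (koszulData.der (gen (l.at 0)))
  map_add' v w := by simp [add_smul, Finset.sum_add_distrib]
  map_smul' r v := by simp [mul_smul, Finset.smul_sum]

theorem koszulLin_apply (v : Lin D) :
    koszulLin v = ∑ l, v l • linPart (koszulData.der (gen (l.at 0))) := rfl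

theorem koszulLin_real_smul (c : ℝ) (v : Lin D) : koszulLin (c • v) = c • koszulLin v :=
  (koszulLin.restrictScalars ℝ).map_smul c v

theorem koszulLin_single (l : Lab D) (r : Op D) :
    koszulLin (Pi.single l r) = r • linPart (koszulData.der (gen (l.at 0))) := by
  rw [koszulLin_apply, Finset.sum_eq_single l]
  · simp
  · intro m _ hm; simp [hm]
  · simp

theorem linPart_koszul_gen_at (l : Lab D) (k : Multiset (Fin D)) :
    linPart (koszulData.der (gen (l.at k))) =
      mono k • linPart (koszulData.der (gen (l.at 0))) := by
  induction k using Multiset.induction_on with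
  | empty => rw [mono_zero, one_smul]
  | cons μ k ih => rw [koszul_gen_cons, linPart_partial, ih, mono_cons, mul_smul]

theorem linPart_koszul_toAlg (v : Lin D) :
    linPart (koszulData.der (toAlg v)) = koszulLin v := by
  induction v using lin_induction with
  | zero => simp
  | single l k => rw [toAlg_single, genOp_mono, linPart_koszul_gen_at, koszulLin_single]
  | add v w hv hw => rw [map_add, map_add, map_add, hv, hw, map_add]
  | smul c v hv => rw [map_smul, map_smul, map_smul, hv, koszulLin_real_smul]

theorem toAlg_koszulLin (v : Lin D) : toAlg (koszulLin v) = koszulData.der (toAlg v) := by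
  induction v using lin_induction with
  | zero => simp
  | single l k =>
    rw [koszulLin_single, ← linPart_koszul_gen_at, toAlg_single, genOp_mono,
      toAlg_linPart (koszul_gen_mem_below l k)]
  | add v w hv hw => rw [map_add, map_add, map_add, hv, hw, map_add]
  | smul c v hv => rw [koszulLin_real_smul, LinearMap.map_smul, hv, map_smul, map_smul]

@[simp]
theorem koszulLin_young (v : Lin D) : koszulLin (young v) = koszulLin v := by
  rw [← linPart_koszul_toAlg, toAlg_young, linPart_koszul_toAlg]

@[simp]
theorem young_koszulLin (v : Lin D) : young (koszulLin v) = koszulLin v := by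
  rw [koszulLin_apply, map_sum]
  refine Finset.sum_congr rfl fun l _ => ?_
  rw [young_smul, young_linPart (koszul_gen_mem_below l 0)]

theorem koszulLin_cls (g : Gen D) : koszulLin (cls g) = linPart (koszulData.der (gen g)) := by
  rcases g.eq_dx_or_at with ⟨ν, rfl⟩ | ⟨l, k, rfl⟩
  · simp [koszul_gen_dx, cls, -DerData.der_gen]
  · rw [cls_at, koszulLin_young, koszulLin_single, linPart_koszul_gen_at l k]

/-- The matrix of the Koszul–Tate differential. -/
def koszulMat (l m : Lab D) : Op D := linPart (koszulData.der (gen (m.at 0))) l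

theorem koszulMat_eq_zero {l m : Lab D} (h : m.lev ≠ l.lev + 1) : koszulMat l m = 0 :=
  linPart_eq_zero_of_lev (koszul_gen_mem_below m 0) h

theorem koszulLin_apply_apply (v : Lin D) (l : Lab D) :
    koszulLin v l = ∑ m, v m * koszulMat l m := by
  simp [koszulLin_apply, koszulMat, Finset.sum_apply]

theorem frechet_toAlg (l : Lab D) (v : Lin D) : frechet l (toAlg v) = young v l ⊗ₜ[ℝ] 1 := by
  induction v using lin_induction with
  | zero => simp
  | single m k => rw [toAlg_single, genOp_mono, frechet_gen, cls_at]
  | add v w hv hw => rw [map_add, map_add, map_add, hv, hw, Pi.add_apply, TensorProduct.add_tmul]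
  | smul c v hv =>
    rw [map_smul, map_smul, map_smul, hv, Pi.smul_apply, TensorProduct.smul_tmul']

theorem koszul_gen_eq (g : Gen D) : koszulData.der (gen g) = toAlg (koszulLin (cls g)) := by
  rcases g.eq_dx_or_at with ⟨ν, rfl⟩ | ⟨l, k, rfl⟩
  · simp [koszul_gen_dx, cls, -DerData.der_gen]
  · rw [koszulLin_cls, toAlg_linPart (koszul_gen_mem_below l k)]

theorem frechet_koszul_gen (l : Lab D) (g : Gen D) :
    frechet l (koszulData.der (gen g)) =
      ∑ m, (koszulMat l m ⊗ₜ[ℝ] (1 : Alg D)) * frechet m (gen g) := by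
  rw [koszul_gen_eq, frechet_toAlg, young_koszulLin, koszulLin_apply_apply,
    TensorProduct.sum_tmul]
  refine Finset.sum_congr rfl fun m _ => ?_
  rw [frechet_gen, Algebra.TensorProduct.tmul_mul_tmul, one_mul, mul_comm]

/-- This is the chain rule: z occurs in δa either through a coefficient on which δ acts, or through
the δ of a variable that contains z, with coefficient `koszulMat`. Both sides are compared through
their Leibniz rules. -/
theorem frechet_koszul (l : Lab D) (a : Alg D) :
    frechet l (koszulData.der a) =
      (-1 : ℝ) ^ l.parity • koszulData.der.lTensor (Op D) (frechet l a) +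
      ∑ m, (koszulMat l m ⊗ₜ[ℝ] (1 : Alg D)) * frechet m a := by
  have hP := isTDer_frechet l
  have hd := (koszulData (D := D)).isDer
  suffices frechet l ∘ₗ koszulData.der =
      (-1 : ℝ) ^ l.parity • koszulData.der.lTensor (Op D) ∘ₗ frechet l +
      ∑ m, LinearMap.mulLeft ℝ (koszulMat l m ⊗ₜ[ℝ] (1 : Alg D)) ∘ₗ frechet m by
    simpa using LinearMap.congr_fun this a
  refine linearMap_ext_gen_mul (by simp [hP.one, hd.one, (isTDer_frechet _).one]) fun g a ha => ?_
  simp only [LinearMap.comp_apply, LinearMap.add_apply, LinearMap.mulLeft_apply,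
    LinearMap.smul_apply, LinearMap.sum_apply] at ha ⊢
  have e1 : ∑ m, (koszulMat l m ⊗ₜ[ℝ] (1 : Alg D)) * frechet m (gen g * a) =
      frechet l (koszulData.der (gen g)) * ((1 : Op D) ⊗ₜ[ℝ] a) +
      (-1 : ℝ) ^ ((l.parity + 1) * g.parity) • (((1 : Op D) ⊗ₜ[ℝ] gen g) *
        ∑ m, (koszulMat l m ⊗ₜ[ℝ] (1 : Alg D)) * frechet m a) := by
    rw [frechet_koszul_gen, Finset.sum_mul, Finset.mul_sum, Finset.smul_sum,
      ← Finset.sum_add_distrib]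
    refine Finset.sum_congr rfl fun m _ => ?_
    rw [(isTDer_frechet m).gen_mul, mul_add, ← mul_assoc]
    congr 1
    -- Only variables one level above l contribute, and these have parity opposite to l; so the sum
    -- over m obeys the Leibniz rule of parity `l.parity + 1`.
    by_cases h : m.lev = l.lev + 1
    · have hs : (-1 : ℝ) ^ (m.parity * g.parity) = (-1) ^ ((l.parity + 1) * g.parity) := by
        rw [mul_comm, neg_one_pow_mul_congr (Lab.parity_add_one_of_lev h), mul_comm]
      rw [hs, mul_smul_comm, ← mul_assoc, ← mul_assoc]
      simp
    · simp [koszulMat_eq_zero h]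
  -- The derivative of g is nonzero only if g and l have equal parity, so the two signs may be
  -- exchanged.
  have e2 : (-1 : ℝ) ^ l.parity • frechet l (gen g) = (-1 : ℝ) ^ g.parity • frechet l (gen g) := by
    rw [frechet_gen]
    by_cases h0 : cls g l = 0
    · simp [h0]
    · rw [parity_of_cls_ne_zero h0]
  have e3 : ∀ x, koszulData.der.lTensor (Op D) (frechet l (gen g) * x) =
      frechet l (gen g) * koszulData.der.lTensor (Op D) x := fun x => by
    rw [frechet_gen, lTensor_coeff_mul]
  rw [e1, hd.apply_gen_mul, hP.gen_mul, map_add, hP.mul, map_smul, hP.gen_mul, ha,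
    koszul_hasParity]
  simp only [map_add, map_smul, e3,
    Algebra.TensorProduct.includeRight_apply, lTensor_mul_left hd, sgn_gen,
    LinearMap.lTensor_tmul]
  have e4 := congrArg (· * ((1 : Op D) ⊗ₜ[ℝ] koszulData.der a)) e2
  simp only [smul_mul_assoc] at e4
  simp only [mul_add, smul_add, smul_mul_assoc, mul_smul_comm, TensorProduct.tmul_smul, smul_smul,
    one_mul, add_mul, pow_add, mul_one]
  rcases g.parity_eq_zero_or_one with h | h <;> rw [h] at e4 ⊢ <;>
    simp only [mul_zero, pow_zero, mul_one, pow_one] at e4 ⊢ <;>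
    linear_combination (norm := module) (-1 : ℝ) • e4

/-! ### Exactness of the polynomial Koszul complex in low degrees -/

open MvPolynomial in
/-- The inverse of the Euler operator shifted by `s > 0`. -/
def eulerInv (D s : ℕ) : Op D →ₗ[ℝ] Op D :=
  (basisMonomials (Fin D) ℝ).constr ℝ fun k =>
    ((Multiset.card (Finsupp.toMultiset k) : ℝ) + s)⁻¹ • monomial k 1

theorem eulerInv_mono (s : ℕ) (k : Multiset (Fin D)) :
    eulerInv D s (mono k) = ((Multiset.card k : ℝ) + s)⁻¹ • mono k := by
  have := (MvPolynomial.basisMonomials (Fin D) ℝ).constr_basis ℝ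
    (fun k => ((Multiset.card (Finsupp.toMultiset k) : ℝ) + s)⁻¹ • MvPolynomial.monomial k (1 : ℝ))
    (Multiset.toFinsupp k)
  simpa [eulerInv, mono] using this

/-- Multiplication by an indeterminate raises the degree by one, which the shift compensates. -/
theorem X_mul_eulerInv (s : ℕ) (a : Fin D) (r : Op D) :
    MvPolynomial.X a * eulerInv D (s + 1) r = eulerInv D s (MvPolynomial.X a * r) := by
  induction r using op_induction with
  | mono k =>
    rw [eulerInv_mono, ← mono_cons, eulerInv_mono, mul_smul_comm, ← mono_cons, Multiset.card_cons]
    push_cast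
    rw [add_right_comm, add_assoc]
  | add r t hr ht => rw [map_add, mul_add, mul_add, map_add, hr, ht]
  | smul c r hr => rw [map_smul, mul_smul_comm, mul_smul_comm, LinearMap.map_smul, hr]

theorem sum_X_mul_pderiv_mono (k : Multiset (Fin D)) :
    ∑ c, MvPolynomial.X c * MvPolynomial.pderiv c (mono k) = (Multiset.card k : ℝ) • mono k := by
  induction k using Multiset.induction_on with
  | empty => simp [mono_zero]
  | cons a k ih =>
    rw [mono_cons]
    simp only [MvPolynomial.pderiv_mul, mul_add, Finset.sum_add_distrib]
    have h1 : ∑ c, (MvPolynomial.X c : Op D) * (MvPolynomial.pderiv c (MvPolynomial.X a) * mono k) =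
        MvPolynomial.X a * mono k := by
      rw [Finset.sum_eq_single a]
      · simp
      · intro c _ hc; simp [MvPolynomial.pderiv_X_of_ne hc.symm]
      · simp
    have h2 : ∑ c, (MvPolynomial.X c : Op D) * (MvPolynomial.X a * MvPolynomial.pderiv c (mono k)) =
        MvPolynomial.X a * ∑ c, MvPolynomial.X c * MvPolynomial.pderiv c (mono k) := by
      rw [Finset.mul_sum]
      exact Finset.sum_congr rfl fun c _ => by ring
    rw [h1, h2, ih, Multiset.card_cons, mul_smul_comm]
    push_cast
    module

/-- The divergence of `p_c r`, where `p_c` are the indeterminates. -/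
theorem eulerInv_divergence {n s : ℕ} (hs : 0 < s) (hn : n + s = D) (r : Op D) :
    eulerInv D s (∑ c, MvPolynomial.pderiv c (MvPolynomial.X c * r) - (n : ℝ) • r) = r := by
  induction r using op_induction with
  | mono k =>
    -- The operator Σ ∂_c p_c acts as degree + D, so after subtracting n it is degree + s, which is
    -- invertible because s = D - n > 0.
    have h : ∑ c, MvPolynomial.pderiv c (MvPolynomial.X c * mono k) - (n : ℝ) • mono k =
        ((Multiset.card k : ℝ) + s) • mono k := by
      simp only [MvPolynomial.pderiv_mul, MvPolynomial.pderiv_X_self, one_mul,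
        Finset.sum_add_distrib, sum_X_mul_pderiv_mono, Finset.sum_const, Finset.card_univ,
        Fintype.card_fin]
      have hD : (D : ℝ) = n + s := by exact_mod_cast hn.symm
      rw [← Nat.cast_smul_eq_nsmul ℝ, hD]
      module
    have hs' : ((Multiset.card k : ℝ) + s) ≠ 0 := by positivity
    rw [h, map_smul, eulerInv_mono, smul_smul, mul_inv_cancel₀ hs', one_smul]
  | add r t hr ht =>
    nth_rewrite 3 [← hr]
    nth_rewrite 3 [← ht]
    rw [← map_add]
    congr 1
    simp only [mul_add, map_add, Finset.sum_add_distrib]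
    module
  | smul c r hr =>
    nth_rewrite 3 [← hr]
    rw [← map_smul]
    congr 1
    simp only [mul_smul_comm, Derivation.map_smul, ← Finset.smul_sum]
    module

theorem X_mul_pderiv (a c : Fin D) (r : Op D) :
    MvPolynomial.X a * MvPolynomial.pderiv c r =
      MvPolynomial.pderiv c (MvPolynomial.X a * r) - if c = a then r else 0 := by
  rw [MvPolynomial.pderiv_mul]
  split_ifs with h
  · subst h; simp
  · simp [MvPolynomial.pderiv_X_of_ne (Ne.symm h)]

theorem X_mul_sum_pderiv (a : Fin D) (r : Fin D → Op D) :
    MvPolynomial.X a * ∑ c, MvPolynomial.pderiv c (r c) =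
      ∑ c, MvPolynomial.pderiv c (MvPolynomial.X a * r c) - r a := by
  simp only [Finset.mul_sum, X_mul_pderiv, Finset.sum_sub_distrib]
  simp

/-- A closed polynomial `1`-form is exact. -/
theorem koszul_one_form (hD : 1 < D) (u : Fin D → Op D)
    (h : ∀ a c, MvPolynomial.X c * u a = MvPolynomial.X a * u c) :
    ∃ w : Op D, ∀ a, u a = MvPolynomial.X a * w := by
  obtain ⟨s, rfl⟩ : ∃ s, D = s + 2 := ⟨D - 2, by omega⟩
  -- The primitive is the rescaled divergence: on n-forms the anticommutator of the divergence with
  -- multiplication by p is degree + D - n. The shift in the witness is D - n + 1 with n = 1, since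
  -- passing p_a through lowers it by one. The same formula serves for two- and three-forms.
  refine ⟨eulerInv (s + 2) (s + 1 + 1) (∑ c, MvPolynomial.pderiv c (u c)), fun a => ?_⟩
  rw [X_mul_eulerInv, X_mul_sum_pderiv]
  conv_lhs => rw [← eulerInv_divergence (n := 1) (s := s + 1) (by omega) (by omega) (u a)]
  congr 1
  simp only [h a, Nat.cast_one, one_smul]

/-- A closed polynomial `2`-form is exact. -/
theorem koszul_two_form (hD : 2 < D) (u : Fin D → Fin D → Op D) (hu : ∀ a b, u a b = -u b a)
    (h : ∀ a b c, MvPolynomial.X c * u a b =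
      MvPolynomial.X a * u c b - MvPolynomial.X b * u c a) :
    ∃ w : Fin D → Op D, ∀ a b, u a b = MvPolynomial.X a * w b - MvPolynomial.X b * w a := by
  obtain ⟨s, rfl⟩ : ∃ s, D = s + 3 := ⟨D - 3, by omega⟩
  refine ⟨fun b => eulerInv (s + 3) (s + 1 + 1) (∑ c, MvPolynomial.pderiv c (u c b)),
    fun a b => ?_⟩
  rw [X_mul_eulerInv, X_mul_eulerInv, X_mul_sum_pderiv a, X_mul_sum_pderiv b, ← map_sub]
  conv_lhs => rw [← eulerInv_divergence (n := 2) (s := s + 1) (by omega) (by omega) (u a b)]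
  congr 1
  simp only [h a b, map_sub, Finset.sum_sub_distrib]
  rw [hu b a]
  push_cast
  module

/-- A closed polynomial `3`-form is exact. -/
theorem koszul_three_form (hD : 3 < D) (u : Fin D → Fin D → Fin D → Op D)
    (h1 : ∀ a b c, u a b c = -u b a c) (h2 : ∀ a b c, u a b c = -u a c b)
    (h : ∀ a b c d, MvPolynomial.X d * u a b c = MvPolynomial.X a * u d b c +
      MvPolynomial.X b * u d c a + MvPolynomial.X c * u d a b) :
    ∃ w : Fin D → Fin D → Op D, (∀ a b, w a b = -w b a) ∧ ∀ a b c, u a b c =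
      MvPolynomial.X a * w b c + MvPolynomial.X b * w c a + MvPolynomial.X c * w a b := by
  obtain ⟨s, rfl⟩ : ∃ s, D = s + 4 := ⟨D - 4, by omega⟩
  refine ⟨fun a b => eulerInv (s + 4) (s + 1 + 1) (∑ c, MvPolynomial.pderiv c (u c a b)),
    fun a b => ?_, fun a b c => ?_⟩
  · simp only [← map_neg, ← Finset.sum_neg_distrib, h2 _ a b]
  · simp only [X_mul_eulerInv]
    rw [X_mul_sum_pderiv a, X_mul_sum_pderiv b, X_mul_sum_pderiv c, ← map_add, ← map_add]
    conv_lhs => rw [← eulerInv_divergence (n := 3) (s := s + 1) (by omega) (by omega) (u a b c)]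
    congr 1
    simp only [h a b c, map_add, Finset.sum_add_distrib]
    rw [h2 b c a, h1 b a c, h1 c a b, h2 a c b]
    push_cast
    module

/-! ### Tensor calculus with polynomial coefficients -/

/-- The diagonal entries of the metric as constant polynomials. -/
def met (d : Fin D) : Op D := algebraMap ℝ (Op D) (η d)

theorem met_mul_self (d : Fin D) : met d * met d = 1 := by
  rw [met, ← map_mul, η]
  split_ifs <;> simp

/-- The indeterminates. -/
abbrev mom (a : Fin D) : Op D := MvPolynomial.X a

/-- Tensors with the symmetries of the field. -/
structure IsHook (T : Fin D → Fin D → Fin D → Op D) : Prop where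
  anti : ∀ a b c, T a b c = -T b a c
  cyc : ∀ a b c, T a b c + T b c a + T c a b = 0

/-- The field strength. -/
def fieldStr (T : Fin D → Fin D → Fin D → Op D) (a b c d : Fin D) : Op D :=
  mom a * T b c d + mom b * T c a d + mom c * T a b d

/-- Twice the trace of the curvature. -/
def ric (T : Fin D → Fin D → Fin D → Op D) (a b c : Fin D) : Op D :=
  ∑ d, met d * (mom d * fieldStr T a b d c - mom c * fieldStr T a b d d)

/-- Twice the double trace of the curvature. -/
def ricTr (T : Fin D → Fin D → Fin D → Op D) (a : Fin D) : Op D := ∑ b, met b * ric T a b b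

/-- The field equations, multiplied by `4 / 3`. -/
def fieldEq (T : Fin D → Fin D → Fin D → Op D) (a b c : Fin D) : Op D :=
  2 * (met a * met b * met c * ric T a b c) +
    ((if c = a then met c * met b * ricTr T b else 0) -
      if c = b then met c * met a * ricTr T a else 0)

/-- The divergence on the second index. -/
def dvg (T : Fin D → Fin D → Fin D → Op D) (b c : Fin D) : Op D := ∑ d, met d * mom d * T b d c

/-- The trace. -/
def trc (T : Fin D → Fin D → Fin D → Op D) (b : Fin D) : Op D := ∑ d, met d * T b d d

/-- The divergence of the trace. -/
def dvgTrc (T : Fin D → Fin D → Fin D → Op D) : Op D := ∑ d, met d * mom d * trc T d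

/-- The double divergence. -/
def ddvg (T : Fin D → Fin D → Fin D → Op D) (a : Fin D) : Op D := ∑ d, met d * mom d * dvg T a d

/-- The d'Alembertian. -/
def box (D : ℕ) : Op D := ∑ d, met d * mom d * mom d

section Identities

variable {T P : Fin D → Fin D → Fin D → Op D}

/-- By the cyclic identity the divergence on the last index reduces to those on the second, so a
single divergence suffices throughout. -/
theorem sum_dvg_last (hT : IsHook T) (a b : Fin D) :
    ∑ d, met d * mom d * T a b d = dvg T a b - dvg T b a := by
  simp only [dvg, ← Finset.sum_sub_distrib]
  refine Finset.sum_congr rfl fun d _ => ?_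
  have h1 := hT.cyc a b d
  have h2 := hT.anti d a b
  linear_combination (met d * mom d) * (h1 - h2)

/-- In terms of divergence, trace and d'Alembertian, the Bianchi identities and the self-adjointness
below become short computations. -/
theorem ric_eq (hT : IsHook T) (a b c : Fin D) :
    ric T a b c = mom a * dvg T b c - mom b * dvg T a c + box D * T a b c -
      mom c * (mom a * trc T b - mom b * trc T a + (dvg T a b - dvg T b a)) := by
  rw [← sum_dvg_last hT]
  simp only [ric, fieldStr, dvg, trc, box, Finset.mul_sum, Finset.sum_mul,
    ← Finset.sum_add_distrib, ← Finset.sum_sub_distrib]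
  refine Finset.sum_congr rfl fun d _ => ?_
  rw [hT.anti d a c, hT.anti d a d]
  ring

theorem two_mul_eq_zero {x : Op D} (h : x = -x) : x = 0 := self_eq_neg.1 h

/-- A product of two momenta is symmetric, while T is antisymmetric in the two indices it is
contracted with. -/
theorem sum_mom_dvg (hT : IsHook T) (c : Fin D) : ∑ b, met b * mom b * dvg T b c = 0 := by
  apply two_mul_eq_zero
  simp only [dvg, Finset.mul_sum]
  conv_rhs => rw [Finset.sum_comm]
  rw [← Finset.sum_neg_distrib]
  refine Finset.sum_congr rfl fun a _ => ?_
  rw [← Finset.sum_neg_distrib]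
  refine Finset.sum_congr rfl fun b _ => ?_
  rw [hT.anti a b c]
  ring

theorem sum_mom_ddvg (hT : IsHook T) : ∑ b, met b * mom b * ddvg T b = 0 := by
  simp only [ddvg, Finset.mul_sum]
  rw [Finset.sum_comm]
  refine Finset.sum_eq_zero fun c _ => ?_
  have := sum_mom_dvg hT c
  rw [← mul_zero (met c * mom c), ← this, Finset.mul_sum]
  exact Finset.sum_congr rfl fun b _ => by ring

theorem sum_trace_dvg (hT : IsHook T) : ∑ b, met b * dvg T b b = -dvgTrc T := by
  simp only [dvg, dvgTrc, trc, Finset.mul_sum]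
  rw [Finset.sum_comm, ← Finset.sum_neg_distrib]
  refine Finset.sum_congr rfl fun a _ => ?_
  rw [← Finset.sum_neg_distrib]
  refine Finset.sum_congr rfl fun b _ => ?_
  rw [hT.anti a b b]
  ring

theorem ricTr_eq (hT : IsHook T) (a : Fin D) :
    ricTr T a = 2 * (box D * trc T a - mom a * dvgTrc T - ddvg T a) := by
  have h1 := sum_trace_dvg hT
  have h2 := sum_mom_dvg hT a
  have h : ricTr T a = mom a * (∑ b, met b * dvg T b b) - ddvg T a + box D * trc T a -
      (mom a * dvgTrc T - box D * trc T a + (ddvg T a - ∑ b, met b * mom b * dvg T b a)) := by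
    have e : box D * trc T a = ∑ b, met b * mom b * mom b * trc T a := by
      rw [box, Finset.sum_mul]
    have e' : box D * trc T a = ∑ b, met b * (box D * T a b b) := by
      rw [trc, Finset.mul_sum]
      exact Finset.sum_congr rfl fun b _ => by ring
    conv_rhs => enter [1, 2]; rw [e']
    conv_rhs => enter [2, 1, 2]; rw [e]
    simp only [ricTr, ric_eq hT, ddvg, dvgTrc, Finset.mul_sum,
      ← Finset.sum_add_distrib, ← Finset.sum_sub_distrib]
    exact Finset.sum_congr rfl fun b _ => by ring
  rw [h, h1, h2]
  ring

/-- This is the contracted Bianchi identity, the source of the Noether identities. -/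
theorem sum_mom_ric (hT : IsHook T) (a b : Fin D) :
    2 * ∑ c, met c * mom c * ric T c a b = -(mom b * ricTr T a) := by
  have h1 := sum_mom_dvg hT b
  have h2 := sum_mom_dvg hT a
  have h : ∑ c, met c * mom c * ric T c a b =
      box D * dvg T a b - mom a * (∑ c, met c * mom c * dvg T c b) - box D * dvg T a b -
      mom b * (box D * trc T a - mom a * dvgTrc T +
        ((∑ c, met c * mom c * dvg T c a) - ddvg T a)) := by
    have e : ∀ x, box D * x = ∑ c, met c * mom c * mom c * x := fun x => by
      rw [box, Finset.sum_mul]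
    have e' : box D * dvg T a b = ∑ c, -(met c * mom c * (box D * T c a b)) := by
      rw [dvg, Finset.mul_sum]
      exact Finset.sum_congr rfl fun c _ => by rw [hT.anti c a b]; ring
    conv_rhs => enter [1, 2]; rw [e']
    conv_rhs => enter [1, 1, 1]; rw [e]
    conv_rhs => enter [2, 2, 1, 1]; rw [e]
    simp only [ric_eq hT, ddvg, dvgTrc, Finset.mul_sum,
      ← Finset.sum_add_distrib, ← Finset.sum_sub_distrib]
    exact Finset.sum_congr rfl fun b _ => by ring
  rw [h, h1, h2, ricTr_eq hT]
  ring

theorem sum_mom_ricTr (hT : IsHook T) : ∑ a, met a * mom a * ricTr T a = 0 := by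
  have h1 := sum_mom_ddvg hT
  have h : ∑ a, met a * mom a * ricTr T a =
      2 * (box D * dvgTrc T - box D * dvgTrc T - ∑ b, met b * mom b * ddvg T b) := by
    conv_rhs => enter [2, 1, 2]; rw [box, Finset.sum_mul]
    simp only [ricTr_eq hT, dvgTrc, Finset.mul_sum, ← Finset.sum_sub_distrib]
    refine Finset.sum_congr rfl fun b _ => ?_
    rw [← Finset.mul_sum, ← Finset.mul_sum]
    ring
  rw [h, h1]
  ring

/-- The Noether identities. -/
theorem sum_mom_fieldEq (hT : IsHook T) (a b : Fin D) : ∑ c, mom c * fieldEq T c a b = 0 := by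
  have h : ∑ c, mom c * fieldEq T c a b =
      met a * met b * (2 * ∑ c, met c * mom c * ric T c a b) + mom b * met b * met a * ricTr T a -
        if b = a then met b * ∑ c, met c * mom c * ricTr T c else 0 := by
    simp only [fieldEq, mul_add, mul_sub, Finset.sum_add_distrib, Finset.sum_sub_distrib]
    rw [← add_sub_assoc]
    congr 1
    · congr 1
      · simp only [Finset.mul_sum]
        exact Finset.sum_congr rfl fun c _ => by ring
      · simp [mul_ite, mul_assoc]
    · split_ifs
      · rw [Finset.mul_sum]
        exact Finset.sum_congr rfl fun c _ => by ring
      · simp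
  rw [h, sum_mom_ric hT, sum_mom_ricTr hT]
  split_ifs <;> ring

theorem fieldStr_anti_left (hT : IsHook T) (a b c d : Fin D) :
    fieldStr T a b c d = -fieldStr T b a c d := by
  simp only [fieldStr]
  linear_combination mom a * hT.anti b c d + mom b * hT.anti c a d + mom c * hT.anti a b d

theorem fieldStr_anti_right (hT : IsHook T) (a b c d : Fin D) :
    fieldStr T a b c d = -fieldStr T a c b d := by
  simp only [fieldStr]
  linear_combination mom a * hT.anti b c d + mom b * hT.anti c a d + mom c * hT.anti a b d

/-- Contraction of the first index with a momentum. -/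
theorem sum_contract_first (hP : IsHook P) (X : Fin D → Fin D → Op D) :
    ∑ a, ∑ b, ∑ c, met a * met b * met c * (P a b c * (mom a * X b c)) =
      -∑ b, ∑ c, met b * met c * (dvg P b c * X b c) := by
  simp only [dvg, Finset.mul_sum, Finset.sum_mul, ← Finset.sum_neg_distrib]
  rw [Finset.sum_comm]
  refine Finset.sum_congr rfl fun b _ => ?_
  rw [Finset.sum_comm]
  refine Finset.sum_congr rfl fun c _ => Finset.sum_congr rfl fun a _ => ?_
  rw [hP.anti a b c]
  ring

theorem sum_contract_second (P : Fin D → Fin D → Fin D → Op D) (X : Fin D → Fin D → Op D) :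
    ∑ a, ∑ b, ∑ c, met a * met b * met c * (P a b c * (mom b * X a c)) =
      ∑ a, ∑ c, met a * met c * (dvg P a c * X a c) := by
  simp only [dvg, Finset.mul_sum, Finset.sum_mul]
  refine Finset.sum_congr rfl fun a _ => ?_
  rw [Finset.sum_comm]
  exact Finset.sum_congr rfl fun c _ => Finset.sum_congr rfl fun b _ => by ring

theorem sum_contract_last (hP : IsHook P) (X : Fin D → Fin D → Op D) :
    ∑ a, ∑ b, ∑ c, met a * met b * met c * (P a b c * (mom c * X a b)) =
      ∑ a, ∑ b, met a * met b * ((dvg P a b - dvg P b a) * X a b) := by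
  simp only [← sum_dvg_last hP, Finset.mul_sum, Finset.sum_mul]
  exact Finset.sum_congr rfl fun a _ => Finset.sum_congr rfl fun b _ =>
    Finset.sum_congr rfl fun c _ => by ring

theorem sum_dvg_mul_mom (P : Fin D → Fin D → Fin D → Op D) (x : Fin D → Op D) :
    ∑ a, ∑ c, met a * met c * (dvg P a c * (mom c * x a)) = ∑ a, met a * (ddvg P a * x a) := by
  simp only [ddvg, Finset.mul_sum, Finset.sum_mul]
  exact Finset.sum_congr rfl fun a _ => Finset.sum_congr rfl fun c _ => by ring

theorem sum_mul_ite_first (hP : IsHook P) (x : Fin D → Op D) :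
    ∑ a, ∑ b, ∑ c, P a b c * (if c = a then met c * met b * x b else 0) =
      -∑ b, met b * (trc P b * x b) := by
  simp only [mul_ite, mul_zero, Finset.sum_ite_eq', Finset.mem_univ, if_true]
  rw [Finset.sum_comm, ← Finset.sum_neg_distrib]
  refine Finset.sum_congr rfl fun b _ => ?_
  rw [trc, Finset.sum_mul, Finset.mul_sum, ← Finset.sum_neg_distrib]
  refine Finset.sum_congr rfl fun a _ => ?_
  rw [hP.anti a b a]
  ring

theorem sum_mul_ite_second (P : Fin D → Fin D → Fin D → Op D) (x : Fin D → Op D) :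
    ∑ a, ∑ b, ∑ c, P a b c * (if c = b then met c * met a * x a else 0) =
      ∑ a, met a * (trc P a * x a) := by
  simp only [mul_ite, mul_zero, Finset.sum_ite_eq', Finset.mem_univ, if_true]
  refine Finset.sum_congr rfl fun a _ => ?_
  rw [trc, Finset.sum_mul, Finset.mul_sum]
  exact Finset.sum_congr rfl fun b _ => by ring

theorem sum_mul_ric (hT : IsHook T) (hP : IsHook P) :
    ∑ a, ∑ b, ∑ c, met a * met b * met c * (P a b c * ric T a b c) =
      -2 * (∑ a, ∑ b, met a * met b * (dvg P a b * dvg T a b)) +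
      box D * (∑ a, ∑ b, ∑ c, met a * met b * met c * (P a b c * T a b c)) +
      2 * (∑ a, met a * (ddvg P a * trc T a)) -
      ∑ a, ∑ b, met a * met b * ((dvg P a b - dvg P b a) * (dvg T a b - dvg T b a)) := by
  have e1 := sum_contract_first hP (dvg T)
  have e2 := sum_contract_second P (dvg T)
  have e3 := sum_contract_first hP fun b c => mom c * trc T b
  have e4 := sum_contract_second P fun a c => mom c * trc T a
  have e5 := sum_contract_last hP fun a b => dvg T a b - dvg T b a
  rw [sum_dvg_mul_mom] at e3 e4
  have e : ∑ a, ∑ b, ∑ c, met a * met b * met c * (P a b c * ric T a b c) =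
      (∑ a, ∑ b, ∑ c, met a * met b * met c * (P a b c * (mom a * dvg T b c))) -
      (∑ a, ∑ b, ∑ c, met a * met b * met c * (P a b c * (mom b * dvg T a c))) +
      box D * (∑ a, ∑ b, ∑ c, met a * met b * met c * (P a b c * T a b c)) -
      (∑ a, ∑ b, ∑ c, met a * met b * met c * (P a b c * (mom a * (mom c * trc T b)))) +
      (∑ a, ∑ b, ∑ c, met a * met b * met c * (P a b c * (mom b * (mom c * trc T a)))) -
      ∑ a, ∑ b, ∑ c, met a * met b * met c * (P a b c * (mom c * (dvg T a b - dvg T b a))) := by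
    simp only [Finset.mul_sum, ← Finset.sum_add_distrib, ← Finset.sum_sub_distrib]
    exact Finset.sum_congr rfl fun a _ => Finset.sum_congr rfl fun b _ =>
      Finset.sum_congr rfl fun c _ => by rw [ric_eq hT]; ring
  rw [e, e1, e2, e3, e4, e5]
  ring

theorem sum_trc_mul_ricTr (P : Fin D → Fin D → Fin D → Op D) (hT : IsHook T) :
    ∑ a, met a * (trc P a * ricTr T a) =
      2 * (box D * (∑ a, met a * (trc P a * trc T a)) - dvgTrc P * dvgTrc T -
        ∑ a, met a * (trc P a * ddvg T a)) := by
  have e : dvgTrc P * dvgTrc T = ∑ a, met a * mom a * trc P a * dvgTrc T := by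
    rw [dvgTrc, Finset.sum_mul]
  rw [e]
  simp only [Finset.mul_sum, ← Finset.sum_sub_distrib]
  exact Finset.sum_congr rfl fun a _ => by rw [ricTr_eq hT]; ring

/-- The scalar product of `P` with the field equations of `T`, which is symmetric. -/
theorem sum_mul_fieldEq (hT : IsHook T) (hP : IsHook P) :
    ∑ a, ∑ b, ∑ c, P a b c * fieldEq T a b c =
      -4 * (∑ a, ∑ b, met a * met b * (dvg P a b * dvg T a b)) +
      2 * box D * (∑ a, ∑ b, ∑ c, met a * met b * met c * (P a b c * T a b c)) +
      4 * (∑ a, met a * (ddvg P a * trc T a)) -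
      2 * (∑ a, ∑ b, met a * met b * ((dvg P a b - dvg P b a) * (dvg T a b - dvg T b a))) -
      4 * box D * (∑ a, met a * (trc P a * trc T a)) + 4 * dvgTrc P * dvgTrc T +
      4 * (∑ a, met a * (trc P a * ddvg T a)) := by
  have e : ∑ a, ∑ b, ∑ c, P a b c * fieldEq T a b c =
      2 * (∑ a, ∑ b, ∑ c, met a * met b * met c * (P a b c * ric T a b c)) +
      (∑ a, ∑ b, ∑ c, P a b c * (if c = a then met c * met b * ricTr T b else 0)) -
      ∑ a, ∑ b, ∑ c, P a b c * (if c = b then met c * met a * ricTr T a else 0) := by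
    simp only [Finset.mul_sum, ← Finset.sum_add_distrib, ← Finset.sum_sub_distrib]
    exact Finset.sum_congr rfl fun a _ => Finset.sum_congr rfl fun b _ =>
      Finset.sum_congr rfl fun c _ => by rw [fieldEq]; ring
  rw [e, sum_mul_ric hT hP, sum_mul_ite_first hP, sum_mul_ite_second, sum_trc_mul_ricTr P hT]
  ring

/-- The expression in `sum_mul_fieldEq` is visibly symmetric in the two tensors: the operator of the
field equations is self-adjoint. Hence a combination of antifields T* is δ-closed exactly when its
coefficients solve the field equations. -/
theorem sum_mul_fieldEq_comm (hT : IsHook T) (hP : IsHook P) :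
    ∑ a, ∑ b, ∑ c, P a b c * fieldEq T a b c = ∑ a, ∑ b, ∑ c, T a b c * fieldEq P a b c := by
  rw [sum_mul_fieldEq hT hP, sum_mul_fieldEq hP hT]
  simp only [mul_comm (dvg T _ _), mul_comm (T _ _ _), mul_comm (ddvg T _), mul_comm (trc T _),
    mul_comm (dvg T _ _ - dvg T _ _)]
  ring

end Identities

/-! ### Solutions of the field equations with polynomial coefficients are pure gauge -/

section Solutions

variable {T : Fin D → Fin D → Fin D → Op D}

theorem box_ne_zero (hD : 1 < D) : box D ≠ 0 := by
  intro h
  have := congrArg (MvPolynomial.eval (Pi.single (⟨1, hD⟩ : Fin D) (1 : ℝ))) h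
  rw [box, map_sum, map_zero, Finset.sum_eq_single (⟨1, hD⟩ : Fin D)] at this
  · simp [met, η] at this
  · intro b _ hb
    simp [hb]
  · simp

theorem two_mul_ric_of_fieldEq (h : ∀ a b c, fieldEq T a b c = 0) (a b c : Fin D) :
    2 * ric T a b c + met a * (if c = a then ricTr T b else 0) -
      met b * (if c = b then ricTr T a else 0) = 0 := by
  have e := h a b c
  have e1 : (if c = a then met c * met b * ricTr T b else 0) =
      met c * met b * (if c = a then ricTr T b else 0) := by split_ifs <;> simp
  have e2 : (if c = b then met c * met a * ricTr T a else 0) =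
      met c * met a * (if c = b then ricTr T a else 0) := by split_ifs <;> simp
  rw [fieldEq, e1, e2] at e
  have sa := met_mul_self a
  have sb := met_mul_self b
  have sc := met_mul_self c
  linear_combination (met a * met b * met c) * e -
    2 * ric T a b c * (sa + met a * met a * sb + met a * met a * met b * met b * sc) -
    met a * (if c = a then ricTr T b else 0) * (sb + met b * met b * sc) +
    met b * (if c = b then ricTr T a else 0) * (sa + met a * met a * sc)

/-- Tracing the field equations over the last two indices leaves 3 - D times the double trace, and
this factor is not zero. -/
theorem ricTr_eq_zero (hD : 4 < D) (h : ∀ a b c, fieldEq T a b c = 0) (a : Fin D) :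
    ricTr T a = 0 := by
  have e : ∑ b, met b * (2 * ric T a b b + met a * (if b = a then ricTr T b else 0) -
      met b * (if b = b then ricTr T a else 0)) = 0 :=
    Finset.sum_eq_zero fun b _ => by rw [two_mul_ric_of_fieldEq h, mul_zero]
  have e1 : ∑ b, met b * (2 * ric T a b b + met a * (if b = a then ricTr T b else 0) -
      met b * (if b = b then ricTr T a else 0)) =
      2 * (∑ b, met b * ric T a b b) + (∑ b, if b = a then met b * met a * ricTr T b else 0) -
        ∑ _b : Fin D, ricTr T a := by
    simp only [Finset.mul_sum, ← Finset.sum_add_distrib, ← Finset.sum_sub_distrib]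
    refine Finset.sum_congr rfl fun b _ => ?_
    have := met_mul_self b
    simp only [if_true]
    split_ifs <;> linear_combination -ricTr T a * this
  rw [e1] at e
  simp only [Finset.sum_ite_eq', Finset.mem_univ, if_true, met_mul_self, Finset.sum_const,
    Finset.card_univ, Fintype.card_fin, nsmul_eq_mul] at e
  change 2 * ricTr T a + 1 * ricTr T a - D * ricTr T a = 0 at e
  have e2 : ((3 : ℕ) - (D : ℕ) : Op D) * ricTr T a = 0 := by push_cast; linear_combination e
  refine (mul_eq_zero.1 e2).resolve_left ?_
  exact sub_ne_zero.2 (Nat.cast_injective.ne (by omega))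

theorem ric_eq_zero (hD : 4 < D) (h : ∀ a b c, fieldEq T a b c = 0) (a b c : Fin D) :
    ric T a b c = 0 := by
  have e := two_mul_ric_of_fieldEq h a b c
  simp only [ricTr_eq_zero hD h, ite_self, mul_zero, add_zero, sub_zero] at e
  exact (mul_eq_zero.1 e).resolve_left two_ne_zero

/-- The Bianchi identity: with d as a spectator, the field strength is an exterior derivative in a,
b, c and therefore closed. -/
theorem mom_mul_fieldStr (hT : IsHook T) (a b c d e : Fin D) :
    mom e * fieldStr T a b c d = mom a * fieldStr T b c e d + mom b * fieldStr T c a e d +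
      mom c * fieldStr T a b e d := by
  simp only [fieldStr]
  linear_combination (-mom a * mom b) * hT.anti e c d - mom a * mom c * hT.anti e b d -
    mom b * mom c * hT.anti e a d

/-- The curvature vanishes. -/
theorem mom_mul_fieldStr_symm (hD : 4 < D) (hT : IsHook T) (h : ∀ a b c, fieldEq T a b c = 0)
    (a b c d e : Fin D) : mom e * fieldStr T a b c d = mom d * fieldStr T a b c e := by
  have h1 : ∀ a b d, ∑ e, met e * mom e * fieldStr T a b e d =
      mom d * ∑ e, met e * fieldStr T a b e e := by
    intro a b d
    have := ric_eq_zero hD h a b d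
    rw [ric] at this
    rw [← sub_eq_zero, Finset.mul_sum, ← Finset.sum_sub_distrib, ← this]
    exact Finset.sum_congr rfl fun e _ => by ring
  -- Contracting the Bianchi identity with p^e and using the vanishing Ricci tensor shows that p²
  -- F_abc|d is p_d times a quantity independent of d.
  have h2 : ∀ d, box D * fieldStr T a b c d =
      mom d * (mom a * (∑ e, met e * fieldStr T b c e e) + mom b * (∑ e, met e * fieldStr T c a e e) +
        mom c * ∑ e, met e * fieldStr T a b e e) := by
    intro d
    have h3 : box D * fieldStr T a b c d = mom a * (∑ e, met e * mom e * fieldStr T b c e d) +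
        mom b * (∑ e, met e * mom e * fieldStr T c a e d) +
        mom c * ∑ e, met e * mom e * fieldStr T a b e d := by
      simp only [box, Finset.sum_mul, Finset.mul_sum, ← Finset.sum_add_distrib]
      refine Finset.sum_congr rfl fun e _ => ?_
      linear_combination met e * mom e * mom_mul_fieldStr hT a b c d e
    rw [h3, h1, h1, h1]
    ring
  -- The curvature is thus annihilated by p², a nonzero element of an integral domain.
  refine mul_left_cancel₀ (box_ne_zero (by omega)) ?_
  linear_combination mom e * h2 d - mom d * h2 e

/-- The gauge transformation with parameters `B`. -/
def gauge (B : Fin D → Fin D → Op D) (a b c : Fin D) : Op D :=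
  mom a * B b c - mom b * B a c - mom c * (B a b - B b a)

theorem mom_ne_zero (a : Fin D) : mom a ≠ 0 := MvPolynomial.X_ne_zero a

/-- Solutions of the field equations are pure gauge. -/
theorem exists_eq_gauge (hD : 4 < D) (hT : IsHook T) (h : ∀ a b c, fieldEq T a b c = 0) :
    ∃ B, ∀ a b c, T a b c = gauge B a b c := by
  have z : Fin D := ⟨0, by omega⟩
  -- Zero curvature says that the field strength is closed in its last index, so F_abc|d = p_d
  -- G_abc.
  choose G hG using fun a b c => koszul_one_form (by omega) (fieldStr T a b c)
    fun d e => mom_mul_fieldStr_symm hD hT h a b c d e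
  -- G inherits antisymmetry and closedness from F after cancelling the factor p_z for one fixed
  -- index z; hence G is the exterior derivative of a two-form W.
  obtain ⟨W, hW, hW'⟩ := koszul_three_form (by omega) G
    (fun a b c => mul_left_cancel₀ (mom_ne_zero z) (by
      rw [← hG, mul_neg, ← hG, fieldStr_anti_left hT]))
    (fun a b c => mul_left_cancel₀ (mom_ne_zero z) (by
      rw [← hG, mul_neg, ← hG, fieldStr_anti_right hT]))
    (fun a b c d => mul_left_cancel₀ (mom_ne_zero z) (by
      have e := mom_mul_fieldStr hT a b c z d
      have e1 := fieldStr_anti_left hT d b c z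
      have e1' := fieldStr_anti_right hT b c d z
      have e2 := fieldStr_anti_left hT d c a z
      have e2' := fieldStr_anti_right hT c a d z
      have e3 := fieldStr_anti_left hT d a b z
      have e3' := fieldStr_anti_right hT a b d z
      simp only [hG] at e e1 e1' e2 e2' e3 e3'
      linear_combination e - mom a * (e1 - e1') - mom b * (e2 - e2') - mom c * (e3 - e3')))
  -- The term p_c W_ab has the same field strength as T, so the difference is closed in a, b for
  -- each c.
  choose B hB using fun c => koszul_two_form (by omega) (fun a b => T a b c - mom c * W a b)
    (fun a b => by linear_combination hT.anti a b c - mom c * hW a b)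
    (fun a b d => by
      have e := hG a b d c
      rw [hW', fieldStr] at e
      linear_combination e - mom a * hT.anti d b c + mom c * mom a * hW d b)
  -- The cyclic identity for T turns into closedness of W_ab + B_ba - B_ab, which determines W up to
  -- an exact form.
  obtain ⟨w, hw⟩ := koszul_two_form (by omega)
    (fun a b => W a b + (B b a - B a b))
    (fun a b => by linear_combination hW a b)
    (fun a b d => by
      have e := hT.cyc a b d
      have e1 := hB d a b
      have e2 := hB a b d
      have e3 := hB b d a
      linear_combination e - e1 - e2 - e3 - mom a * hW d b)
  have half : 2 * algebraMap ℝ (Op D) (1 / 2) = 1 := by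
    rw [← map_ofNat (algebraMap ℝ (Op D)) 2, ← map_mul]
    norm_num
  -- The correction with factor 1/2 reproduces the exact part p_a w_b - p_b w_a of W, which enters
  -- the gauge transformation twice.
  refine ⟨fun b c => B c b + algebraMap ℝ (Op D) (1 / 2) * (mom c * w b), fun a b c => ?_⟩
  rw [gauge]
  linear_combination hB c a b + mom c * hw a b - mom c * (mom a * w b - mom b * w a) * half

/-- Trivial gauge parameters. -/
theorem exists_of_gauge_eq_zero (hD : 4 < D) (B : Fin D → Fin D → Op D)
    (h : ∀ a b c, gauge B a b c = 0) :
    ∃ u : Fin D → Op D, ∀ a b, B a b = -(4 * (mom a * u b) + 2 * (mom b * u a)) := by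
  have z : Fin D := ⟨0, by omega⟩
  -- In the cyclic sum of p_c times the equation with last index z, the terms with B_az and its
  -- permutations cancel; what is left is p_z times the exterior derivative of the antisymmetric
  -- part of B.
  obtain ⟨u, hu⟩ := koszul_two_form (by omega) (fun a b => B a b - B b a) (fun a b => by ring)
    (fun a b c => mul_left_cancel₀ (mom_ne_zero z) (by
      have e1 := h a b z
      have e2 := h b c z
      have e3 := h c a z
      simp only [gauge] at e1 e2 e3
      linear_combination -mom c * e1 - mom a * e2 - mom b * e3))
  -- Substituting the antisymmetric part makes B_bc - p_c u_b closed in b for each c.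
  choose m hm using fun c => koszul_one_form (by omega) (fun b => B b c - mom c * u b)
    (fun b a => by
      have e := h a b c
      simp only [gauge] at e
      linear_combination e + mom c * hu a b)
  -- The two expressions for the antisymmetric part of B must agree, so 2u - m is closed.
  obtain ⟨ρ, hρ⟩ := koszul_one_form (by omega) (fun b => 2 * u b - m b)
    (fun b c => by
      linear_combination hu b c - hm c b + hm b c)
  have sixth : 6 * algebraMap ℝ (Op D) (1 / 6) = 1 := by
    rw [← map_ofNat (algebraMap ℝ (Op D)) 6, ← map_mul]
    norm_num
  -- At this point B_ab = 2 p_a u_b + p_b u_a - p_a p_b ρ. The weights 4 and 2 in the goal are those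
  -- of the sum of the S* and A* components of δC*.
  refine ⟨fun b => algebraMap ℝ (Op D) (1 / 6) * (mom b * ρ - 3 * u b), fun a b => ?_⟩
  linear_combination hm b a - mom a * hρ b -
    (mom b * u a + 2 * mom a * u b - mom a * mom b * ρ) * sixth

end Solutions

/-! ### Exactness of the Koszul–Tate complex on the linear part -/

theorem IsSym.map {M N : Type*} [AddCommGroup M] [Module ℝ M] [AddCommGroup N] [Module ℝ N]
    {v : Lab D → M} (h : IsSym v) (f : M →ₗ[ℝ] N) : IsSym fun l => f (v l) := by
  rw [isSym_iff, young_map, h.young_eq]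

/-- The bilinear pairing of linear combinations. -/
def pair (φ v : Lin D) : Op D := ∑ l, φ l * v l

theorem pair_young (φ v : Lin D) : pair φ (young v) = pair (young φ) v := by
  have h := sum_young_adjoint (fun l => LinearMap.mul ℝ (Op D) (φ l)) v
  rw [young_map] at h
  exact h

theorem pair_single (v : Lin D) (l : Lab D) : pair (Pi.single l 1) v = v l := by
  rw [pair, Finset.sum_eq_single l]
  · simp
  · intro m _ hm; simp [hm]
  · simp

/-- The pairing is nondegenerate on families with the symmetries. -/
theorem eq_of_pair_eq {v w : Lin D} (hv : IsSym v) (hw : IsSym w)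
    (h : ∀ φ, IsSym φ → pair φ v = pair φ w) : v = w := by
  funext l
  rw [← pair_single v, ← pair_single w, ← hv.young_eq, ← hw.young_eq, pair_young, pair_young]
  exact h _ (isSym_young _)

/-- Evaluation of the linear part of an element of the algebra. -/
def evalLin (φ : Lin D) : Alg D →ₗ[ℝ] Op D :=
  (∑ l, LinearMap.mulLeft ℝ (φ l) ∘ₗ LinearMap.proj l) ∘ₗ linPart

theorem evalLin_apply (φ : Lin D) (a : Alg D) : evalLin φ a = pair φ (linPart a) := by
  simp [evalLin, pair]

theorem evalLin_gen {φ : Lin D} (hφ : IsSym φ) (l : Lab D) (k : Multiset (Fin D)) :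
    evalLin φ (gen (l.at k)) = φ l * mono k := by
  rw [evalLin_apply, linPart_gen, cls_at, pair_young, hφ.young_eq, pair, Finset.sum_eq_single l]
  · simp
  · intro m _ hm; simp [hm]
  · simp

/-- The transpose of the Koszul–Tate differential. -/
def koszulDual (φ : Lin D) : Lin D := fun l => evalLin φ (koszulData.der (gen (l.at 0)))

theorem pair_koszulLin (φ v : Lin D) : pair φ (koszulLin v) = pair (koszulDual φ) v := by
  simp only [pair, koszulDual, evalLin_apply, koszulLin_apply, Finset.sum_apply, Pi.smul_apply,
    smul_eq_mul, Finset.mul_sum, Finset.sum_mul]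
  rw [Finset.sum_comm]
  exact Finset.sum_congr rfl fun l _ => Finset.sum_congr rfl fun m _ => by ring

theorem isSym_koszulDual (φ : Lin D) : IsSym (koszulDual φ) :=
  (isSym_gen 0).map (evalLin φ ∘ₗ koszulData.der)

section Dual

variable {φ : Lin D}

theorem IsSym.isHook_T (hφ : IsSym φ) : IsHook fun a b c => φ (.T a b c) := ⟨hφ.T_anti, hφ.T_cyc⟩

theorem IsSym.isHook_Ts (hφ : IsSym φ) : IsHook fun a b c => φ (.Ts a b c) :=
  ⟨hφ.Ts_anti, hφ.Ts_cyc⟩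

theorem mono_singleton_cons (a : Fin D) : mono (a ::ₘ 0) = mom a := by
  rw [mono_cons, mono_zero, mul_one]

theorem evalLin_Fstr (hφ : IsSym φ) (a b c d : Fin D) (k : Multiset (Fin D)) :
    evalLin φ (Fstr a b c d k) = mono k * fieldStr (fun a b c => φ (.T a b c)) a b c d := by
  have h : ∀ a b c k, evalLin φ (gen (.T a b c k)) = φ (.T a b c) * mono k :=
    fun a b c k => evalLin_gen hφ (.T a b c) k
  simp only [Fstr, map_add, h, mono_cons, fieldStr]
  ring

theorem evalLin_ricci (hφ : IsSym φ) (a b c : Fin D) :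
    evalLin φ (ricci a b c 0) = (1 / 2 : ℝ) • ric (fun a b c => φ (.T a b c)) a b c := by
  simp only [ricci, curv, map_sum, map_smul, map_sub, evalLin_Fstr hφ, ric, Finset.smul_sum,
    mono_singleton_cons]
  refine Finset.sum_congr rfl fun d _ => ?_
  rw [smul_comm, Algebra.smul_def (η d)]
  rfl

theorem evalLin_ricciTr (hφ : IsSym φ) (a : Fin D) :
    evalLin φ (ricciTr a 0) = (1 / 2 : ℝ) • ricTr (fun a b c => φ (.T a b c)) a := by
  simp only [ricciTr, map_sum, map_smul, evalLin_ricci hφ, ricTr, Finset.smul_sum]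
  refine Finset.sum_congr rfl fun d _ => ?_
  rw [smul_comm, Algebra.smul_def (η d)]
  rfl

theorem koszulDual_Ts (hφ : IsSym φ) (a b c : Fin D) : koszulDual φ (.Ts a b c) =
    (3 / 4 : ℝ) • fieldEq (fun a b c => φ (.T a b c)) a b c := by
  have hm : ∀ (x y z : Fin D) (r : Op D), (metric x y * η z) • r =
      if x = y then met x * met z * r else 0 := fun x y z r => by
    rw [metric]
    split_ifs with h
    · rw [Algebra.smul_def, map_mul]; rfl
    · simp
  have h1 : (η a * η b * η c) • ric (fun a b c => φ (.T a b c)) a b c =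
      met a * met b * met c * ric (fun a b c => φ (.T a b c)) a b c := by
    rw [Algebra.smul_def, map_mul, map_mul]; rfl
  rw [koszulDual, DerData.der_gen]
  change evalLin φ (eom a b c 0) = _
  simp only [eom, map_smul, map_add, map_sub, evalLin_ricci hφ, evalLin_ricciTr hφ, fieldEq,
    ← hm, ← h1, two_mul]
  module

theorem koszulDual_Ss (hφ : IsSym φ) (a b : Fin D) : koszulDual φ (.Ss a b) =
    -∑ c, mom c * (φ (.Ts c a b) + φ (.Ts c b a)) := by
  have h : ∀ a b c k, evalLin φ (gen (.Ts a b c k)) = φ (.Ts a b c) * mono k :=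
    fun a b c k => evalLin_gen hφ (.Ts a b c) k
  rw [koszulDual, DerData.der_gen]
  change evalLin φ (-∑ c, (gen (.Ts c a b (c ::ₘ 0)) + gen (.Ts c b a (c ::ₘ 0)))) = _
  simp only [map_neg, map_sum, map_add, h, mono_singleton_cons]
  exact congrArg _ (Finset.sum_congr rfl fun c _ => by ring)

theorem koszulDual_As (hφ : IsSym φ) (a b : Fin D) : koszulDual φ (.As a b) =
    -3 * ∑ c, mom c * (φ (.Ts c a b) - φ (.Ts c b a)) := by
  have h : ∀ a b c k, evalLin φ (gen (.Ts a b c k)) = φ (.Ts a b c) * mono k :=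
    fun a b c k => evalLin_gen hφ (.Ts a b c) k
  rw [koszulDual, DerData.der_gen]
  change evalLin φ (-(3 : ℝ) • ∑ c, (gen (.Ts c a b (c ::ₘ 0)) - gen (.Ts c b a (c ::ₘ 0)))) = _
  simp only [map_smul, map_sum, map_sub, h, mono_singleton_cons]
  rw [Algebra.smul_def, map_neg, map_ofNat]
  exact congrArg _ (Finset.sum_congr rfl fun c _ => by ring)

theorem koszulDual_Cs (hφ : IsSym φ) (a : Fin D) : koszulDual φ (.Cs a) =
    6 * (∑ c, mom c * φ (.Ss c a)) + 2 * ∑ c, mom c * φ (.As c a) := by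
  have h : ∀ a b k, evalLin φ (gen (.Ss a b k)) = φ (.Ss a b) * mono k :=
    fun a b k => evalLin_gen hφ (.Ss a b) k
  have h' : ∀ a b k, evalLin φ (gen (.As a b k)) = φ (.As a b) * mono k :=
    fun a b k => evalLin_gen hφ (.As a b) k
  rw [koszulDual, DerData.der_gen]
  change evalLin φ ((6 : ℝ) • (∑ c, gen (.Ss c a (c ::ₘ 0))) +
    (2 : ℝ) • ∑ c, gen (.As c a (c ::ₘ 0))) = _
  simp only [map_smul, map_sum, map_add, h, h', mono_singleton_cons]
  rw [Algebra.smul_def, Algebra.smul_def, map_ofNat, map_ofNat]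
  simp only [mul_comm (mom _)]

theorem koszulDual_of_lev {l : Lab D} (hl : l.lev = 0 ∨ l.lev = 5) : koszulDual φ l = 0 := by
  rw [koszulDual, DerData.der_gen]
  refine (congrArg _ ?_).trans (map_zero _)
  cases l <;> first | rfl | simp [Lab.lev] at hl

/-- This is the transpose of δ² = 0 on the variables. For S* and A* it is the Noether identities;
for C* it is the vanishing of a double divergence over two antisymmetric indices. -/
theorem koszulDual_koszulDual (hφ : IsSym φ) : koszulDual (koszulDual φ) = 0 := by
  have hK := isSym_koszulDual φ
  have noether : ∀ a b, ∑ c, mom c * koszulDual φ (.Ts c a b) = 0 := fun a b => by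
    simp only [koszulDual_Ts hφ, mul_smul_comm, ← Finset.smul_sum, sum_mom_fieldEq hφ.isHook_T,
      smul_zero]
  funext l
  cases l with
  | Ts a b c =>
    have h : (fun a b c => koszulDual φ (.T a b c)) = fun _ _ _ => 0 := by
      funext a b c; exact koszulDual_of_lev (.inl rfl)
    rw [koszulDual_Ts hK, h]
    simp [fieldEq, ric, ricTr, fieldStr]
  | Ss a b =>
    rw [koszulDual_Ss hK]
    simp only [mul_add, Finset.sum_add_distrib, noether]
    simp
  | As a b =>
    rw [koszulDual_As hK]
    simp only [mul_sub, Finset.sum_sub_distrib, noether]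
    simp
  | Cs a =>
    have h0 : ∑ c, ∑ d, mom c * (mom d * φ (.Ts d c a)) = 0 := by
      apply two_mul_eq_zero
      conv_rhs => rw [Finset.sum_comm]
      rw [← Finset.sum_neg_distrib]
      refine Finset.sum_congr rfl fun b _ => ?_
      rw [← Finset.sum_neg_distrib]
      refine Finset.sum_congr rfl fun c _ => ?_
      rw [hφ.Ts_anti b c a]
      ring
    -- With the weights 6 and 2 of δC* the terms with the last two indices interchanged cancel
    -- between S* and A*.
    have h : koszulDual (koszulDual φ) (.Cs a) =
        -12 * ∑ c, ∑ d, mom c * (mom d * φ (.Ts d c a)) := by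
      rw [koszulDual_Cs hK]
      simp only [koszulDual_Ss hφ, koszulDual_As hφ, Finset.mul_sum, ← Finset.sum_add_distrib,
        ← Finset.sum_neg_distrib]
      exact Finset.sum_congr rfl fun c _ => Finset.sum_congr rfl fun d _ => by ring
    rw [h, h0, mul_zero]
    rfl
  | _ => exact koszulDual_of_lev (by simp [Lab.lev])

theorem isSym_koszulLin (v : Lin D) : IsSym (koszulLin v) := isSym_iff.2 (young_koszulLin v)

theorem koszulLin_koszulLin (v : Lin D) : koszulLin (koszulLin v) = 0 := by
  refine eq_of_pair_eq (isSym_koszulLin _) (isSym_iff.2 (map_zero _)) fun φ hφ => ?_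
  rw [pair_koszulLin, pair_koszulLin, koszulDual_koszulDual hφ]
  simp [pair]

theorem koszul_koszul (a : Alg D) : koszulData.der (koszulData.der a) = 0 := by
  have h := (koszulData (D := D)).isDer.bracket koszulData.isDer koszul_hasParity koszul_hasParity
  have h0 := h.ext (isDer_zero _) fun g => by
    have : koszulData.der (koszulData.der (gen g)) = 0 := by
      rw [koszul_gen_eq, ← toAlg_koszulLin, koszulLin_koszulLin, map_zero]
    simp only [LinearMap.sub_apply, LinearMap.smul_apply, LinearMap.comp_apply, this]
    simp
  have h1 : koszulData.der (koszulData.der a) + koszulData.der (koszulData.der a) = 0 := by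
    simpa using LinearMap.congr_fun h0 a
  rw [← two_smul ℝ] at h1
  exact (smul_eq_zero.1 h1).resolve_left two_ne_zero

end Dual

/-! ### The linear Koszul–Tate complex in components and its exactness -/

theorem isHook_gauge (B : Fin D → Fin D → Op D) : IsHook (gauge B) where
  anti a b c := by simp only [gauge]; ring
  cyc a b c := by simp only [gauge]; ring

/-- The gauge transformation is the transpose of a divergence: the symmetries of H and relabelling
bring the momentum in every term onto the first index. -/
theorem sum_mul_gauge {H : Fin D → Fin D → Fin D → Op D} (hH : IsHook H)
    (B : Fin D → Fin D → Op D) :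
    ∑ a, ∑ b, ∑ c, H a b c * gauge B a b c =
      2 * ∑ a, ∑ b, ∑ c, mom a * (H a b c * (2 * B b c - B c b)) := by
  have s12 : ∀ f : Fin D → Fin D → Fin D → Op D,
      ∑ a, ∑ b, ∑ c, f b a c = ∑ a, ∑ b, ∑ c, f a b c := fun f => Finset.sum_comm
  have s23 : ∀ f : Fin D → Fin D → Fin D → Op D,
      ∑ a, ∑ b, ∑ c, f a c b = ∑ a, ∑ b, ∑ c, f a b c := fun f =>
    Finset.sum_congr rfl fun a _ => Finset.sum_comm
  have e1 := s12 fun a b c => mom a * (H a b c * B b c)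
  have e2 : ∑ a, ∑ b, ∑ c, mom b * (H b c a * B c a) = ∑ a, ∑ b, ∑ c, mom a * (H a b c * B b c) := by
    rw [s12 fun a b c => mom a * (H a c b * B c b), s23 fun a b c => mom a * (H a b c * B b c)]
  have e3 : ∑ a, ∑ b, ∑ c, mom c * (H c a b * B a b) = ∑ a, ∑ b, ∑ c, mom a * (H a b c * B b c) := by
    rw [s23 fun a b c => mom b * (H b a c * B a c), s12 fun a b c => mom a * (H a b c * B b c)]
  have e4 : ∑ a, ∑ b, ∑ c, mom c * (H c b a * B b a) = ∑ a, ∑ b, ∑ c, mom a * (H a b c * B b c) := by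
    rw [s23 fun a b c => mom b * (H b c a * B c a), e2]
  have e5 : ∑ a, ∑ b, ∑ c, mom c * (H c a b * B b a) = ∑ a, ∑ b, ∑ c, mom a * (H a b c * B c b) := by
    rw [s23 fun a b c => mom b * (H b a c * B c a), s12 fun a b c => mom a * (H a b c * B c b)]
  have e6 : ∑ a, ∑ b, ∑ c, mom c * (H c b a * B a b) = ∑ a, ∑ b, ∑ c, mom a * (H a b c * B c b) := by
    rw [s12 fun a b c => mom c * (H c a b * B b a), e5]
  have e : ∑ a, ∑ b, ∑ c, H a b c * gauge B a b c =
      (∑ a, ∑ b, ∑ c, mom a * (H a b c * B b c)) + (∑ a, ∑ b, ∑ c, mom b * (H b a c * B a c)) +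
      (∑ a, ∑ b, ∑ c, mom c * (H c a b * B a b)) - (∑ a, ∑ b, ∑ c, mom c * (H c a b * B b a)) -
      (∑ a, ∑ b, ∑ c, mom c * (H c b a * B a b)) + ∑ a, ∑ b, ∑ c, mom c * (H c b a * B b a) := by
    simp only [← Finset.sum_add_distrib, ← Finset.sum_sub_distrib]
    refine Finset.sum_congr rfl fun a _ => Finset.sum_congr rfl fun b _ =>
      Finset.sum_congr rfl fun c _ => ?_
    have h1 := hH.anti a b c
    have h2 := hH.cyc a b c
    have h3 := hH.anti b c a
    rw [gauge]
    linear_combination (-(mom b * B a c)) * h1 - mom c * (B a b - B b a) * (h2 - h3)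
  rw [e, e1, e3, e4, e5, e6]
  have e7 : ∑ a, ∑ b, ∑ c, mom a * (H a b c * (2 * B b c - B c b)) =
      2 * (∑ a, ∑ b, ∑ c, mom a * (H a b c * B b c)) -
        ∑ a, ∑ b, ∑ c, mom a * (H a b c * B c b) := by
    simp only [Finset.mul_sum, ← Finset.sum_sub_distrib]
    exact Finset.sum_congr rfl fun a _ => Finset.sum_congr rfl fun b _ =>
      Finset.sum_congr rfl fun c _ => by ring
  rw [e7]
  ring

/-- The Koszul–Tate differential of a family with the symmetries in components. -/
def koszulComp (v : Lin D) : Lin D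
  | .T a b c => (3 / 4 : ℝ) • fieldEq (fun a b c => v (.Ts a b c)) a b c
  | .Ts a b c => gauge (fun a b => -(v (.Ss a b) + v (.As a b))) a b c
  | .Ss a b => 3 * (mom a * v (.Cs b) + mom b * v (.Cs a))
  | .As a b => mom a * v (.Cs b) - mom b * v (.Cs a)
  | _ => 0

theorem isSym_koszulComp {v : Lin D} (hv : IsSym v) : IsSym (koszulComp v) := by
  have key : ∀ a b c, koszulComp v (.T a b c) =
      koszulDual (fun | .T a b c => v (.Ts a b c) | _ => 0) (.Ts a b c) := fun a b c => by
    rw [koszulDual_Ts]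
    · rfl
    · exact ⟨hv.Ts_anti, hv.Ts_cyc, by simp, by simp, by simp, by simp, by simp, by simp⟩
  constructor
  · intro a b c; rw [key, key]; exact (isSym_koszulDual _).Ts_anti a b c
  · intro a b c; rw [key, key, key]; exact (isSym_koszulDual _).Ts_cyc a b c
  · intros; rfl
  · intros; simp [koszulComp]
  · exact (isHook_gauge _).anti
  · exact (isHook_gauge _).cyc
  · intros; simp only [koszulComp]; ring
  · intros; simp only [koszulComp]; ring

/-- δ is given by its values on the variables, whereas its action on coefficients is the transpose.
As both sides have the symmetries, it is enough to pair them with test families: the T part is the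
self-adjointness of the field equations, the T* part is `sum_mul_gauge`, and the rest is
relabelling. -/
theorem koszulLin_eq {v : Lin D} (hv : IsSym v) : koszulLin v = koszulComp v := by
  refine eq_of_pair_eq (isSym_koszulLin _) (isSym_koszulComp hv) fun φ hφ => ?_
  have s : ∀ f : Fin D → Fin D → Op D, ∑ a, ∑ b, f b a = ∑ a, ∑ b, f a b :=
    fun f => Finset.sum_comm
  have hT : ∑ a, ∑ b, ∑ c, koszulDual φ (.Ts a b c) * v (.Ts a b c) =
      ∑ a, ∑ b, ∑ c, φ (.T a b c) * koszulComp v (.T a b c) := by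
    have := sum_mul_fieldEq_comm hφ.isHook_T hv.isHook_Ts
    simp only [koszulDual_Ts hφ, koszulComp, mul_smul_comm, smul_mul_assoc, ← Finset.smul_sum]
    rw [← this]
    simp only [mul_comm (v _)]
  have hTs : (∑ a, ∑ b, koszulDual φ (.Ss a b) * v (.Ss a b)) +
      (∑ a, ∑ b, koszulDual φ (.As a b) * v (.As a b)) =
      ∑ a, ∑ b, ∑ c, φ (.Ts a b c) * koszulComp v (.Ts a b c) := by
    simp only [koszulComp]
    rw [sum_mul_gauge hφ.isHook_Ts]
    have e1 : ∑ a, ∑ b, koszulDual φ (.Ss a b) * v (.Ss a b) =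
        -2 * ∑ a, ∑ b, ∑ c, mom c * (φ (.Ts c a b) * v (.Ss a b)) := by
      have e : ∑ a, ∑ b, koszulDual φ (.Ss a b) * v (.Ss a b) =
          -((∑ a, ∑ b, ∑ c, mom c * (φ (.Ts c a b) * v (.Ss a b))) +
          ∑ a, ∑ b, ∑ c, mom c * (φ (.Ts c b a) * v (.Ss b a))) := by
        simp only [koszulDual_Ss hφ, Finset.sum_mul, ← Finset.sum_neg_distrib,
          ← Finset.sum_add_distrib]
        refine Finset.sum_congr rfl fun a _ => Finset.sum_congr rfl fun b _ =>
          Finset.sum_congr rfl fun c _ => ?_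
        rw [hv.Ss_symm b a]
        ring
      rw [e, s fun a b => ∑ c, mom c * (φ (.Ts c a b) * v (.Ss a b))]
      ring
    have e2 : ∑ a, ∑ b, koszulDual φ (.As a b) * v (.As a b) =
        -6 * ∑ a, ∑ b, ∑ c, mom c * (φ (.Ts c a b) * v (.As a b)) := by
      have e : ∑ a, ∑ b, koszulDual φ (.As a b) * v (.As a b) =
          -3 * ((∑ a, ∑ b, ∑ c, mom c * (φ (.Ts c a b) * v (.As a b))) +
          ∑ a, ∑ b, ∑ c, mom c * (φ (.Ts c b a) * v (.As b a))) := by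
        simp only [koszulDual_As hφ, Finset.sum_mul, Finset.mul_sum,
          ← Finset.sum_add_distrib]
        refine Finset.sum_congr rfl fun a _ => Finset.sum_congr rfl fun b _ =>
          Finset.sum_congr rfl fun c _ => ?_
        rw [hv.As_anti b a]
        ring
      rw [e, s fun a b => ∑ c, mom c * (φ (.Ts c a b) * v (.As a b))]
      ring
    have r : ∀ f : Fin D → Fin D → Fin D → Op D,
        ∑ a, ∑ b, ∑ c, f c a b = ∑ a, ∑ b, ∑ c, f a b c := fun f => by
      rw [Finset.sum_congr rfl fun a _ => Finset.sum_comm, Finset.sum_comm]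
    rw [e1, e2, r fun c a b => mom c * (φ (.Ts c a b) * v (.Ss a b)),
      r fun c a b => mom c * (φ (.Ts c a b) * v (.As a b))]
    simp only [Finset.mul_sum, ← Finset.sum_add_distrib]
    refine Finset.sum_congr rfl fun a _ => Finset.sum_congr rfl fun b _ =>
      Finset.sum_congr rfl fun c _ => ?_
    rw [hv.Ss_symm c b, hv.As_anti c b]
    ring
  have hCs : ∑ a, koszulDual φ (.Cs a) * v (.Cs a) =
      (∑ a, ∑ b, φ (.Ss a b) * koszulComp v (.Ss a b)) +
      ∑ a, ∑ b, φ (.As a b) * koszulComp v (.As a b) := by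
    have e1 : ∑ a, ∑ b, φ (.Ss a b) * koszulComp v (.Ss a b) =
        6 * ∑ a, ∑ b, mom b * φ (.Ss b a) * v (.Cs a) := by
      have e : ∑ a, ∑ b, φ (.Ss a b) * koszulComp v (.Ss a b) =
          3 * ((∑ a, ∑ b, mom b * φ (.Ss b a) * v (.Cs a)) +
            ∑ a, ∑ b, mom a * φ (.Ss a b) * v (.Cs b)) := by
        simp only [koszulComp, Finset.mul_sum, ← Finset.sum_add_distrib]
        refine Finset.sum_congr rfl fun a _ => Finset.sum_congr rfl fun b _ => ?_
        rw [hφ.Ss_symm b a]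
        ring
      rw [e, s fun a b => mom b * φ (.Ss b a) * v (.Cs a)]
      ring
    have e2 : ∑ a, ∑ b, φ (.As a b) * koszulComp v (.As a b) =
        2 * ∑ a, ∑ b, mom b * φ (.As b a) * v (.Cs a) := by
      have e : ∑ a, ∑ b, φ (.As a b) * koszulComp v (.As a b) =
          (∑ a, ∑ b, mom b * φ (.As b a) * v (.Cs a)) +
            ∑ a, ∑ b, mom a * φ (.As a b) * v (.Cs b) := by
        simp only [koszulComp, ← Finset.sum_add_distrib]
        refine Finset.sum_congr rfl fun a _ => Finset.sum_congr rfl fun b _ => ?_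
        rw [hφ.As_anti b a]
        ring
      rw [e, s fun a b => mom b * φ (.As b a) * v (.Cs a)]
      ring
    rw [e1, e2]
    simp only [koszulDual_Cs hφ, Finset.mul_sum, ← Finset.sum_add_distrib, Finset.sum_mul, add_mul]
    exact Finset.sum_congr rfl fun a _ => Finset.sum_congr rfl fun b _ => by ring
  rw [pair_koszulLin, pair, pair, sum_lab, sum_lab]
  have z : ∀ l : Lab D, l.lev = 0 ∨ l.lev = 5 → koszulDual φ l = 0 := fun l => koszulDual_of_lev
  have y1 : ∀ a b, koszulComp v (.S a b) = 0 := fun _ _ => rfl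
  have y2 : ∀ a b, koszulComp v (.A a b) = 0 := fun _ _ => rfl
  have y3 : ∀ a, koszulComp v (.C a) = 0 := fun _ => rfl
  have y4 : ∀ a, koszulComp v (.Cs a) = 0 := fun _ => rfl
  simp only [z (.T _ _ _) (.inl rfl), z (.S _ _) (.inr rfl), z (.A _ _) (.inr rfl),
    z (.C _) (.inr rfl), y1, y2, y3, y4, zero_mul, mul_zero, Finset.sum_const_zero, zero_add,
    add_zero, hT, hCs, ← add_assoc]
  rw [add_assoc (∑ a, ∑ b, ∑ c, φ (.T a b c) * koszulComp v (.T a b c)), hTs]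

/-- Exactness of the Koszul–Tate complex on the linear part in positive antifield number. -/
theorem koszulLin_exact (hD : 4 < D) {v : Lin D} (hv : IsSym v)
    (h0 : ∀ l : Lab D, l.lev = 0 ∨ l.lev = 5 → v l = 0) (h : koszulLin v = 0) :
    ∃ w, koszulLin w = v := by
  rw [koszulLin_eq hv] at h
  -- The T component of δv = 0 says that the T* coefficients solve the field equations.
  obtain ⟨B, hB⟩ := exists_eq_gauge hD hv.isHook_Ts fun a b c => by
    have := congrFun h (.T a b c)
    simp only [koszulComp, Pi.zero_apply] at this
    exact (smul_eq_zero.1 this).resolve_left (by norm_num)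
  -- The T* component says that the S* and A* coefficients form a trivial gauge parameter.
  obtain ⟨u, hu⟩ := exists_of_gauge_eq_zero hD (fun a b => -(v (.Ss a b) + v (.As a b)))
    fun a b c => congrFun h (.Ts a b c)
  -- The diagonal of the S* component is 6 p_a times the C* coefficient.
  have hC : ∀ a, v (.Cs a) = 0 := fun a => by
    have := congrFun h (.Ss a a)
    simp only [koszulComp, Pi.zero_apply, ← two_mul] at this
    simpa [mom_ne_zero] using this
  have half : 2 * algebraMap ℝ (Op D) (1 / 2) = 1 := by
    rw [← map_ofNat (algebraMap ℝ (Op D)) 2, ← map_mul]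
    norm_num
  set t := algebraMap ℝ (Op D) (1 / 2)
  -- The S* and A* parts are chosen to add up to -B, the parameter expected by the T* component of
  -- `koszulComp`; u supplies the C* part.
  let w : Lin D := fun
    | .Ss a b => -(t * (B a b + B b a))
    | .As a b => -(t * (B a b - B b a))
    | .Cs a => u a
    | _ => 0
  have hw : IsSym w := by
    constructor <;> intros <;> simp only [w] <;> ring
  refine ⟨w, ?_⟩
  rw [koszulLin_eq hw]
  funext l
  cases l with
  | T a b c =>
    rw [h0 _ (.inl rfl)]
    simp [koszulComp, w, fieldEq, ric, ricTr, fieldStr]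
  | Ts a b c =>
    rw [hB]
    simp only [koszulComp, w, gauge]
    linear_combination (mom a * B b c - mom b * B a c - mom c * (B a b - B b a)) * half
  | Ss a b =>
    simp only [koszulComp, w]
    have e1 := hu a b
    have e2 := hu b a
    have e3 := hv.Ss_symm a b
    have e4 := hv.As_anti a b
    refine mul_left_cancel₀ (two_ne_zero (α := Op D)) ?_
    linear_combination e1 + e2 - e3 + e4
  | As a b =>
    simp only [koszulComp, w]
    have e1 := hu a b
    have e2 := hu b a
    have e3 := hv.Ss_symm a b
    have e4 := hv.As_anti a b
    refine mul_left_cancel₀ (two_ne_zero (α := Op D)) ?_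
    linear_combination e1 - e2 + e3 - e4
  | Cs a => rw [hC]; rfl
  | _ => rw [h0 _ (.inr rfl)]; rfl

/-! ### A contracting homotopy on the linear part -/

/-- The projection to the variables of level `n`. -/
def levProj (n : ℕ) : Lin D →ₗ[ℝ] Lin D where
  toFun v l := if l.lev = n then v l else 0
  map_add' v w := by funext l; simp only [Pi.add_apply]; split_ifs <;> simp
  map_smul' c v := by funext l; simp only [Pi.smul_apply, RingHom.id_apply]; split_ifs <;> simp

theorem levProj_apply (n : ℕ) (v : Lin D) (l : Lab D) :
    levProj n v l = if l.lev = n then v l else 0 := rfl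

theorem levProj_levProj (n : ℕ) (v : Lin D) : levProj n (levProj n v) = levProj n v := by
  funext l
  simp only [levProj_apply]
  split_ifs <;> rfl

theorem levProj_levProj_of_ne {n m : ℕ} (h : n ≠ m) (v : Lin D) : levProj n (levProj m v) = 0 := by
  funext l
  simp only [levProj_apply, Pi.zero_apply]
  split_ifs with h1 h2
  · exact absurd (h1.symm.trans h2) h
  all_goals rfl

theorem Lab.lev_lt (l : Lab D) : l.lev < 6 := by cases l <;> simp [Lab.lev]

theorem sum_levProj (v : Lin D) : ∑ n ∈ Finset.range 6, levProj n v = v := by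
  funext l
  simp [Finset.sum_apply, levProj_apply, l.lev_lt]

theorem levProj_of_le {n : ℕ} (h : 6 ≤ n) (v : Lin D) : levProj n v = 0 := by
  funext l
  have := l.lev_lt
  rw [levProj_apply, if_neg (by omega)]
  rfl

theorem young_levProj (n : ℕ) (v : Lin D) : young (levProj n v) = levProj n (young v) := by
  funext l
  by_cases h : l.lev = n
  · rw [levProj_apply, if_pos h]
    have e : young (levProj n v - v) l = 0 := young_eq_zero_of_kind fun m hm => by
      simp [levProj_apply, Lab.lev_eq_of_kind hm, h]
    rwa [map_sub, Pi.sub_apply, sub_eq_zero] at e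
  · rw [levProj_apply, if_neg h]
    exact young_eq_zero_of_kind fun m hm => by
      rw [levProj_apply, if_neg (by rw [Lab.lev_eq_of_kind hm]; exact h)]

theorem levProj_koszulLin (n : ℕ) (v : Lin D) :
    levProj n (koszulLin v) = koszulLin (levProj (n + 1) v) := by
  funext l
  rw [levProj_apply, koszulLin_apply_apply, koszulLin_apply_apply]
  split_ifs with h
  · refine Finset.sum_congr rfl fun m _ => ?_
    by_cases hm : m.lev = l.lev + 1
    · rw [levProj_apply, if_pos (by omega)]
    · rw [koszulMat_eq_zero hm, mul_zero, mul_zero]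
  · refine (Finset.sum_eq_zero fun m _ => ?_).symm
    by_cases hm : m.lev = l.lev + 1
    · rw [levProj_apply, if_neg (by omega), zero_mul]
    · rw [koszulMat_eq_zero hm, mul_zero]

theorem koszulLin_levProj_zero (v : Lin D) : koszulLin (levProj 0 v) = 0 := by
  funext l
  rw [koszulLin_apply_apply]
  refine Finset.sum_eq_zero fun m _ => ?_
  by_cases hm : m.lev = l.lev + 1
  · rw [levProj_apply, if_neg (by omega), zero_mul]
  · rw [koszulMat_eq_zero hm, mul_zero]

/-- A linear map has a generalized inverse. -/
theorem exists_generalized_inverse {V : Type*} [AddCommGroup V] [Module ℝ V] (f : V →ₗ[ℝ] V) :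
    ∃ g : V →ₗ[ℝ] V, ∀ v, f (g (f v)) = f v := by
  obtain ⟨s, hs⟩ := f.rangeRestrict.exists_rightInverse_of_surjective f.range_rangeRestrict
  obtain ⟨g, hg⟩ := LinearMap.exists_extend s
  refine ⟨g, fun v => ?_⟩
  have h1 := LinearMap.congr_fun hg (f.rangeRestrict v)
  have h2 := LinearMap.congr_fun hs (f.rangeRestrict v)
  have h3 := congrArg Subtype.val h2
  simp only [LinearMap.comp_apply, Submodule.subtype_apply, LinearMap.codRestrict_apply] at h1 h3
  change g (f v) = _ at h1
  rw [h1]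
  exact h3

/-- A generalized inverse of the Koszul–Tate differential which raises the level by one and
respects the symmetries. -/
theorem exists_koszulLin_inverse : ∃ g : Lin D →ₗ[ℝ] Lin D,
    (∀ v, koszulLin (g (koszulLin v)) = koszulLin v) ∧ (∀ v, young (g v) = g v) ∧
    (∀ n v, levProj (n + 1) (g v) = g (levProj n v)) ∧ ∀ v, levProj 0 (g v) = 0 := by
  obtain ⟨g, hg⟩ := exists_generalized_inverse ((koszulLin (D := D)).restrictScalars ℝ)
  simp only [LinearMap.coe_restrictScalars] at hg
  -- Keep only the symmetrized part of g that raises the level by one. It is still a generalized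
  -- inverse, because `koszulLin` lowers the level by exactly one and does not see `young`.
  let g' : Lin D →ₗ[ℝ] Lin D := ∑ n ∈ Finset.range 6, levProj (n + 1) ∘ₗ young ∘ₗ g ∘ₗ levProj n
  have hg' : ∀ v, g' v = ∑ n ∈ Finset.range 6, levProj (n + 1) (young (g (levProj n v))) :=
    fun v => by simp [g']
  refine ⟨g', fun v => ?_, fun v => ?_, fun n v => ?_, fun v => ?_⟩
  · rw [hg', map_sum]
    conv_rhs => rw [← sum_levProj (koszulLin v)]
    refine Finset.sum_congr rfl fun n _ => ?_
    rw [← levProj_koszulLin, levProj_koszulLin n v, koszulLin_young, hg, ← levProj_koszulLin,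
      levProj_levProj]
  · rw [hg', map_sum]
    refine Finset.sum_congr rfl fun n _ => ?_
    rw [young_levProj, young_young]
  · rw [hg', hg', map_sum]
    by_cases hn : n < 6
    · rw [Finset.sum_eq_single_of_mem n (Finset.mem_range.2 hn),
        Finset.sum_eq_single_of_mem n (Finset.mem_range.2 hn), levProj_levProj, levProj_levProj]
      · intro m _ hm
        rw [levProj_levProj_of_ne hm]
        simp
      · intro m _ hm
        rw [levProj_levProj_of_ne (by omega)]
    · have h1 : ∀ w : Lin D, levProj (n + 1) w = 0 := levProj_of_le (by omega)
      have h2 : ∀ w : Lin D, levProj n w = 0 := levProj_of_le (by omega)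
      simp [h1, h2]
  · rw [hg', map_sum]
    exact Finset.sum_eq_zero fun m _ => levProj_levProj_of_ne (by omega) _

theorem levProj_cls (l : Lab D) (k : Multiset (Fin D)) (n : ℕ) :
    levProj n (cls (l.at k)) = if l.lev = n then cls (l.at k) else 0 := by
  funext m
  rw [levProj_apply]
  by_cases hm : m.kind = l.kind
  · rw [Lab.lev_eq_of_kind hm]
    split_ifs <;> rfl
  · rw [cls_at_of_kind hm]
    split_ifs <;> simp [cls_at_of_kind hm]

/-- A contracting homotopy for the Koszul–Tate differential on the linear part. -/
theorem exists_homotopy_lin (hD : 4 < D) : ∃ σ : Lin D →ₗ[ℝ] Lin D,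
    (∀ v, young (σ v) = σ v) ∧
    (∀ (l m : Lab D) k, m.lev ≠ l.lev + 1 → σ (cls (l.at k)) m = 0) ∧
    (∀ (l : Lab D) k, l.lev ≠ 0 → l.lev ≠ 5 →
      koszulLin (σ (cls (l.at k))) + σ (koszulLin (cls (l.at k))) = cls (l.at k)) ∧
    ∀ (l : Lab D) k, l.lev = 0 ∨ l.lev = 5 → koszulLin (cls (l.at k)) = 0 ∧
      koszulLin (σ (koszulLin (σ (cls (l.at k))))) = koszulLin (σ (cls (l.at k))) := by
  obtain ⟨g, h1, h2, h3, h4⟩ := exists_koszulLin_inverse (D := D)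
  let d : Lin D →ₗ[ℝ] Lin D := koszulLin.restrictScalars ℝ
  -- From d g d = d and d² = 0 one gets d σ = d g and σ d = g d - d g g d.
  let σ : Lin D →ₗ[ℝ] Lin D := g ∘ₗ d ∘ₗ g - d ∘ₗ g ∘ₗ g ∘ₗ d ∘ₗ g
  have hσ : ∀ v, σ v = g (koszulLin (g v)) - koszulLin (g (g (koszulLin (g v)))) := fun v => rfl
  have dσ : ∀ v, koszulLin (σ v) = koszulLin (g v) := fun v => by
    rw [hσ, map_sub, koszulLin_koszulLin, sub_zero, h1]
  have σd : ∀ v, σ (koszulLin v) = g (koszulLin v) - koszulLin (g (g (koszulLin v))) := fun v => by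
    rw [hσ, h1]
  refine ⟨σ, fun v => ?_, fun l m k hm => ?_, fun l k hl hl' => ?_, fun l k hl => ?_⟩
  · rw [hσ, map_sub, h2, young_koszulLin]
  · have e : σ (cls (l.at k)) = levProj (l.lev + 1) (σ (cls (l.at k))) := by
      have : cls (l.at k) = levProj l.lev (cls (l.at k)) := by rw [levProj_cls, if_pos rfl]
      conv_lhs => rw [this]
      rw [hσ, hσ, map_sub, h3, levProj_koszulLin, h3, levProj_koszulLin, h3, h3, levProj_koszulLin,
        h3]
    rw [e, levProj_apply, if_neg hm]
  · set v := cls (l.at k)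
    -- The element v - g d v is closed with no part at levels 0 and 5, hence exact, so d g fixes it.
    -- That equation is precisely d σ v + σ d v = v.
    have hx : ∃ w, koszulLin w = v - g (koszulLin v) := by
      refine koszulLin_exact hD (isSym_iff.2 ?_) ?_ ?_
      · rw [map_sub, h2, young_cls]
      · have e0 : levProj 0 (v - g (koszulLin v)) = 0 := by
          rw [map_sub, h4, levProj_cls, if_neg hl, sub_zero]
        have e5 : levProj 5 (v - g (koszulLin v)) = 0 := by
          rw [map_sub, h3, levProj_koszulLin, levProj_cls, if_neg hl']
          simp
        rintro m (hm | hm)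
        · simpa [levProj_apply, hm] using congrFun e0 m
        · simpa [levProj_apply, hm] using congrFun e5 m
      · rw [map_sub, h1, sub_self]
    obtain ⟨w, hw⟩ := hx
    have e : koszulLin (g (v - g (koszulLin v))) = v - g (koszulLin v) := by rw [← hw, h1]
    rw [map_sub, map_sub] at e
    rw [dσ, σd]
    linear_combination (exp := 1) e
  · have hd : koszulLin (cls (l.at k)) = 0 := by
      rcases hl with hl | hl
      · have : cls (l.at k) = levProj 0 (cls (l.at k)) := by rw [levProj_cls, if_pos hl]
        rw [this, koszulLin_levProj_zero]
      · rw [koszulLin_cls, DerData.der_gen]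
        refine (congrArg _ ?_).trans (map_zero _)
        cases l <;> first | rfl | simp [Lab.lev] at hl
    exact ⟨hd, by rw [dσ, dσ, h1]⟩

/-! ### Operators with positive integer eigenvalues -/

section Eigen

variable {M : Type*} [AddCommGroup M] [Module ℝ M]

/-- The span of the eigenvectors of `L` with integer eigenvalues at least `k`. -/
def eigenSpan (L : M →ₗ[ℝ] M) (k : ℕ) : Submodule ℝ M :=
  Submodule.span ℝ {a | ∃ n : ℕ, k ≤ n ∧ L a = (n : ℝ) • a}

/-- An operator can be inverted, by a polynomial in it, on sums of eigenvectors with positive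
eigenvalues. -/
theorem exists_polynomial_inverse (L : Module.End ℝ M) {x : M} (hx : x ∈ eigenSpan L 1) :
    ∃ f : Polynomial ℝ, L (Polynomial.aeval L f x) = x := by
  open Polynomial in
  -- A finite sum of eigenvectors is annihilated by a polynomial with roots 1, …, N only.
  have key : ∃ N : ℕ, aeval L (∏ i ∈ Finset.range N, (X - C ((i : ℝ) + 1))) x = 0 := by
    have mono : ∀ {N N' : ℕ} {y : M}, N ≤ N' →
        aeval L (∏ i ∈ Finset.range N, (X - C ((i : ℝ) + 1))) y = 0 →
        aeval L (∏ i ∈ Finset.range N', (X - C ((i : ℝ) + 1))) y = 0 := by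
      intro N N' y h hy
      obtain ⟨c, hc⟩ := Finset.prod_dvd_prod_of_subset _ _ (fun i : ℕ => X - C ((i : ℝ) + 1))
        (Finset.range_mono h)
      rw [hc, mul_comm, map_mul, Module.End.mul_apply, hy, map_zero]
    induction hx using Submodule.span_induction with
    | mem a ha =>
      obtain ⟨n, hn, ha⟩ := ha
      refine ⟨n, ?_⟩
      obtain ⟨m, rfl⟩ : ∃ m, n = m + 1 := ⟨n - 1, by omega⟩
      rw [Finset.prod_range_succ, map_mul, Module.End.mul_apply]
      have : aeval L (X - C ((m : ℝ) + 1)) a = 0 := by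
        rw [map_sub, aeval_X, aeval_C, LinearMap.sub_apply, ha, Module.algebraMap_end_apply]
        push_cast
        exact sub_self _
      rw [this, map_zero]
    | zero => exact ⟨0, by simp⟩
    | add a b _ _ ha hb =>
      obtain ⟨N, hN⟩ := ha
      obtain ⟨N', hN'⟩ := hb
      refine ⟨max N N', ?_⟩
      rw [map_add, mono (le_max_left _ _) hN, mono (le_max_right _ _) hN', add_zero]
    | smul c a _ ha =>
      obtain ⟨N, hN⟩ := ha
      exact ⟨N, by rw [map_smul, hN, smul_zero]⟩
  obtain ⟨N, hN⟩ := key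
  set h : Polynomial ℝ := ∏ i ∈ Finset.range N, (.X - .C ((i : ℝ) + 1)) with hh
  have h0 : h.coeff 0 ≠ 0 := by
    rw [Polynomial.coeff_zero_eq_eval_zero, hh, Polynomial.eval_prod]
    refine Finset.prod_ne_zero_iff.2 fun i _ => ?_
    have : (i : ℝ) + 1 ≠ 0 := by positivity
    simpa using fun e => this (by linarith)
  -- As h(0) ≠ 0, the relation h(L) x = 0 can be solved for x as L applied to a polynomial in L.
  refine ⟨-(h.coeff 0)⁻¹ • h.divX, ?_⟩
  have e := hN
  rw [← Polynomial.divX_mul_X_add h, map_add, mul_comm, map_mul, Polynomial.aeval_X,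
    Polynomial.aeval_C, LinearMap.add_apply, Module.End.mul_apply, Module.algebraMap_end_apply] at e
  rw [map_smul, LinearMap.smul_apply, map_smul, eq_neg_of_add_eq_zero_left e, smul_neg, neg_smul,
    neg_neg, smul_smul, inv_mul_cancel₀ h0, one_smul]

theorem aeval_mem {L : Module.End ℝ M} {S : Submodule ℝ M} (h : ∀ x ∈ S, L x ∈ S)
    (f : Polynomial ℝ) {x : M} (hx : x ∈ S) : Polynomial.aeval L f x ∈ S := by
  induction f using Polynomial.induction_on' with
  | add f g hf hg => rw [map_add]; exact add_mem hf hg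
  | monomial n c =>
    rw [Polynomial.aeval_monomial, Module.End.mul_apply, Module.algebraMap_end_apply]
    refine Submodule.smul_mem _ _ ?_
    induction n with
    | zero => simpa
    | succ n ih => rw [pow_succ', Module.End.mul_apply]; exact h _ ih

theorem aeval_comm {L T : Module.End ℝ M} (h : ∀ x, T (L x) = L (T x))
    (f : Polynomial ℝ) (x : M) : T (Polynomial.aeval L f x) = Polynomial.aeval L f (T x) := by
  induction f using Polynomial.induction_on' with
  | add f g hf hg => rw [map_add, LinearMap.add_apply, map_add, hf, hg, LinearMap.add_apply]
  | monomial n c =>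
    rw [Polynomial.aeval_monomial, Module.End.mul_apply, Module.algebraMap_end_apply, map_smul,
      Module.End.mul_apply, Module.algebraMap_end_apply]
    congr 1
    induction n with
    | zero => simp
    | succ n ih => rw [pow_succ', Module.End.mul_apply, h, ih, Module.End.mul_apply]

end Eigen

/-! ### A contracting homotopy on the algebra -/

theorem toAlg_mem_span {p : Lab D → Prop} {v : Lin D} (h : ∀ m, ¬ p m → v m = 0) :
    toAlg v ∈ Submodule.span ℝ {a | ∃ (m : Lab D) (k : Multiset (Fin D)), p m ∧ a = gen (m.at k)} := by
  rw [toAlg_apply]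
  refine sum_mem fun m _ => ?_
  by_cases hm : p m
  · generalize v m = r
    induction r using op_induction with
    | mono k => rw [genOp_mono]; exact Submodule.subset_span ⟨m, k, hm, rfl⟩
    | add r s hr hs => rw [map_add]; exact add_mem hr hs
    | smul c r hr => rw [map_smul]; exact Submodule.smul_mem _ _ hr
  · rw [h m hm, map_zero]; exact zero_mem _

theorem sgn_two (a : Alg D) : sgn D 2 a = a := by
  have : (sgn D 2).toLinearMap = LinearMap.id := by
    refine linearMap_ext_gen_mul (by simp) fun g a ha => ?_
    simp only [AlgHom.toLinearMap_apply, LinearMap.id_apply] at ha ⊢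
    rw [map_mul, ha, sgn_gen, pow_mul]
    simp
  exact LinearMap.congr_fun this a

theorem Lab.antigh_ne_zero {l : Lab D} (h : l.antigh ≠ 0) : l.lev ≠ 0 ∧ l.lev ≠ 5 := by
  cases l <;> simp_all [Lab.antigh, Lab.lev, Lab.at, Gen.antigh]

/-- A contracting homotopy for the Koszul–Tate differential up to an operator with integer
eigenvalues, positive in positive antifield number. -/
theorem exists_homotopy (hD : 4 < D) : ∃ s : Alg D →ₗ[ℝ] Alg D,
    (∀ p q a, a ∈ formsA D p q → s a ∈ formsA D p (q + 1)) ∧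
    ∀ l : List (Gen D), (l.map Gen.antigh).sum ≠ 0 →
      (l.map gen).prod ∈ eigenSpan (koszulData.der ∘ₗ s + s ∘ₗ koszulData.der) 1 := by
  obtain ⟨σ, h1, h2, h3, h4⟩ := exists_homotopy_lin hD
  have hspan : ∀ (l : Lab D) k, toAlg (σ (cls (l.at k))) ∈ Submodule.span ℝ
      {a | ∃ (m : Lab D) (k : Multiset (Fin D)), m.lev = l.lev + 1 ∧ a = gen (m.at k)} :=
    fun l k => toAlg_mem_span fun m hm => h2 l m k hm
  have hpar : ∀ g : Gen D, HasParity (g.parity + 1) (toAlg (σ (cls g))) := by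
    intro g
    rcases g.eq_dx_or_at with ⟨ν, rfl⟩ | ⟨l, k, rfl⟩
    · simp only [cls, map_zero]; exact HasParity.zero _
    · have := hspan l k
      generalize toAlg (σ (cls (l.at k))) = a at this ⊢
      induction this using Submodule.span_induction with
      | mem a ha =>
        obtain ⟨m, k', hm, rfl⟩ := ha
        refine (hasParity_gen _).congr ?_
        rw [parity_at, parity_at]
        exact Lab.parity_add_one_of_lev hm
      | zero => exact HasParity.zero _
      | add a b _ _ ha hb => exact ha.add hb
      | smul c a _ ha => exact ha.smul c
  have hsuper : ∀ g : Gen D, SuperComm (g.parity + 1) (toAlg (σ (cls g))) := by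
    intro g
    rcases g.eq_dx_or_at with ⟨ν, rfl⟩ | ⟨l, k, rfl⟩
    · simp only [cls, map_zero]; exact SuperComm.zero _
    · have := hspan l k
      generalize toAlg (σ (cls (l.at k))) = a at this ⊢
      induction this using Submodule.span_induction with
      | mem a ha =>
        obtain ⟨m, k', hm, rfl⟩ := ha
        refine (superComm_gen _).congr ?_
        rw [parity_at, parity_at]
        exact Lab.parity_add_one_of_lev hm
      | zero => exact SuperComm.zero _
      | add a b _ _ ha hb => exact ha.add hb
      | smul c a _ ha => exact ha.smul c
  -- The linear homotopy is extended to the whole algebra as an odd derivation.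
  let X : DerData D 1 := ⟨fun g => toAlg (σ (cls g)), hsuper, fun v hv => by
    have := Finsupp.apply_linearCombination ℝ (toAlg ∘ₗ σ) cls v
    rw [linearCombination_cls hv, map_zero] at this
    exact this.symm⟩
  have hX : ∀ g, X.der (gen g) = toAlg (σ (cls g)) := X.der_gen
  have hXlin : ∀ v : Lin D, X.der (toAlg v) = toAlg (σ (young v)) := by
    intro v
    induction v using lin_induction with
    | zero => simp
    | single l k => rw [toAlg_single, genOp_mono, hX, cls_at]
    | add v w hv hw => simp only [map_add, hv, hw]
    | smul c v hv => simp only [map_smul, hv]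
  -- For two odd derivations the graded commutator is the anticommutator, so L is an even derivation
  -- and its eigenvalues add under multiplication.
  have hL := koszulData.isDer.bracket X.isDer koszul_hasParity (fun g => by rw [hX]; exact hpar g)
  have e0 : koszulData.der ∘ₗ X.der - (-1 : ℝ) ^ (1 * 1) • X.der ∘ₗ koszulData.der =
      koszulData.der ∘ₗ X.der + X.der ∘ₗ koszulData.der := by
    refine LinearMap.ext fun a => ?_
    rw [LinearMap.sub_apply, LinearMap.smul_apply, LinearMap.add_apply, one_mul, pow_one, neg_smul,
      one_smul, sub_neg_eq_add]
  rw [e0] at hL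
  set L := koszulData.der ∘ₗ X.der + X.der ∘ₗ koszulData.der with hLdef
  have hLlin : ∀ v : Lin D, young v = v →
      L (toAlg v) = toAlg (koszulLin (σ v) + σ (koszulLin v)) := by
    intro v hv
    rw [hLdef, LinearMap.add_apply, LinearMap.comp_apply, LinearMap.comp_apply, hXlin, hv,
      ← toAlg_koszulLin, ← toAlg_koszulLin, hXlin, young_koszulLin, map_add]
  have hLmul : ∀ z a, L (z * a) = L z * a + z * L a := fun z a => by
    have := hL.mul z a
    rw [sgn_two] at this
    exact this
  have mul_one_mem : ∀ (z a : Alg D) (k : ℕ), L z = z → a ∈ eigenSpan L k →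
      z * a ∈ eigenSpan L (k + 1) := by
    intro z a k hz ha
    induction ha using Submodule.span_induction with
    | mem a ha =>
      obtain ⟨n, hn, ha⟩ := ha
      refine Submodule.subset_span ⟨n + 1, by omega, ?_⟩
      rw [hLmul, hz, ha, mul_smul_comm]
      push_cast
      module
    | zero => rw [mul_zero]; exact zero_mem _
    | add a b _ _ ha hb => rw [mul_add]; exact add_mem ha hb
    | smul c a _ ha => rw [mul_smul_comm]; exact Submodule.smul_mem _ _ ha
  have mul_zero_mem : ∀ (z a : Alg D) (k : ℕ), L z = 0 → a ∈ eigenSpan L k →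
      z * a ∈ eigenSpan L k := by
    intro z a k hz ha
    induction ha using Submodule.span_induction with
    | mem a ha =>
      obtain ⟨n, hn, ha⟩ := ha
      refine Submodule.subset_span ⟨n, hn, ?_⟩
      rw [hLmul, hz, ha, mul_smul_comm, zero_mul, zero_add]
    | zero => rw [mul_zero]; exact zero_mem _
    | add a b _ _ ha hb => rw [mul_add]; exact add_mem ha hb
    | smul c a _ ha => rw [mul_smul_comm]; exact Submodule.smul_mem _ _ ha
  have anti : ∀ k, eigenSpan L (k + 1) ≤ eigenSpan L k := fun k =>
    Submodule.span_mono fun a ⟨n, hn, ha⟩ => ⟨n, by omega, ha⟩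
  have hLgen : ∀ (l : Lab D) k, l.lev ≠ 0 → l.lev ≠ 5 → L (gen (l.at k)) = gen (l.at k) := by
    intro l k hl hl'
    rw [← toAlg_cls_at, hLlin _ (young_cls _), h3 l k hl hl']
  have gen_mul_mem : ∀ (g : Gen D) (a : Alg D) (k : ℕ), a ∈ eigenSpan L k →
      gen g * a ∈ eigenSpan L k := by
    intro g a k ha
    rcases g.eq_dx_or_at with ⟨ν, rfl⟩ | ⟨l, n, rfl⟩
    · refine mul_zero_mem _ _ _ ?_ ha
      rw [hLdef, LinearMap.add_apply, LinearMap.comp_apply, LinearMap.comp_apply, hX, koszul_gen_dx]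
      simp [cls]
    -- On fields and ghosts L acts as a projector. The generator therefore splits into an
    -- eigenvector of eigenvalue 0 and one of eigenvalue 1, the latter being its δ-exact part.
    · by_cases hl : l.lev = 0 ∨ l.lev = 5
      · obtain ⟨h5, h6⟩ := h4 l n hl
        set c := cls (l.at n)
        have e1 : L (gen (l.at n)) = toAlg (koszulLin (σ c)) := by
          rw [← toAlg_cls_at, hLlin _ (young_cls _), h5, map_zero, add_zero]
        have e2 : L (toAlg (koszulLin (σ c))) = toAlg (koszulLin (σ c)) := by
          rw [hLlin _ (young_koszulLin _), h6, koszulLin_koszulLin, map_zero, add_zero]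
        rw [← sub_add_cancel (gen (l.at n)) (toAlg (koszulLin (σ c))), add_mul]
        refine add_mem (mul_zero_mem _ _ _ ?_ ha) (anti _ (mul_one_mem _ _ _ e2 ha))
        rw [map_sub, e1, e2, sub_self]
      · push Not at hl
        exact anti _ (mul_one_mem _ _ _ (hLgen l n hl.1 hl.2) ha)
  refine ⟨X.der, fun p q a ha => ?_, fun l hl => ?_⟩
  · have := X.isDer.mem_formsA (dp := 0) (dq := 1) (fun g => ?_) ha
    · simpa using this
    rw [hX]
    rcases g.eq_dx_or_at with ⟨ν, rfl⟩ | ⟨l, k, rfl⟩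
    · simp [cls]
    · refine Submodule.span_le.2 ?_ (hspan l k)
      rintro _ ⟨m, k', hm, rfl⟩
      have := gen_mem_formsA (m.at k')
      rw [formDeg_at, antigh_at, Lab.antigh_add_one_of_lev hm] at this
      simpa using this
  · have hone : (1 : Alg D) ∈ eigenSpan L 0 :=
      Submodule.subset_span ⟨0, le_rfl, by rw [hL.one]; simp⟩
    have hall : ∀ l : List (Gen D), (l.map gen).prod ∈ eigenSpan L 0 := by
      intro l
      induction l with
      | nil => simpa using hone
      | cons g l ih => simpa using gen_mul_mem g _ 0 ih
    induction l with
    | nil => simp at hl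
    | cons g l ih =>
      rw [List.map_cons, List.prod_cons]
      -- Some factor of the word has nonzero antifield number. On it L is the identity, which raises
      -- the lower bound on the eigenvalues from 0 to 1.
      by_cases hg : g.antigh = 0
      · refine gen_mul_mem g _ 1 (ih ?_)
        simpa [hg] using hl
      · rcases g.eq_dx_or_at with ⟨ν, rfl⟩ | ⟨m, k, rfl⟩
        · simp [Gen.antigh] at hg
        · rw [antigh_at] at hg
          obtain ⟨h5, h6⟩ := Lab.antigh_ne_zero hg
          exact mul_one_mem _ _ 0 (hLgen m k h5 h6) (hall l)

/-! ### Operators on local forms -/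

variable {K : CoeffClass D}

theorem tmul_mem_forms (f : K.Fn) {p q : ℤ} {a : Alg D} (ha : a ∈ formsA D p q) :
    f ⊗ₜ[ℝ] a ∈ forms K p q := by
  induction ha using Submodule.span_induction with
  | mem a ha =>
    obtain ⟨l, h1, h2, rfl⟩ := ha
    exact Submodule.subset_span ⟨f, l, h1, h2, rfl⟩
  | zero => rw [TensorProduct.tmul_zero]; exact zero_mem _
  | add a b _ _ ha hb => rw [TensorProduct.tmul_add]; exact add_mem ha hb
  | smul c a _ ha => rw [TensorProduct.tmul_smul]; exact Submodule.smul_mem _ _ ha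

theorem forms_le {p q : ℤ} {S : Submodule ℝ (LocalForm K)}
    (h : ∀ f, ∀ a ∈ formsA D p q, f ⊗ₜ[ℝ] a ∈ S) : forms K p q ≤ S :=
  Submodule.span_le.2 <| by
    rintro _ ⟨f, l, h1, h2, rfl⟩
    exact h f _ (Submodule.subset_span ⟨l, h1, h2, rfl⟩)

theorem lTensor_mem_forms {X : Alg D →ₗ[ℝ] Alg D} {p q p' q' : ℤ}
    (h : ∀ a ∈ formsA D p q, X a ∈ formsA D p' q') {b : LocalForm K} (hb : b ∈ forms K p q) :
    X.lTensor K.Fn b ∈ forms K p' q' := by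
  refine forms_le (S := (forms K p' q').comap (X.lTensor K.Fn)) (fun f a ha => ?_) hb
  exact tmul_mem_forms f (h a ha)

theorem δ_tmul (f : K.Fn) (a : Alg D) : δ K (f ⊗ₜ[ℝ] a) = f ⊗ₜ[ℝ] koszulData.der a := rfl

theorem totalDeriv_tmul (μ : Fin D) (f : K.Fn) (a : Alg D) :
    totalDeriv K μ (f ⊗ₜ[ℝ] a) = K.pd μ f ⊗ₜ[ℝ] a + f ⊗ₜ[ℝ] (partialData μ).der a := rfl

theorem δ_mem_forms {p q : ℤ} {b : LocalForm K} (hb : b ∈ forms K p q) :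
    δ K b ∈ forms K p (q - 1) := lTensor_mem_forms (fun _ => koszul_mem_formsA) hb

theorem totalDeriv_mem_forms (μ : Fin D) {p q : ℤ} {b : LocalForm K} (hb : b ∈ forms K p q) :
    totalDeriv K μ b ∈ forms K p q := by
  refine forms_le (S := (forms K p q).comap (totalDeriv K μ)) (fun f a ha => ?_) hb
  rw [Submodule.mem_comap, totalDeriv_tmul]
  exact add_mem (tmul_mem_forms _ ha) (tmul_mem_forms _ (partial_mem_formsA μ ha))

theorem δ_δ (b : LocalForm K) : δ K (δ K b) = 0 := by
  induction b using TensorProduct.induction_on with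
  | zero => simp
  | tmul f a => rw [δ_tmul, δ_tmul, koszul_koszul, TensorProduct.tmul_zero]
  | add b c hb hc => rw [map_add, map_add, hb, hc, add_zero]

/-- An operator on `Alg D` that commutes with the `∂_μ` commutes with the total derivatives. -/
theorem lTensor_totalDeriv {X : Alg D →ₗ[ℝ] Alg D} {μ : Fin D}
    (h : ∀ a, X ((partialData μ).der a) = (partialData μ).der (X a)) (b : LocalForm K) :
    X.lTensor K.Fn (totalDeriv K μ b) = totalDeriv K μ (X.lTensor K.Fn b) := by
  induction b using TensorProduct.induction_on with
  | zero => simp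
  | tmul f a =>
    rw [totalDeriv_tmul, map_add, LinearMap.lTensor_tmul, LinearMap.lTensor_tmul,
      LinearMap.lTensor_tmul, totalDeriv_tmul, h]
  | add b c hb hc => rw [map_add, map_add, hb, hc, map_add, map_add]

theorem δ_totalDeriv (μ : Fin D) (b : LocalForm K) :
    δ K (totalDeriv K μ b) = totalDeriv K μ (δ K b) := lTensor_totalDeriv (koszul_partial μ) b

/-- Symmetry of second derivatives of smooth functions; it lets polynomials in the total derivatives
act on local forms. -/
theorem pd_comm (μ ν : Fin D) (f : K.Fn) : K.pd μ (K.pd ν f) = K.pd ν (K.pd μ f) := by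
  have hf : ContDiff ℝ ∞ f.1 := K.smooth f.1 f.2
  have hd : Differentiable ℝ (fderiv ℝ f.1) :=
    (hf.fderiv_right (m := ∞) (by simp)).differentiable (by simp)
  have key : ∀ (v w : Fin D → ℝ) (x : Fin D → ℝ),
      fderiv ℝ (fun y => fderiv ℝ f.1 y v) x w = fderiv ℝ (fderiv ℝ f.1) x w v := by
    intro v w x
    rw [fderiv_clm_apply (hd x) (differentiableAt_const v)]
    simp
  refine Subtype.ext (funext fun x => ?_)
  change fderiv ℝ (fun y => fderiv ℝ f.1 y (Pi.single ν 1)) x (Pi.single μ 1) =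
    fderiv ℝ (fun y => fderiv ℝ f.1 y (Pi.single μ 1)) x (Pi.single ν 1)
  rw [key, key]
  exact (hf.contDiffAt.isSymmSndFDerivAt (by simpa using ENat.LEInfty.out)) _ _

theorem totalDeriv_comm (μ ν : Fin D) (b : LocalForm K) :
    totalDeriv K μ (totalDeriv K ν b) = totalDeriv K ν (totalDeriv K μ b) := by
  induction b using TensorProduct.induction_on with
  | zero => simp
  | tmul f a =>
    simp only [totalDeriv_tmul, map_add]
    rw [pd_comm μ ν, partial_comm μ ν]
    abel
  | add b c hb hc => rw [map_add, map_add, hb, hc, map_add, map_add]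

/-- Left multiplication by an element of `Alg D`. -/
def mulL (K : CoeffClass D) : Alg D →ₗ[ℝ] LocalForm K →ₗ[ℝ] LocalForm K :=
  LinearMap.lTensorHom K.Fn ∘ₗ LinearMap.mul ℝ (Alg D)

theorem mulL_tmul (u : Alg D) (f : K.Fn) (a : Alg D) :
    mulL K u (f ⊗ₜ[ℝ] a) = f ⊗ₜ[ℝ] (u * a) := rfl

theorem mulL_mem_forms {u : Alg D} {p q p' q' : ℤ} (hu : u ∈ formsA D p q) {b : LocalForm K}
    (hb : b ∈ forms K p' q') : mulL K u b ∈ forms K (p + p') (q + q') :=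
  lTensor_mem_forms (fun _ ha => mul_mem_formsA hu ha) hb

theorem totalDeriv_mulL (μ : Fin D) (u : Alg D) (b : LocalForm K) :
    totalDeriv K μ (mulL K u b) =
      mulL K ((partialData μ).der u) b + mulL K u (totalDeriv K μ b) := by
  induction b using TensorProduct.induction_on with
  | zero => simp
  | tmul f a =>
    have hs : sgn D 0 u = u := by
      have : (sgn D 0).toLinearMap = LinearMap.id :=
        linearMap_ext_gen_mul (by simp) fun g a ha => by simpa using congrArg (gen g * ·) ha
      exact LinearMap.congr_fun this u
    have := (partialData μ).isDer.mul u a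
    rw [hs] at this
    simp only [totalDeriv_tmul, mulL_tmul, map_add, this, TensorProduct.tmul_add, AlgHom.id_apply]
    abel
  | add b c hb hc => simp only [map_add, hb, hc]; abel

theorem δ_mulL_gen (g : Gen D) (b : LocalForm K) : δ K (mulL K (gen g) b) =
    mulL K (koszulData.der (gen g)) b + (-1 : ℝ) ^ g.parity • mulL K (gen g) (δ K b) := by
  induction b using TensorProduct.induction_on with
  | zero => simp
  | tmul f a =>
    rw [mulL_tmul, δ_tmul, koszulData.isDer.apply_gen_mul, δ_tmul, mulL_tmul, mulL_tmul, one_mul,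
      TensorProduct.tmul_add, TensorProduct.tmul_smul]
  | add b c hb hc => simp only [map_add, hb, hc, smul_add]; abel

/-- In positive antifield number the Koszul–Tate differential has no cohomology. -/
theorem exists_δ_eq (hD : 4 < D) {p q : ℤ} (hq : q ≠ 0) {x : LocalForm K} (hx : x ∈ forms K p q)
    (h : δ K x = 0) : ∃ y ∈ forms K p (q + 1), δ K y = x := by
  obtain ⟨s, hs, hL⟩ := exists_homotopy hD
  let L : Module.End ℝ (LocalForm K) :=
    (koszulData.der ∘ₗ s + s ∘ₗ koszulData.der).lTensor K.Fn
  have hLx : ∀ b, L b = δ K (s.lTensor K.Fn b) + s.lTensor K.Fn (δ K b) := by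
    intro b
    simp only [L, LinearMap.lTensor_add, LinearMap.lTensor_comp]
    rfl
  have hδL : ∀ b, δ K (L b) = L (δ K b) := fun b => by
    rw [hLx, hLx, map_add, δ_δ, δ_δ, map_zero, zero_add, add_zero]
  have hLf : ∀ b ∈ forms K p q, L b ∈ forms K p q := fun b hb => by
    rw [hLx]
    refine add_mem ?_ ?_
    · have := δ_mem_forms (lTensor_mem_forms (hs p q) hb)
      rwa [add_sub_cancel_right] at this
    · have := lTensor_mem_forms (hs p (q - 1)) (δ_mem_forms hb)
      rwa [sub_add_cancel] at this
  have hxL : x ∈ eigenSpan L 1 := by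
    refine Submodule.span_le.2 ?_ hx
    rintro _ ⟨f, l, -, h2, rfl⟩
    have hl := hL l (by rw [h2]; exact hq)
    refine Submodule.span_induction (p := fun a _ => f ⊗ₜ[ℝ] a ∈ eigenSpan L 1) ?_ ?_ ?_ ?_ hl
    · rintro a ⟨n, hn, ha⟩
      refine Submodule.subset_span ⟨n, hn, ?_⟩
      rw [← TensorProduct.tmul_smul, ← ha]
      rfl
    · rw [TensorProduct.tmul_zero]; exact zero_mem _
    · intro a b _ _ ha hb; rw [TensorProduct.tmul_add]; exact add_mem ha hb
    · intro c a _ ha; rw [TensorProduct.tmul_smul]; exact Submodule.smul_mem _ _ ha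
  obtain ⟨f, hf⟩ := exists_polynomial_inverse L hxL
  -- L commutes with δ, so f(L) x is closed and x = L f(L) x reduces to δ s f(L) x.
  have h0 : δ K (Polynomial.aeval L f x) = 0 := by
    rw [aeval_comm (T := δ K) hδL, h, map_zero]
  refine ⟨_, lTensor_mem_forms (hs p q) (aeval_mem hLf f hx), ?_⟩
  rw [hLx, h0, map_zero, add_zero] at hf
  exact hf

/-! ### Differential operators acting on local forms -/

-- The target is not commutative, so the polynomials are evaluated in the commutative subalgebra
-- generated by the given elements.
open scoped IsMulCommutative in
theorem exists_algHom_of_commute {A : Type*} [Ring A] [Algebra ℝ A] (f : Fin D → A)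
    (h : ∀ i j, f i * f j = f j * f i) : ∃ ρ : Op D →ₐ[ℝ] A, ∀ i, ρ (MvPolynomial.X i) = f i := by
  let S := Algebra.adjoin ℝ (Set.range f)
  have : IsMulCommutative S := Algebra.isMulCommutative_adjoin ℝ (by
    rintro _ ⟨i, rfl⟩ _ ⟨j, rfl⟩
    exact h i j)
  let f' : Fin D → S := fun i => ⟨f i, Algebra.subset_adjoin ⟨i, rfl⟩⟩
  refine ⟨S.val.comp (MvPolynomial.aeval f'), fun i => ?_⟩
  rw [AlgHom.comp_apply, MvPolynomial.aeval_X]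
  rfl

/-- Each indeterminate acts with the minus sign that integration by parts produces. -/
theorem exists_opAct (K : CoeffClass D) : ∃ ρ : Op D →ₐ[ℝ] Module.End ℝ (LocalForm K),
    ∀ μ, ρ (MvPolynomial.X μ) = -totalDeriv K μ :=
  exists_algHom_of_commute (A := Module.End ℝ (LocalForm K)) (fun μ => -totalDeriv K μ)
    fun μ ν => LinearMap.ext fun b => by
      simpa [Module.End.mul_apply] using totalDeriv_comm μ ν b

/-- The formal adjoint `r(-∂)` of a differential operator `r(∂)`. -/
def opAct (K : CoeffClass D) : Op D →ₐ[ℝ] Module.End ℝ (LocalForm K) := (exists_opAct K).choose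

theorem opAct_X (μ : Fin D) (b : LocalForm K) :
    opAct K (MvPolynomial.X μ) b = -totalDeriv K μ b := by
  rw [opAct, (exists_opAct K).choose_spec μ]
  rfl

theorem opAct_C (c : ℝ) (b : LocalForm K) : opAct K (MvPolynomial.C c) b = c • b := by
  rw [← MvPolynomial.algebraMap_eq, AlgHom.commutes, Module.algebraMap_end_apply]

theorem opAct_mul (r s : Op D) (b : LocalForm K) : opAct K (r * s) b = opAct K r (opAct K s b) := by
  rw [map_mul, Module.End.mul_apply]

theorem opAct_comm {X : LocalForm K →ₗ[ℝ] LocalForm K}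
    (h : ∀ μ b, X (totalDeriv K μ b) = totalDeriv K μ (X b)) (r : Op D) (b : LocalForm K) :
    X (opAct K r b) = opAct K r (X b) := by
  induction r using MvPolynomial.induction_on generalizing b with
  | C c => rw [opAct_C, opAct_C, map_smul]
  | add r s hr hs => rw [map_add, LinearMap.add_apply, map_add, hr, hs, LinearMap.add_apply]
  | mul_X r μ hr => rw [opAct_mul, opAct_mul, hr, opAct_X, opAct_X, map_neg, h]

theorem opAct_mem_forms (r : Op D) {p q : ℤ} {b : LocalForm K} (hb : b ∈ forms K p q) :
    opAct K r b ∈ forms K p q := by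
  induction r using MvPolynomial.induction_on generalizing b with
  | C c => rw [opAct_C]; exact Submodule.smul_mem _ _ hb
  | add r s hr hs => rw [map_add, LinearMap.add_apply]; exact add_mem (hr hb) (hs hb)
  | mul_X r μ hr => rw [opAct_mul, opAct_X]; exact hr (neg_mem (totalDeriv_mem_forms μ hb))

/-! ### Euler–Lagrange derivatives -/

/-- The map `f ⊗ (r ⊗ a) ↦ r(-∂) (f ⊗ a)`. -/
def contract (K : CoeffClass D) : K.Fn ⊗[ℝ] (Op D ⊗[ℝ] Alg D) →ₗ[ℝ] LocalForm K :=
  TensorProduct.lift (opAct K).toLinearMap ∘ₗ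
    (TensorProduct.leftComm ℝ K.Fn (Op D) (Alg D)).toLinearMap

theorem contract_tmul (f : K.Fn) (r : Op D) (a : Alg D) :
    contract K (f ⊗ₜ[ℝ] (r ⊗ₜ[ℝ] a)) = opAct K r (f ⊗ₜ[ℝ] a) := rfl

theorem contract_coeff_mul (f : K.Fn) (r : Op D) (x : Op D ⊗[ℝ] Alg D) :
    contract K (f ⊗ₜ[ℝ] ((r ⊗ₜ[ℝ] 1) * x)) = opAct K r (contract K (f ⊗ₜ[ℝ] x)) := by
  induction x using TensorProduct.induction_on with
  | zero => simp
  | tmul s a =>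
    rw [Algebra.TensorProduct.tmul_mul_tmul, one_mul, contract_tmul, contract_tmul, opAct_mul]
  | add x y hx hy =>
    rw [mul_add, TensorProduct.tmul_add, map_add, hx, hy, TensorProduct.tmul_add, map_add, map_add]

theorem contract_koszul (f : K.Fn) (x : Op D ⊗[ℝ] Alg D) :
    contract K (f ⊗ₜ[ℝ] koszulData.der.lTensor (Op D) x) = δ K (contract K (f ⊗ₜ[ℝ] x)) := by
  induction x using TensorProduct.induction_on with
  | zero => simp
  | tmul s a => rw [LinearMap.lTensor_tmul, contract_tmul, contract_tmul, opAct_comm δ_totalDeriv, δ_tmul]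
  | add x y hx hy =>
    rw [map_add, TensorProduct.tmul_add, map_add, hx, hy, TensorProduct.tmul_add, map_add, map_add]

theorem contract_partial (μ : Fin D) (f : K.Fn) (x : Op D ⊗[ℝ] Alg D) :
    contract K (K.pd μ f ⊗ₜ[ℝ] x) + contract K (f ⊗ₜ[ℝ] (partialData μ).der.lTensor (Op D) x) =
      totalDeriv K μ (contract K (f ⊗ₜ[ℝ] x)) := by
  induction x using TensorProduct.induction_on with
  | zero => simp
  | tmul s a =>
    rw [LinearMap.lTensor_tmul, contract_tmul, contract_tmul, contract_tmul,
      opAct_comm (totalDeriv_comm μ), totalDeriv_tmul, map_add]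
  | add x y hx hy =>
    simp only [map_add, TensorProduct.tmul_add, ← hx, ← hy]
    abel

/-- The Euler–Lagrange derivative with respect to the variable with label `l`. -/
def eulerLagrange (K : CoeffClass D) (l : Lab D) : LocalForm K →ₗ[ℝ] LocalForm K :=
  contract K ∘ₗ (frechet l).lTensor K.Fn

theorem eulerLagrange_tmul (l : Lab D) (f : K.Fn) (a : Alg D) :
    eulerLagrange K l (f ⊗ₜ[ℝ] a) = contract K (f ⊗ₜ[ℝ] frechet l a) := rfl

/-- The extra factor X_μ in `frechet_partial` acts as -∂_μ and cancels the total derivative of the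
remaining terms. -/
theorem eulerLagrange_totalDeriv (l : Lab D) (μ : Fin D) (b : LocalForm K) :
    eulerLagrange K l (totalDeriv K μ b) = 0 := by
  induction b using TensorProduct.induction_on with
  | zero => simp
  | tmul f a =>
    rw [totalDeriv_tmul, map_add, eulerLagrange_tmul, eulerLagrange_tmul, frechet_partial,
      TensorProduct.tmul_add, map_add, ← add_assoc, contract_partial, contract_coeff_mul, opAct_X,
      add_neg_cancel]
  | add b c hb hc => rw [map_add, map_add, hb, hc, add_zero]

/-- The differential induced by `δ` on the Euler–Lagrange derivatives. -/
def dualKoszul (x : Lab D → LocalForm K) (l : Lab D) : LocalForm K :=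
  (-1 : ℝ) ^ l.parity • δ K (x l) + ∑ m, opAct K (koszulMat l m) (x m)

theorem eulerLagrange_δ (l : Lab D) (b : LocalForm K) :
    eulerLagrange K l (δ K b) = dualKoszul (fun m => eulerLagrange K m b) l := by
  unfold dualKoszul
  induction b using TensorProduct.induction_on with
  | zero => simp
  | tmul f a =>
    simp only [δ_tmul, eulerLagrange_tmul, frechet_koszul, TensorProduct.tmul_add,
      TensorProduct.tmul_smul, TensorProduct.tmul_sum, map_add, map_smul, map_sum,
      contract_coeff_mul, contract_koszul]
  | add b c hb hc =>
    simp only [map_add, hb, hc, smul_add, Finset.sum_add_distrib]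
    abel

theorem dualKoszul_sub (x y : Lab D → LocalForm K) (l : Lab D) :
    dualKoszul (fun m => x m - y m) l = dualKoszul x l - dualKoszul y l := by
  simp only [dualKoszul, map_sub, smul_sub, Finset.sum_sub_distrib]
  abel

theorem sum_koszulMat_mul (l n : Lab D) : ∑ m, koszulMat l m * koszulMat m n = 0 := by
  have h := congrFun (koszulLin_koszulLin (Pi.single n (1 : Op D))) l
  rw [koszulLin_apply_apply] at h
  simp only [Pi.zero_apply] at h
  rw [← h]
  refine Finset.sum_congr rfl fun m _ => ?_
  rw [koszulLin_single, one_smul, mul_comm]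
  rfl

/-- The squares of δ and of its matrix vanish separately, and the cross terms cancel because
adjacent levels have opposite parity. -/
theorem dualKoszul_dualKoszul (x : Lab D → LocalForm K) (l : Lab D) :
    dualKoszul (dualKoszul x) l = 0 := by
  have h1 : ∑ m, opAct K (koszulMat l m) (∑ n, opAct K (koszulMat m n) (x n)) = 0 := by
    simp only [map_sum, ← opAct_mul]
    rw [Finset.sum_comm]
    refine Finset.sum_eq_zero fun n _ => ?_
    rw [← LinearMap.sum_apply, ← map_sum, sum_koszulMat_mul, map_zero, LinearMap.zero_apply]
  have h2 : ∑ m, ((-1 : ℝ) ^ l.parity • opAct K (koszulMat l m) (δ K (x m)) +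
      (-1 : ℝ) ^ m.parity • opAct K (koszulMat l m) (δ K (x m))) = 0 := by
    refine Finset.sum_eq_zero fun m _ => ?_
    by_cases h : m.lev = l.lev + 1
    · have := neg_one_pow_mul_congr (Lab.parity_add_one_of_lev h) 1
      rw [one_mul, one_mul] at this
      rw [this, ← add_smul, pow_succ]
      simp
    · simp [koszulMat_eq_zero h]
  unfold dualKoszul
  simp only [map_add, map_smul, map_sum, δ_δ, smul_zero, zero_add,
    Finset.sum_add_distrib, opAct_comm δ_totalDeriv] at h1 h2 ⊢
  rw [h1, add_zero, Finset.smul_sum]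
  exact h2

theorem dualKoszul_mem_forms {p q : ℤ} {x : Lab D → LocalForm K}
    (h : ∀ l, x l ∈ forms K p (q + 1 - l.antigh)) (l : Lab D) :
    dualKoszul x l ∈ forms K p (q - l.antigh) := by
  refine add_mem (Submodule.smul_mem _ _ ?_) (sum_mem fun m _ => ?_)
  · have := δ_mem_forms (h l)
    convert this using 2
    ring
  · by_cases hm : m.lev = l.lev + 1
    · have := opAct_mem_forms (koszulMat l m) (h m)
      rw [Lab.antigh_add_one_of_lev hm] at this
      convert this using 2
      ring
    · rw [koszulMat_eq_zero hm, map_zero]; exact zero_mem _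

/-- This is the origin of the bound on q: for q > 3 all Euler–Lagrange derivatives have positive
antifield number. -/
theorem Lab.antigh_le (l : Lab D) : l.antigh ≤ 3 := by
  cases l <;> simp [Lab.antigh, Lab.at, Gen.antigh]

/-- At the highest occupied level the matrix term drops out, so the components there are δ-closed
and hence δ-exact. Subtracting `dualKoszul` of their primitives empties that level without creating
higher ones, and the induction descends. -/
theorem exists_dualKoszul_eq_of_lev (hD : 4 < D) {p q : ℤ} (hq : 3 < q) (n : ℕ)
    {x : Lab D → LocalForm K} (hx : ∀ l, x l ∈ forms K p (q - l.antigh))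
    (h : ∀ l, dualKoszul x l = 0) (hn : ∀ l : Lab D, n ≤ l.lev → x l = 0) :
    ∃ y : Lab D → LocalForm K, (∀ l, y l ∈ forms K p (q + 1 - l.antigh)) ∧
      ∀ l, dualKoszul y l = x l := by
  induction n generalizing x with
  | zero =>
    refine ⟨fun _ => 0, fun l => zero_mem _, fun l => ?_⟩
    simp [dualKoszul, hn l (Nat.zero_le _)]
  | succ n ih =>
    have hz : ∀ l : Lab D, ∃ z ∈ forms K p (q + 1 - l.antigh),
        (l.lev = n → δ K z = (-1 : ℝ) ^ l.parity • x l) ∧ (l.lev ≠ n → z = 0) := by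
      intro l
      by_cases hl : l.lev = n
      · have h0 : δ K (x l) = 0 := by
          have h1 := h l
          rw [dualKoszul, Finset.sum_eq_zero, add_zero, smul_eq_zero] at h1
          · exact h1.resolve_left (pow_ne_zero _ (by norm_num))
          · intro m _
            by_cases hm : m.lev = l.lev + 1
            · rw [hn m (by omega), map_zero]
            · rw [koszulMat_eq_zero hm, map_zero, LinearMap.zero_apply]
        have := l.antigh_le
        obtain ⟨z, hz, hz'⟩ := exists_δ_eq hD (by omega) (hx l) h0
        refine ⟨(-1 : ℝ) ^ l.parity • z, Submodule.smul_mem _ _ ?_, fun _ => ?_, fun h => absurd hl h⟩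
        · convert hz using 2
          ring
        · rw [map_smul, hz']
      · exact ⟨0, zero_mem _, fun h => absurd h hl, fun _ => rfl⟩
    choose z hz1 hz2 hz3 using hz
    have hsum : ∀ l : Lab D, n ≤ l.lev → ∑ m, opAct K (koszulMat l m) (z m) = 0 := by
      intro l hl
      refine Finset.sum_eq_zero fun m _ => ?_
      by_cases hm : m.lev = l.lev + 1
      · rw [hz3 m (by omega), map_zero]
      · rw [koszulMat_eq_zero hm, map_zero, LinearMap.zero_apply]
    obtain ⟨y, hy1, hy2⟩ := ih (x := fun l => x l - dualKoszul z l)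
      (fun l => sub_mem (hx l) (dualKoszul_mem_forms hz1 l))
      (fun l => by rw [dualKoszul_sub, h, dualKoszul_dualKoszul, sub_zero])
      (fun l hl => by
        rw [dualKoszul, hsum l hl, add_zero]
        by_cases hl' : l.lev = n
        · rw [hz2 l hl', smul_smul, ← pow_add, ← two_mul, pow_mul]
          simp
        · rw [hz3 l hl', hn l (by omega)]
          simp)
    refine ⟨fun l => z l - (-1 : ℝ) • y l, fun l =>
      sub_mem (hz1 l) (Submodule.smul_mem _ _ (hy1 l)), fun l => ?_⟩
    have e : dualKoszul (fun l => (-1 : ℝ) • y l) l = (-1 : ℝ) • dualKoszul y l := by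
      simp only [dualKoszul, map_smul, smul_add, Finset.smul_sum]
      rw [smul_comm]
    rw [dualKoszul_sub z fun l => (-1 : ℝ) • y l, e, hy2]
    module

/-- In antifield number greater than three `dualKoszul` has no cohomology. -/
theorem exists_dualKoszul_eq (hD : 4 < D) {p q : ℤ} (hq : 3 < q)
    {x : Lab D → LocalForm K} (hx : ∀ l, x l ∈ forms K p (q - l.antigh))
    (h : ∀ l, dualKoszul x l = 0) :
    ∃ y : Lab D → LocalForm K, (∀ l, y l ∈ forms K p (q + 1 - l.antigh)) ∧
      ∀ l, dualKoszul y l = x l :=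
  exists_dualKoszul_eq_of_lev hD hq 6 hx h fun l hl => absurd l.lev_lt (by omega)

/-- The span of the `r ⊗ a` with `a` of form degree `p` and antifield number `q`. -/
def opForms (D : ℕ) (p q : ℤ) : Submodule ℝ (Op D ⊗[ℝ] Alg D) :=
  Submodule.span ℝ {x | ∃ r : Op D, ∃ a ∈ formsA D p q, x = r ⊗ₜ[ℝ] a}

theorem frechet_mem_opForms (l : Lab D) {p q : ℤ} {a : Alg D} (ha : a ∈ formsA D p q) :
    frechet l a ∈ opForms D p (q - l.antigh) := by
  refine Submodule.span_le (p := (opForms D p (q - l.antigh)).comap (frechet l)).2 ?_ ha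
  rintro _ ⟨s, rfl, rfl, rfl⟩
  rw [SetLike.mem_coe, Submodule.mem_comap]
  clear ha
  induction s with
  | nil => simp [(isTDer_frechet l).one]
  | cons g s ih =>
    simp only [List.map_cons, List.prod_cons, List.sum_cons]
    rw [(isTDer_frechet l).gen_mul, frechet_gen]
    refine add_mem ?_ (Submodule.smul_mem _ _ ?_)
    · by_cases h0 : cls g l = 0
      · simp [h0]
      · refine Submodule.subset_span ⟨cls g l, (s.map gen).prod, ?_, by simp⟩
        rcases g.eq_dx_or_at with ⟨μ, rfl⟩ | ⟨m, k, rfl⟩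
        · simp [cls] at h0
        · have hk : l.kind = m.kind := by
            by_contra hk
            exact h0 (cls_at_of_kind hk k)
          refine Submodule.subset_span ⟨s, by simp, ?_, rfl⟩
          simp [Lab.antigh_eq_of_kind hk]
    · rw [Algebra.TensorProduct.includeRight_apply]
      generalize frechet l (s.map gen).prod = x at ih ⊢
      induction ih using Submodule.span_induction with
      | mem x hx =>
        obtain ⟨r, a, ha, rfl⟩ := hx
        refine Submodule.subset_span ⟨r, gen g * a, ?_, by simp⟩
        have := mul_mem_formsA (gen_mem_formsA g) ha
        rwa [← add_sub_assoc] at this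
      | zero => simp
      | add x y _ _ hx hy => rw [mul_add]; exact add_mem hx hy
      | smul c x _ hx => rw [mul_smul_comm]; exact Submodule.smul_mem _ _ hx

theorem eulerLagrange_mem_forms (l : Lab D) {p q : ℤ} {b : LocalForm K} (hb : b ∈ forms K p q) :
    eulerLagrange K l b ∈ forms K p (q - l.antigh) := by
  refine forms_le (S := (forms K p (q - l.antigh)).comap (eulerLagrange K l)) (fun f a ha => ?_) hb
  rw [Submodule.mem_comap, eulerLagrange_tmul]
  refine Submodule.span_le (p := (forms K p (q - l.antigh)).comap
    (contract K ∘ₗ TensorProduct.mk ℝ _ _ f)).2 ?_ (frechet_mem_opForms l ha)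
  rintro _ ⟨r, a, ha, rfl⟩
  exact opAct_mem_forms r (tmul_mem_forms f ha)

/-! ### The number operator -/

/-- The derivation which counts the variables other than the `dx`. -/
def numberData (D : ℕ) : DerData D 0 where
  val g := toAlg (cls g)
  superComm g := by
    rcases g.eq_dx_or_at with ⟨μ, rfl⟩ | ⟨l, k, rfl⟩
    · simp only [cls, map_zero]; exact SuperComm.zero _
    · rw [toAlg_cls_at]; exact superComm_gen _
  lin v hv := by
    have := Finsupp.apply_linearCombination ℝ toAlg cls v
    rw [linearCombination_cls hv, map_zero] at this
    exact this.symm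

theorem number_gen_at (l : Lab D) (k : Multiset (Fin D)) :
    (numberData D).der (gen (l.at k)) = gen (l.at k) := by
  rw [DerData.der_gen]
  exact toAlg_cls_at l k

theorem number_gen_dx (μ : Fin D) : (numberData D).der (gen (.dx μ)) = 0 := by
  rw [DerData.der_gen]
  exact map_zero _

theorem number_hasParity (g : Gen D) : HasParity g.parity ((numberData D).der (gen g)) := by
  rcases g.eq_dx_or_at with ⟨ν, rfl⟩ | ⟨l, k, rfl⟩
  · rw [number_gen_dx]; exact HasParity.zero _
  · rw [number_gen_at]; exact hasParity_gen _

theorem number_toAlg (v : Lin D) : (numberData D).der (toAlg v) = toAlg v := by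
  induction v using lin_induction with
  | zero => simp
  | single l k => rw [toAlg_single, genOp_mono, number_gen_at]
  | add v w hv hw => rw [map_add, map_add, hv, hw]
  | smul c v hv => rw [map_smul, map_smul, hv]

theorem koszul_number (a : Alg D) :
    koszulData.der ((numberData D).der a) = (numberData D).der (koszulData.der a) := by
  have h := (numberData D).isDer.bracket koszulData.isDer number_hasParity koszul_hasParity
  have h0 := h.ext (isDer_zero _) fun g => by
    rcases g.eq_dx_or_at with ⟨ν, rfl⟩ | ⟨l, k, rfl⟩
    · simp [number_gen_dx, koszul_gen_dx, -DerData.der_gen]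
    · simp [number_gen_at, koszul_gen_eq, number_toAlg, -DerData.der_gen]
  have := LinearMap.congr_fun h0 a
  simp only [zero_mul, pow_zero, one_smul, LinearMap.sub_apply, LinearMap.comp_apply,
    LinearMap.zero_apply, sub_eq_zero] at this
  exact this.symm

theorem number_partial (μ : Fin D) (a : Alg D) :
    (numberData D).der ((partialData μ).der a) = (partialData μ).der ((numberData D).der a) := by
  have h := (numberData D).isDer.bracket (partialData (D := D) μ).isDer
    number_hasParity (partial_hasParity μ)
  have h0 := h.ext (isDer_zero _) fun g => by
    rcases g.eq_dx_or_at with ⟨ν, rfl⟩ | ⟨l, k, rfl⟩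
    · simp [partial_gen_dx, number_gen_dx, -DerData.der_gen]
    · simp [partial_gen_at, number_gen_at, -DerData.der_gen]
  have := LinearMap.congr_fun h0 a
  simpa [sub_eq_zero] using this

theorem number_mem_formsA {p q : ℤ} {a : Alg D} (ha : a ∈ formsA D p q) :
    (numberData D).der a ∈ formsA D p q := by
  have := (numberData D).isDer.mem_formsA (dp := 0) (dq := 0) (fun g => ?_) ha
  · simpa using this
  rcases g.eq_dx_or_at with ⟨ν, rfl⟩ | ⟨l, k, rfl⟩
  · rw [number_gen_dx]; exact zero_mem _
  · rw [number_gen_at]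
    simpa using gen_mem_formsA (l.at k)

theorem number_list (l : List (Gen D)) : ∃ n : ℕ,
    (numberData D).der (l.map gen).prod = (n : ℝ) • (l.map gen).prod ∧
      ((l.map Gen.antigh).sum ≠ 0 → 1 ≤ n) := by
  induction l with
  | nil => exact ⟨0, by simp [(numberData D).isDer.one], fun h => by simp at h⟩
  | cons g l ih =>
    obtain ⟨n, h1, h2⟩ := ih
    simp only [List.map_cons, List.prod_cons, List.sum_cons]
    rw [(numberData D).isDer.apply_gen_mul, h1, zero_mul, pow_zero, one_smul]
    rcases g.eq_dx_or_at with ⟨ν, rfl⟩ | ⟨m, k, rfl⟩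
    · exact ⟨n, by rw [number_gen_dx, zero_mul, zero_add, mul_smul_comm], by simpa [Gen.antigh]⟩
    · refine ⟨n + 1, ?_, fun _ => by omega⟩
      rw [number_gen_at, mul_smul_comm]
      push_cast
      module

/-- A word of nonzero antifield number contains at least one variable. -/
theorem mem_eigenSpan_number {p q : ℤ} (hq : q ≠ 0) {x : LocalForm K} (hx : x ∈ forms K p q) :
    x ∈ eigenSpan ((numberData D).der.lTensor K.Fn) 1 := by
  refine Submodule.span_le.2 ?_ hx
  rintro _ ⟨f, l, -, h2, rfl⟩
  obtain ⟨n, h3, h4⟩ := number_list l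
  refine Submodule.subset_span ⟨n, h4 (by rw [h2]; exact hq), ?_⟩
  rw [LinearMap.lTensor_tmul, h3, TensorProduct.tmul_smul]

theorem superComm_genOp (l : Lab D) (r : Op D) : SuperComm l.parity (genOp l r) := by
  induction r using op_induction with
  | mono k => rw [genOp_mono, ← parity_at l k]; exact superComm_gen _
  | add r s hr hs => rw [map_add]; exact hr.add hs
  | smul c r hr => rw [map_smul]; exact hr.smul c

theorem genOp_mem_formsA (l : Lab D) (r : Op D) : genOp l r ∈ formsA D 0 l.antigh := by
  induction r using op_induction with
  | mono k => rw [genOp_mono]; simpa using gen_mem_formsA (l.at k)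
  | add r s hr hs => rw [map_add]; exact add_mem hr hs
  | smul c r hr => rw [map_smul]; exact Submodule.smul_mem _ _ hr

theorem partial_genOp (l : Lab D) (μ : Fin D) (r : Op D) :
    (partialData μ).der (genOp l r) = genOp l (MvPolynomial.X μ * r) := by
  rw [← toAlg_single, partial_toAlg, ← Pi.single_smul, toAlg_single, smul_eq_mul]

/-- The map `r ⊗ a ↦ r(∂)z a`, with `z` the variable with label `l`. -/
def pairing (l : Lab D) : Op D ⊗[ℝ] Alg D →ₗ[ℝ] Alg D :=
  TensorProduct.lift (LinearMap.mul ℝ (Alg D) ∘ₗ genOp l)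

theorem pairing_tmul (l : Lab D) (r : Op D) (a : Alg D) :
    pairing l (r ⊗ₜ[ℝ] a) = genOp l r * a := rfl

theorem pairing_gen_mul (l : Lab D) (g : Gen D) (x : Op D ⊗[ℝ] Alg D) :
    pairing l (((1 : Op D) ⊗ₜ[ℝ] gen g) * x) =
      (-1 : ℝ) ^ (l.parity * g.parity) • (gen g * pairing l x) := by
  induction x using TensorProduct.induction_on with
  | zero => simp
  | tmul r a =>
    rw [Algebra.TensorProduct.tmul_mul_tmul, one_mul, pairing_tmul, pairing_tmul, ← mul_assoc,
      superComm_genOp l r g, smul_mul_assoc, mul_assoc]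
  | add x y hx hy => rw [mul_add, map_add, hx, hy, map_add, mul_add, smul_add]

/-- Euler's formula for the number operator. -/
theorem number_eq_sum (a : Alg D) : (numberData D).der a = ∑ l, pairing l (frechet l a) := by
  suffices (numberData D).der = ∑ l, pairing l ∘ₗ frechet l by simp [this]
  refine linearMap_ext_gen_mul ?_ fun g a ha => ?_
  · simp [(numberData D).isDer.one, (isTDer_frechet _).one]
  · simp only [LinearMap.sum_apply, LinearMap.comp_apply] at ha ⊢
    rw [(numberData D).isDer.apply_gen_mul, ha, zero_mul, pow_zero, one_smul, DerData.der_gen,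
      Finset.mul_sum]
    change toAlg (cls g) * a + _ = _
    rw [toAlg_apply, Finset.sum_mul, ← Finset.sum_add_distrib]
    refine Finset.sum_congr rfl fun l _ => ?_
    rw [(isTDer_frechet l).gen_mul, map_add, map_smul, frechet_gen,
      Algebra.TensorProduct.includeRight_apply, Algebra.TensorProduct.includeRight_apply,
      Algebra.TensorProduct.tmul_mul_tmul, mul_one, one_mul, pairing_tmul, pairing_gen_mul,
      smul_smul, ← pow_add, ← two_mul, pow_mul]
    simp

/-! ### Integration by parts -/

/-- The sums of total derivatives of local forms of form degree `p` and antifield number `q`. -/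
def divergences (K : CoeffClass D) (p q : ℤ) : Submodule ℝ (LocalForm K) :=
  ⨆ μ, (forms K p q).map (totalDeriv K μ)

theorem totalDeriv_mem_divergences (μ : Fin D) {p q : ℤ} {b : LocalForm K} (hb : b ∈ forms K p q) :
    totalDeriv K μ b ∈ divergences K p q :=
  Submodule.mem_iSup_of_mem μ (Submodule.mem_map_of_mem hb)

/-- One derivative is moved at a time by the Leibniz rule. The operator s already acting on the
variable is what keeps the induction on r going. -/
theorem integration_by_parts (l : Lab D) (r s : Op D) {p q : ℤ} {b : LocalForm K}
    (hb : b ∈ forms K p q) : mulL K (genOp l s) (opAct K r b) - mulL K (genOp l (r * s)) b ∈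
      divergences K p (l.antigh + q) := by
  induction r using MvPolynomial.induction_on generalizing b s with
  | C c =>
    rw [opAct_C, ← MvPolynomial.smul_eq_C_mul, map_smul, map_smul, map_smul, LinearMap.smul_apply,
      sub_self]
    exact zero_mem _
  | add r r' hr hr' =>
    have := add_mem (hr s hb) (hr' s hb)
    convert this using 1
    simp only [map_add, LinearMap.add_apply, add_mul]
    abel
  | mul_X r μ hr =>
    have h1 := hr s (b := opAct K (MvPolynomial.X μ) b) (opAct_mem_forms _ hb)
    have h2 : totalDeriv K μ (mulL K (genOp l (r * s)) b) ∈ divergences K p (l.antigh + q) := by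
      refine totalDeriv_mem_divergences μ ?_
      simpa using mulL_mem_forms (genOp_mem_formsA l (r * s)) hb
    have := sub_mem h1 h2
    convert this using 1
    rw [totalDeriv_mulL, partial_genOp, opAct_mul, opAct_X, map_neg, map_neg, map_neg,
      mul_comm r, mul_assoc]
    abel

/-- In Euler's formula all derivatives are shifted from the variables to their coefficients, leaving
undifferentiated variables times Euler–Lagrange derivatives. -/
theorem number_sub_mem_divergences {p q : ℤ} {b : LocalForm K} (hb : b ∈ forms K p q) :
    (numberData D).der.lTensor K.Fn b - ∑ l : Lab D, mulL K (gen (l.at 0)) (eulerLagrange K l b) ∈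
      divergences K p q := by
  have key := forms_le (S := (divergences K p q).comap ((numberData D).der.lTensor K.Fn -
    ∑ l : Lab D, mulL K (gen (l.at 0)) ∘ₗ eulerLagrange K l)) (fun f a ha => ?_) hb
  · simpa using key
  rw [Submodule.mem_comap, LinearMap.sub_apply, LinearMap.lTensor_tmul, number_eq_sum,
    TensorProduct.tmul_sum, LinearMap.sum_apply, ← Finset.sum_sub_distrib]
  refine sum_mem fun l _ => ?_
  rw [LinearMap.comp_apply, eulerLagrange_tmul]
  have h := frechet_mem_opForms l ha
  refine Submodule.span_le (p := (divergences K p q).comap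
    ((TensorProduct.mk ℝ K.Fn (Alg D) f) ∘ₗ pairing l -
      mulL K (gen (l.at 0)) ∘ₗ contract K ∘ₗ TensorProduct.mk ℝ _ _ f)).2 ?_ h
  rintro _ ⟨r, a, ha, rfl⟩
  have := integration_by_parts l r 1 (tmul_mem_forms f ha)
  rw [add_sub_cancel, mul_one, ← mono_zero, genOp_mono] at this
  rw [SetLike.mem_coe, Submodule.mem_comap, ← neg_mem_iff]
  convert this using 1
  rw [LinearMap.sub_apply, neg_sub]
  rfl

/-! ### Divergences in top form degree -/

theorem gen_dx_mul_self (μ : Fin D) : gen (.dx μ) * gen (.dx μ) = (0 : Alg D) := by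
  have h := gen_comm (.dx μ) (.dx μ)
  simp only [Gen.parity, mul_one, pow_one, neg_smul, one_smul] at h
  have h2 : (2 : ℝ) • (gen (.dx μ) * gen (.dx μ) : Alg D) = 0 := by
    rw [two_smul]
    exact add_eq_zero_iff_eq_neg.2 h
  exact (smul_eq_zero.1 h2).resolve_left two_ne_zero

theorem gen_dx_mul_prod {μ : Fin D} {l : List (Gen D)} (h : Gen.dx μ ∈ l) :
    gen (.dx μ) * (l.map gen).prod = 0 := by
  induction l with
  | nil => simp at h
  | cons g l ih =>
    rw [List.map_cons, List.prod_cons, ← mul_assoc]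
    rcases List.mem_cons.1 h with rfl | h
    · rw [gen_dx_mul_self, zero_mul]
    · rw [gen_comm, smul_mul_assoc, mul_assoc, ih h, mul_zero, smul_zero]

open scoped Classical in
theorem count_dx_le_one {l : List (Gen D)} (h : (l.map gen).prod ≠ 0) (μ : Fin D) :
    l.count (.dx μ) ≤ 1 := by
  induction l with
  | nil => simp
  | cons g l ih =>
    rw [List.map_cons, List.prod_cons] at h
    by_cases hg : g = .dx μ
    · subst hg
      have : Gen.dx μ ∉ l := fun hl => h (gen_dx_mul_prod hl)
      rw [List.count_cons_self, List.count_eq_zero_of_not_mem this]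
    · rw [List.count_cons_of_ne hg]
      exact ih (right_ne_zero_of_mul h)

open scoped Classical in
theorem sum_formDeg (l : List (Gen D)) :
    (l.map Gen.formDeg).sum = ∑ μ, (l.count (.dx μ) : ℤ) := by
  induction l with
  | nil => simp
  | cons g l ih =>
    simp only [List.map_cons, List.sum_cons, ih, List.count_cons, Nat.cast_add,
      Finset.sum_add_distrib]
    rw [add_comm]
    congr 1
    cases g <;> simp [Gen.formDeg]

/-- By pigeonhole some dx occurs twice, and a repeated dx gives zero. -/
theorem formsA_eq_zero {p q : ℤ} (hp : (D : ℤ) < p) {a : Alg D} (ha : a ∈ formsA D p q) : a = 0 := by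
  refine (Submodule.mem_bot ℝ).1 (Submodule.span_le.2 ?_ ha)
  rintro _ ⟨l, h1, -, rfl⟩
  by_contra h
  classical
  rw [sum_formDeg] at h1
  have : ∑ μ : Fin D, (l.count (.dx μ) : ℤ) ≤ ∑ _μ : Fin D, 1 :=
    Finset.sum_le_sum fun μ _ => mod_cast count_dx_le_one h μ
  simp at this
  omega

/-- The contraction with the coordinate vector field `∂/∂x^ν`. -/
def contractionData (ν : Fin D) : DerData D 1 where
  val
    | .dx μ => if μ = ν then 1 else 0
    | _ => 0
  superComm g := by
    cases g
    case dx μ =>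
      have h1 : SuperComm 0 (1 : Alg D) := fun g => by simp
      by_cases h : μ = ν
      · simp only [h, if_true]; exact h1.congr (by simp [Gen.parity])
      · simp only [h, if_false]; exact SuperComm.zero _
    all_goals exact SuperComm.zero _
  lin v hv := by cases hv <;> simp

theorem contraction_gen_dx (μ ν : Fin D) :
    (contractionData ν).der (gen (.dx μ)) = if μ = ν then 1 else 0 := by
  rw [DerData.der_gen]
  rfl

theorem contraction_gen_at (ν : Fin D) (l : Lab D) (k : Multiset (Fin D)) :
    (contractionData ν).der (gen (l.at k)) = 0 := by
  rw [DerData.der_gen]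
  cases l <;> rfl

theorem contraction_hasParity (ν : Fin D) (g : Gen D) :
    HasParity (g.parity + 1) ((contractionData ν).der (gen g)) := by
  rcases g.eq_dx_or_at with ⟨μ, rfl⟩ | ⟨l, k, rfl⟩
  · rw [contraction_gen_dx]
    split_ifs
    · intro ε
      simp [Gen.parity, mul_comm ε, pow_mul]
    · exact HasParity.zero _
  · rw [contraction_gen_at]; exact HasParity.zero _

theorem contraction_partial (μ ν : Fin D) (a : Alg D) :
    (contractionData ν).der ((partialData μ).der a) =
      (partialData μ).der ((contractionData ν).der a) := by
  have h := (partialData (D := D) μ).isDer.bracket (contractionData ν).isDer (partial_hasParity μ)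
    (contraction_hasParity ν)
  have h0 := h.ext (isDer_zero _) fun g => by
    rcases g.eq_dx_or_at with ⟨κ, rfl⟩ | ⟨l, k, rfl⟩
    · have : (partialData (D := D) μ).der (if κ = ν then 1 else 0) = 0 := by
        split_ifs
        · exact (partialData μ).isDer.one
        · exact map_zero _
      simp [partial_gen_dx, contraction_gen_dx, this, -DerData.der_gen]
    · simp [partial_gen_at, contraction_gen_at, -DerData.der_gen]
  have := LinearMap.congr_fun h0 a
  simp only [zero_mul, pow_zero, one_smul, LinearMap.sub_apply, LinearMap.comp_apply,
    LinearMap.zero_apply, sub_eq_zero] at this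
  exact this.symm

theorem contraction_mem_formsA (ν : Fin D) {p q : ℤ} {a : Alg D} (ha : a ∈ formsA D p q) :
    (contractionData ν).der a ∈ formsA D (p - 1) q := by
  have := (contractionData ν).isDer.mem_formsA (dp := -1) (dq := 0) (fun g => ?_) ha
  · simpa [sub_eq_add_neg] using this
  rcases g.eq_dx_or_at with ⟨μ, rfl⟩ | ⟨l, k, rfl⟩
  · rw [contraction_gen_dx]
    split_ifs
    · simpa [Gen.formDeg, Gen.antigh] using one_mem_formsA
    · exact zero_mem _
  · rw [contraction_gen_at]; exact zero_mem _

/-- Multiplication by dx^μ kills a top form for degree reasons; contracting that vanishing product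
with ∂/∂x^ν gives the formula. -/
theorem mulL_dx_contraction (μ ν : Fin D) {q : ℤ} {c : LocalForm K} (hc : c ∈ forms K D q) :
    mulL K (gen (.dx μ)) ((contractionData ν).der.lTensor K.Fn c) = if μ = ν then c else 0 := by
  have key := forms_le (S := LinearMap.ker (mulL K (gen (.dx μ)) ∘ₗ
    (contractionData ν).der.lTensor K.Fn - if μ = ν then LinearMap.id else 0))
    (fun f a ha => ?_) hc
  · rw [LinearMap.mem_ker, LinearMap.sub_apply, sub_eq_zero, LinearMap.comp_apply] at key
    rw [key]
    split_ifs <;> rfl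
  have h0 : gen (.dx μ) * a = 0 :=
    formsA_eq_zero (q := 0 + q) (by simp [Gen.formDeg]) (mul_mem_formsA (gen_mem_formsA (.dx μ)) ha)
  have h1 := (contractionData ν).isDer.apply_gen_mul (.dx μ) a
  rw [h0, map_zero, contraction_gen_dx] at h1
  simp only [Gen.parity, mul_one, pow_one, neg_smul, one_smul] at h1
  have h2 : gen (.dx μ) * (contractionData ν).der a = (if μ = ν then 1 else 0) * a :=
    (add_neg_eq_zero.1 h1.symm).symm
  rw [LinearMap.mem_ker, LinearMap.sub_apply, LinearMap.comp_apply, LinearMap.lTensor_tmul,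
    mulL_tmul, h2]
  split_ifs <;> simp

theorem d_eq_sum (b : LocalForm K) : d K b = ∑ μ, mulL K (gen (.dx μ)) (totalDeriv K μ b) := by
  rw [d, LinearMap.sum_apply]
  rfl

theorem d_eq_sum_totalDeriv (b : LocalForm K) :
    d K b = ∑ μ, totalDeriv K μ (mulL K (gen (.dx μ)) b) := by
  rw [d_eq_sum]
  refine Finset.sum_congr rfl fun μ _ => ?_
  rw [totalDeriv_mulL, partial_gen_dx, map_zero, LinearMap.zero_apply, zero_add]

/-- In top form degree divergences are exact. -/
theorem divergences_le (q : ℤ) :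
    divergences K D q ≤ (forms K (D - 1) q).map (d K) := by
  refine iSup_le fun ν => ?_
  rintro _ ⟨c, hc, rfl⟩
  -- The primitive of ∂_ν c is the contraction of c with ∂/∂x^ν: contraction commutes with ∂_μ, and
  -- only μ = ν survives.
  refine ⟨(contractionData ν).der.lTensor K.Fn c,
    lTensor_mem_forms (fun _ => contraction_mem_formsA ν) hc, ?_⟩
  rw [d_eq_sum, Finset.sum_congr rfl fun μ _ => by
    rw [← lTensor_totalDeriv (contraction_partial μ ν),
      mulL_dx_contraction μ ν (totalDeriv_mem_forms μ hc)]]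
  simp

/-! ### The main theorem -/

/-- This recognizes δ of a variable once the matrix has been integrated by parts onto the variables.
-/
theorem sum_genOp_koszulMat (m : Lab D) :
    ∑ l, genOp l (koszulMat l m) = koszulData.der (gen (m.at 0)) := by
  rw [← toAlg_linPart (koszul_gen_mem_below m 0), toAlg_apply]
  rfl

theorem mem_coboundaries (hD : 4 < D) {q : ℤ} (hq : 3 < q) {a : LocalForm K}
    (ha : a ∈ cocycles K D q) : a ∈ coboundaries K D q := by
  obtain ⟨ha, b, hb, hab⟩ := ha
  set N : Module.End ℝ (LocalForm K) := (numberData D).der.lTensor K.Fn with hN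
  have hNδ : ∀ x, δ K (N x) = N (δ K x) := fun x => by
    induction x using TensorProduct.induction_on with
    | zero => simp
    | tmul f a => simp only [hN, LinearMap.lTensor_tmul, δ_tmul, koszul_number]
    | add x y hx hy => simp only [map_add, hx, hy]
  have hNd : ∀ μ x, totalDeriv K μ (N x) = N (totalDeriv K μ x) := fun μ x =>
    (lTensor_totalDeriv (number_partial μ) x).symm
  -- Euler's formula produces N a rather than a, so it is applied to a' = f(N) a with N a' = a.
  obtain ⟨f, hf⟩ := exists_polynomial_inverse N (mem_eigenSpan_number (by omega) ha)
  set a' := Polynomial.aeval N f a with ha'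
  have ha'f : a' ∈ forms K D q := aeval_mem (fun x => lTensor_mem_forms fun _ => number_mem_formsA) f ha
  -- f(N) commutes with δ and the total derivatives, so δ a' is still a divergence and its
  -- Euler–Lagrange derivatives vanish.
  have hel : ∀ l, dualKoszul (fun m => eulerLagrange K m a') l = 0 := by
    intro l
    rw [← eulerLagrange_δ, ha', aeval_comm (T := δ K) hNδ, eq_neg_of_add_eq_zero_left hab,
      d_eq_sum_totalDeriv, map_neg, map_sum, map_neg, map_sum, neg_eq_zero]
    refine Finset.sum_eq_zero fun μ _ => ?_
    rw [← aeval_comm (T := totalDeriv K μ) (hNd μ), eulerLagrange_totalDeriv]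
  obtain ⟨y, hy, hy'⟩ := exists_dualKoszul_eq hD hq (fun l => eulerLagrange_mem_forms l ha'f) hel
  have h1 := number_sub_mem_divergences ha'f
  -- The matrix acting on y_m is moved onto the variables z_l; the antifield numbers match because
  -- only adjacent levels contribute.
  have h2 : ∑ l : Lab D, ∑ m : Lab D, (mulL K (gen (l.at 0)) (opAct K (koszulMat l m) (y m)) -
      mulL K (genOp l (koszulMat l m)) (y m)) ∈ divergences K D q := by
    refine sum_mem fun l _ => sum_mem fun m _ => ?_
    by_cases h : m.lev = l.lev + 1
    · have := integration_by_parts l (koszulMat l m) 1 (hy m)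
      rw [mul_one, ← mono_zero, genOp_mono, Lab.antigh_add_one_of_lev h] at this
      convert this using 2
      ring
    · simp [koszulMat_eq_zero h]
  -- In the Leibniz expansion of δ(Σ z_m y_m), δ z_m is written as Σ_l K_lm(∂) z_l.
  have h3 : δ K (∑ l : Lab D, mulL K (gen (l.at 0)) (y l)) =
      ∑ l : Lab D, (-1 : ℝ) ^ l.parity • mulL K (gen (l.at 0)) (δ K (y l)) +
      ∑ l : Lab D, ∑ m : Lab D, mulL K (genOp l (koszulMat l m)) (y m) := by
    rw [Finset.sum_comm, map_sum, ← Finset.sum_add_distrib]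
    refine Finset.sum_congr rfl fun m _ => ?_
    rw [δ_mulL_gen, ← LinearMap.sum_apply, ← map_sum, sum_genOp_koszulMat, parity_at, add_comm]
  have h4 : ∑ l : Lab D, mulL K (gen (l.at 0)) (eulerLagrange K l a') =
      ∑ l : Lab D, (-1 : ℝ) ^ l.parity • mulL K (gen (l.at 0)) (δ K (y l)) +
      ∑ l : Lab D, ∑ m : Lab D, mulL K (gen (l.at 0)) (opAct K (koszulMat l m) (y m)) := by
    rw [← Finset.sum_add_distrib]
    refine Finset.sum_congr rfl fun l _ => ?_
    rw [← hy', dualKoszul, map_add, map_smul, map_sum]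
  have h5 : a - δ K (∑ l : Lab D, mulL K (gen (l.at 0)) (y l)) ∈ divergences K D q := by
    have := add_mem h1 h2
    convert this using 1
    simp only [Finset.sum_sub_distrib]
    rw [h3, h4, ← hN, hf]
    abel
  rw [← add_sub_cancel (δ K (∑ l : Lab D, mulL K (gen (l.at 0)) (y l))) a]
  refine Submodule.add_mem_sup (Submodule.mem_map_of_mem (sum_mem fun l _ => ?_)) (divergences_le q h5)
  have := mulL_mem_forms (gen_mem_formsA (l.at 0)) (hy l)
  simpa using this

end HookGauge

end

theorem mainTheorem4 (D : ℕ) (hD : 4 < D) (K : HookGauge.CoeffClass D) (q : ℤ) (hq : 3 < q) :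
    Subsingleton (HookGauge.H K (D : ℤ) q) := by
  rw [HookGauge.H, Submodule.Quotient.subsingleton_iff, eq_top_iff]
  exact fun a _ => HookGauge.mem_coboundaries hD hq a.2
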